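/- Let $G\subset \mathrm{GL}_n(\mathbb R)$ be a closed Lie subgroup with Lie algebra $\mathfrak g$. Let $(P,\theta,\omega)$ be a $G$-structure with connection: $P$ is a (Hausdorff, second countable) smooth manifold of dimension $n+\dim G$ with a smooth, proper, effective and locally free right $G$-action, $\theta\in\Omega^1(P,\mathbb R^n)$ is a pointwise surjective tensorial form (it vanishes on the infinitesimal generators $\tilde\alpha$, $\alpha\in\mathfrak g$, and $g^*\theta=g^{-1}\cdot\theta$), and $\omega\in\Omega^1(P,\mathfrak g)$ is a connection form ($\omega(\tilde\alpha)=\alpha$ and $g^*\omega=\mathrm{Ad}_{g^{-1}}\circ\omega$). A form $\Omega\in\Omega^k(P)$ is *invariant* if $\Phi^*\Omega=\Omega$ for every $G$-equivariant diffeomorphism $\Phi$ between $G$-saturated open subsets of $P$ with $\Phi^*\theta=\theta$ and $\Phi^*\omega=\omega$; $\Omega^k(P,\theta,\omega)$ is the space of invariant $k$-forms, and invariant functions are invariant $0$-forms. Assume that $(P,\theta,\omega)$ is fully regular of rank $d$: for every $p\in P$ the space $\{d_pI : I \text{ an invariant function}\}\subset T_p^*P$ has dimension $d$. Let $X=P/{\sim}$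 with the quotient topology, where $p\sim q$ if there is a diffeomorphism $\Phi:U_p\to U_q$ between open neighbourhoods of $p$ and $q$ with $\Phi(p)=q$, $\Phi^*\theta=\theta$ and $\Phi^*\omega=\omega$, and let $h:P\to X$ be the quotient map. Then $X$ has a smooth structure of dimension $d$ for which $h$ is a submersion ($X$ is a manifold that is not required to be Hausdorff). For every such smooth structure, let $A=X\times(\mathbb R^n\oplus\mathfrak g)\to X$ be the trivial vector bundle, $\Omega^k(A)$ the space of smooth sections of $\wedge^kA^*$, and $H=(\theta,\omega):TP\to A$ the bundle map covering $h$. Then: 1. For every $k\ge 0$, the pullback $H^*$ is a linear isomorphism from $\Omega^k(A)$ onto the space $\Omega^k(P,\theta,\omega)$ of invariant $k$-forms. 2. There is a unique Lie algebroid structure on $A$, with anchor $\rho_A$ and algebroid differential $d_A$, for which $H:TP\to A$ is a Lie algebroid morphism, i.e. $\rho_A\circ H=dh$ and $H^*d_A=d\,H^*$ on $\Omega^k(A)$ for all $k$. -/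

import Mathlib

open Bundle Function Set
open scoped Manifold ContDiff Topology RightActions

noncomputable section

namespace GStr

/-! ### Lie algebroids, their forms and their morphisms -/

section Algebroid

variable {EM HM : Type*} [NormedAddCommGroup EM] [NormedSpace ℝ EM] [TopologicalSpace HM]
  (I : ModelWithCorners ℝ EM HM)
  {M : Type*} [TopologicalSpace M] [ChartedSpace HM M]
  (F : Type*) [NormedAddCommGroup F] [NormedSpace ℝ F]
  (A : M → Type*) [TopologicalSpace (TotalSpace F A)] [∀ x, TopologicalSpace (A x)]
  [∀ x, AddCommGroup (A x)] [∀ x, Module ℝ (A x)] [FiberBundle F A] [VectorBundle ℝ F A]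

/-- `Ω^k(A)`: the smooth sections of the bundle of alternating `k`-linear forms on the fibres of
the vector bundle `A`. Smoothness at `x₀` is tested in the trivialization of `A` around `x₀`.
For `A = TM` these are the differential `k`-forms on `M`. -/
def forms (k : ℕ) : Submodule ℝ (Π x : M, A x [⋀^Fin k]→L[ℝ] ℝ) where
  carrier := {η | ∀ x₀ : M, ContMDiffAt I 𝓘(ℝ, F [⋀^Fin k]→L[ℝ] ℝ) ∞
    (fun x => (η x).compContinuousLinearMap ((trivializationAt F A x₀).symmL ℝ x)) x₀}
  add_mem' := by
    intro η ζ hη hζ x₀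
    exact (hη x₀).add (hζ x₀)
  zero_mem' := by
    intro x₀
    exact contMDiffAt_const (c := (0 : F [⋀^Fin k]→L[ℝ] ℝ))
  smul_mem' := by
    intro c η hη x₀
    exact (contMDiffAt_const (I := I) (I' := 𝓘(ℝ, ℝ)) (c := c)).smul (hη x₀)

variable [IsManifold I ∞ M] [ContMDiffVectorBundle ∞ F A I]

/-- A Lie algebroid structure on the vector bundle `A → M`: a smooth bundle map
`ρ : A → TM` and a Lie bracket on the smooth sections of `A` satisfying the Leibniz rule
(`ℝ`-homogeneity of the bracket is the Leibniz rule for constant functions). -/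
structure LieAlgebroid where
  /-- the anchor -/
  anchor : ∀ x : M, A x →L[ℝ] TangentSpace I x
  contMDiff_anchor : ContMDiff (I.prod 𝓘(ℝ, F)) I.tangent ∞
    (fun a : TotalSpace F A => (⟨a.1, anchor a.1 a.2⟩ : TangentBundle I M))
  /-- the bracket of sections -/
  bracket : Cₛ^∞⟮I; F, A⟯ → Cₛ^∞⟮I; F, A⟯ → Cₛ^∞⟮I; F, A⟯
  bracket_add : ∀ s t t', bracket s (t + t') = bracket s t + bracket s t'
  bracket_skew : ∀ s t, bracket s t = - bracket t s
  jacobi : ∀ s t u, bracket s (bracket t u) = bracket (bracket s t) u + bracket t (bracket s u)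
  leibniz : ∀ (s t t' : Cₛ^∞⟮I; F, A⟯) (f : M → ℝ), ContMDiff I 𝓘(ℝ, ℝ) ∞ f →
    (∀ x, t' x = f x • t x) →
    ∀ x, bracket s t' x = f x • bracket s t x + mvfderiv I f x (anchor x (s x)) • t x
  anchor_bracket : ∀ s t x, anchor x (bracket s t x) =
    VectorField.mlieBracket I (fun y => anchor y (s y)) (fun y => anchor y (t y)) x

variable {I F A}

/-- The value at `x` of the algebroid differential of `η ∈ Ω^k(A)` on sections `s₀, …, s_k`:
`∑ᵢ (-1)ⁱ L_{ρ(sᵢ)} (η(s₀, …, ŝᵢ, …, s_k))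
  + ∑_{i < j} (-1)ʲ η(s₀, …, [sᵢ, sⱼ], …, ŝⱼ, …, s_k)`,
with `[sᵢ, sⱼ]` standing in the place of `sᵢ`. Moving it to the first place
turns the sign `(-1)ʲ` into the customary `(-1)^(i+j)`. -/
def LieAlgebroid.diffOnSections (L : LieAlgebroid I F A) {k : ℕ}
    (η : Π x : M, A x [⋀^Fin k]→L[ℝ] ℝ) (s : Fin (k + 1) → Cₛ^∞⟮I; F, A⟯) (x : M) : ℝ :=
  (∑ i : Fin (k + 1), (-1 : ℝ) ^ (i : ℕ) *
    mvfderiv I (fun y => η y (fun l => s (i.succAbove l) y)) x (L.anchor x (s i x))) +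
  ∑ j : Fin (k + 1), ∑ i : Fin k, if i.castSucc < j then
    (-1 : ℝ) ^ (j : ℕ) * η x (Function.update (fun l => s (j.succAbove l) x) i
      (L.bracket (s i.castSucc) (s j) x)) else 0

/-- `ζ = d_A η` for the algebroid differential `d_A`. -/
def LieAlgebroid.IsDifferential (L : LieAlgebroid I F A) {k : ℕ}
    (η : Π x : M, A x [⋀^Fin k]→L[ℝ] ℝ) (ζ : Π x : M, A x [⋀^Fin (k + 1)]→L[ℝ] ℝ) : Prop :=
  ∀ (s : Fin (k + 1) → Cₛ^∞⟮I; F, A⟯) (x : M), ζ x (fun i => s i x) = L.diffOnSections η s x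

variable {EN HN : Type*} [NormedAddCommGroup EN] [NormedSpace ℝ EN] [TopologicalSpace HN]
  {J : ModelWithCorners ℝ EN HN}
  {N : Type*} [TopologicalSpace N] [ChartedSpace HN N] [IsManifold J ∞ N]
  {F' : Type*} [NormedAddCommGroup F'] [NormedSpace ℝ F']
  {B : N → Type*} [TopologicalSpace (TotalSpace F' B)] [∀ x, TopologicalSpace (B x)]
  [∀ x, AddCommGroup (B x)] [∀ x, Module ℝ (B x)] [FiberBundle F' B] [VectorBundle ℝ F' B]
  [ContMDiffVectorBundle ∞ F' B J]

/-- The pullback `Φ^*` of (not necessarily smooth) forms along a bundle map `Φ : A → B`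
covering `φ : M → N`: `(Φ^* η)_x (a₁, …, a_k) = η_{φ x} (Φ a₁, …, Φ a_k)`. -/
def pullback {φ : M → N} (Φ : ∀ x : M, A x →L[ℝ] B (φ x)) (k : ℕ) :
    (Π y : N, B y [⋀^Fin k]→L[ℝ] ℝ) →ₗ[ℝ] (Π x : M, A x [⋀^Fin k]→L[ℝ] ℝ) where
  toFun η x := (η (φ x)).compContinuousLinearMap (Φ x)
  map_add' _ _ := rfl
  map_smul' _ _ := rfl

/-- A morphism of Lie algebroids: a smooth bundle map `Φ : A → B` covering `φ : M → N` which
intertwines the anchors, `ρ_B ∘ Φ = dφ ∘ ρ_A`, and the algebroid differentials,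
`Φ^* d_B = d_A Φ^*` on `Ω^k(B)` for all `k`. -/
structure IsMorphism (L : LieAlgebroid I F A) (L' : LieAlgebroid J F' B) {φ : M → N}
    (Φ : ∀ x : M, A x →L[ℝ] B (φ x)) : Prop where
  contMDiff_base : ContMDiff I J ∞ φ
  contMDiff_map : ContMDiff (I.prod 𝓘(ℝ, F)) (J.prod 𝓘(ℝ, F')) ∞
    (fun a : TotalSpace F A => (⟨φ a.1, Φ a.1 a.2⟩ : TotalSpace F' B))
  anchor_comp : ∀ x (a : A x), L'.anchor (φ x) (Φ x a) = mfderiv I J φ x (L.anchor x a)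
  differential : ∀ (k : ℕ), ∀ η ∈ forms J F' B k, ∃ ζ ∈ forms J F' B (k + 1),
    L'.IsDifferential η ζ ∧ L.IsDifferential (pullback Φ k η) (pullback Φ (k + 1) ζ)

variable (I M) in
/-- The tangent bundle as a Lie algebroid: the anchor is the identity and the bracket is the Lie
bracket of vector fields; the algebroid differential is the de Rham differential. -/
def tangentAlgebroid [CompleteSpace EM] :
    LieAlgebroid I EM (TangentSpace I : M → Type _) := by
  have h2 : minSmoothness ℝ 3 ≤ (∞ : ℕ∞ω) := by
    rw [minSmoothness_of_isRCLikeNormedField]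
    exact WithTop.coe_le_coe.2 (le_top : (3 : ℕ∞) ≤ ⊤)
  have h3 : IsManifold I (minSmoothness ℝ 3) M := IsManifold.of_le (n := ∞) h2
  have hi : IsManifold I (((⊤ : ℕ∞) : ℕ∞ω) + 1) M := inferInstanceAs (IsManifold I ∞ M)
  have hd : ∀ (s : Cₛ^∞⟮I; EM, (TangentSpace I : M → Type _)⟯) (x : M),
      MDifferentiableAt I I.tangent (fun y => (⟨y, s y⟩ : TangentBundle I M)) x :=
    fun s x => s.contMDiff.mdifferentiable (by simp) x
  exact
  { anchor := fun x => ContinuousLinearMap.id ℝ _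
    contMDiff_anchor := contMDiff_id
    bracket := fun s t => ⟨VectorField.mlieBracket I s t, by
      intro x
      exact ContMDiffAt.mlieBracket_vectorField (n := ⊤) (m := ⊤) (s.contMDiff x) (t.contMDiff x)
        (by simp)⟩
    bracket_add := by
      intro s t t'
      ext x
      exact VectorField.mlieBracket_add_right (hd t x) (hd t' x)
    bracket_skew := by
      intro s t
      ext x
      exact VectorField.mlieBracket_swap_apply
    jacobi := by
      intro s t u
      ext x
      exact VectorField.leibniz_identity_mlieBracket_apply (s.contMDiff.of_le (le_trans (minSmoothness_monotone (by norm_num)) h2) x)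
        (t.contMDiff.of_le (le_trans (minSmoothness_monotone (by norm_num)) h2) x) (u.contMDiff.of_le (le_trans (minSmoothness_monotone (by norm_num)) h2) x)
    leibniz := by
      intro s t t' f hf ht x
      have : (t' : ∀ x, TangentSpace I x) = f • (t : ∀ x, TangentSpace I x) := funext ht
      change VectorField.mlieBracket I s t' x = f x • VectorField.mlieBracket I s t x + _
      rw [this, VectorField.mlieBracket_smul_right (hf.mdifferentiable (by simp) x) (hd t x),
        add_comm]
      rfl
    anchor_bracket := fun s t x => rfl }

end Algebroid

/-! ### `G`-structures with connection -/

/-- `ℝⁿ`. -/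
abbrev Eu (n : ℕ) : Type := EuclideanSpace ℝ (Fin n)

section GStructure

variable {n r : ℕ}
  {G : Type*} [Group G] [TopologicalSpace G] [ChartedSpace (Eu r) G]

variable (r) in
/-- `ι` realizes the Lie group `G` as a closed Lie subgroup of `GL_n(ℝ)`. -/
structure IsClosedLieSubgroup (ι : G →* (Eu n →L[ℝ] Eu n)ˣ) : Prop where
  contMDiff : ContMDiff (𝓡 r) 𝓘(ℝ, Eu n →L[ℝ] Eu n) ∞ (fun g => (ι g : Eu n →L[ℝ] Eu n))
  isClosedEmbedding : Topology.IsClosedEmbedding ι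

/-- The underlying vector space `ℝʳ` of the Lie algebra `𝔤 = T₁G` of the `r`-dimensional Lie
group `G`: tangent vectors at `1` are written in the preferred chart at `1`. -/
abbrev LieAlg (r : ℕ) : Type := Eu r

/-- The adjoint action `Ad_g : 𝔤 → 𝔤`, the differential at `1` of `x ↦ g x g⁻¹`. -/
def Ad (g : G) : LieAlg r →L[ℝ] LieAlg r :=
  mfderiv (𝓡 r) (𝓡 r) (fun x : G => g * x * g⁻¹) 1

variable (r) in
/-- A `G`-structure with connection `(P, θ, ω)`, for a closed subgroup `ι : G ↪ GL_n(ℝ)`: a manifold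
`P` of dimension `n + dim G` with a smooth, proper, effective and locally free right action of `G`,
a pointwise surjective tensorial form `θ ∈ Ω¹(P, ℝⁿ)` and a connection form `ω ∈ Ω¹(P, 𝔤)`.
The right action is written `p <• g`; the differential at `1` of `g ↦ p <• g` sends `α ∈ 𝔤`
to the value at `p` of the infinitesimal generator `d/dt|₀ p exp(tα)`. -/
structure GStructureWithConnection (ι : G →* (Eu n →L[ℝ] Eu n)ˣ)
    (P : Type*) [TopologicalSpace P] [ChartedSpace (Eu (n + r)) P] [IsManifold (𝓡 (n + r)) ∞ P]
    [MulAction Gᵐᵒᵖ P] where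
  contMDiff_action : ContMDiff ((𝓡 (n + r)).prod (𝓡 r)) (𝓡 (n + r)) ∞
    (fun x : P × G => x.1 <• x.2)
  proper : ProperSMul Gᵐᵒᵖ P
  effective : ∀ g : G, (∀ p : P, p <• g = p) → g = 1
  locallyFree : ∀ p : P,
    Injective (mfderiv (𝓡 r) (𝓡 (n + r)) (fun g : G => p <• g) 1)
  /-- the tautological form -/
  θ : ∀ p : P, TangentSpace (𝓡 (n + r)) p →L[ℝ] Eu n
  contMDiff_θ : ContMDiff (𝓡 (n + r)).tangent 𝓘(ℝ, Eu n) ∞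
    (fun ξ : TangentBundle (𝓡 (n + r)) P => θ ξ.1 ξ.2)
  θ_surjective : ∀ p, Surjective (θ p)
  θ_horizontal : ∀ (p : P) (α : LieAlg r),
    θ (p <• (1 : G)) (mfderiv (𝓡 r) (𝓡 (n + r)) (fun g : G => p <• g) 1 α) = 0
  θ_equivariant : ∀ (g : G) (p : P) (ξ : TangentSpace (𝓡 (n + r)) p),
    θ (p <• g) (mfderiv (𝓡 (n + r)) (𝓡 (n + r)) (fun q : P => q <• g) p ξ)
      = (ι g⁻¹ : Eu n →L[ℝ] Eu n) (θ p ξ)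
  /-- the connection form `ω` -/
  conn : ∀ p : P, TangentSpace (𝓡 (n + r)) p →L[ℝ] LieAlg r
  contMDiff_conn : ContMDiff (𝓡 (n + r)).tangent 𝓘(ℝ, LieAlg r) ∞
    (fun ξ : TangentBundle (𝓡 (n + r)) P => conn ξ.1 ξ.2)
  conn_vertical : ∀ (p : P) (α : LieAlg r),
    conn (p <• (1 : G)) (mfderiv (𝓡 r) (𝓡 (n + r)) (fun g : G => p <• g) 1 α) = α
  conn_equivariant : ∀ (g : G) (p : P) (ξ : TangentSpace (𝓡 (n + r)) p),
    conn (p <• g) (mfderiv (𝓡 (n + r)) (𝓡 (n + r)) (fun q : P => q <• g) p ξ)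
      = Ad g⁻¹ (conn p ξ)

namespace GStructureWithConnection

variable {ι : G →* (Eu n →L[ℝ] Eu n)ˣ}
  {P : Type*} [TopologicalSpace P] [ChartedSpace (Eu (n + r)) P] [IsManifold (𝓡 (n + r)) ∞ P]
  [MulAction Gᵐᵒᵖ P] (S : GStructureWithConnection r ι P)

/-- `Φ` is a diffeomorphism between open subsets of `P` preserving `θ` and `ω`. -/
structure PreservesCoframe (Φ : OpenPartialHomeomorph P P) : Prop where
  contMDiffOn : ContMDiffOn (𝓡 (n + r)) (𝓡 (n + r)) ∞ Φ Φ.source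
  contMDiffOn_symm : ContMDiffOn (𝓡 (n + r)) (𝓡 (n + r)) ∞ Φ.symm Φ.target
  map_θ : ∀ p ∈ Φ.source, ∀ ξ : TangentSpace (𝓡 (n + r)) p,
    S.θ (Φ p) (mfderiv (𝓡 (n + r)) (𝓡 (n + r)) Φ p ξ) = S.θ p ξ
  map_conn : ∀ p ∈ Φ.source, ∀ ξ : TangentSpace (𝓡 (n + r)) p,
    S.conn (Φ p) (mfderiv (𝓡 (n + r)) (𝓡 (n + r)) Φ p ξ) = S.conn p ξ

/-- `Φ` is a locally defined self equivalence `π⁻¹(U) → π⁻¹(U')` of `(P, θ, ω)`: a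
`G`-equivariant diffeomorphism between `G`-saturated open subsets of `P` preserving `θ` and `ω`. -/
structure IsLocalSelfEquivalence (Φ : OpenPartialHomeomorph P P) : Prop
    extends S.PreservesCoframe Φ where
  saturated : ∀ p ∈ Φ.source, ∀ g : G, p <• g ∈ Φ.source
  equivariant : ∀ p ∈ Φ.source, ∀ g : G, Φ (p <• g) = Φ p <• g

/-- `Ω^k(P, θ, ω)`: the differential `k`-forms `Ω` with `Φ^* Ω = Ω` for every locally defined self
equivalence `Φ`. -/
def invariantForms (k : ℕ) :
    Submodule ℝ (Π p : P, TangentSpace (𝓡 (n + r)) p [⋀^Fin k]→L[ℝ] ℝ) where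
  carrier := {Ω | Ω ∈ forms (𝓡 (n + r)) (Eu (n + r)) (TangentSpace (𝓡 (n + r)) : P → Type _) k ∧
    ∀ Φ : OpenPartialHomeomorph P P, S.IsLocalSelfEquivalence Φ → ∀ p ∈ Φ.source,
      (Ω (Φ p)).compContinuousLinearMap (mfderiv (𝓡 (n + r)) (𝓡 (n + r)) Φ p) = Ω p}
  add_mem' := by
    rintro η ζ ⟨hη, hη'⟩ ⟨hζ, hζ'⟩
    refine ⟨add_mem hη hζ, fun Φ hΦ p hp => ?_⟩
    rw [Pi.add_apply η ζ p, ← hη' Φ hΦ p hp, ← hζ' Φ hΦ p hp]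
    rfl
  zero_mem' := ⟨zero_mem _, fun _ _ _ _ => rfl⟩
  smul_mem' := by
    rintro c η ⟨hη, hη'⟩
    refine ⟨Submodule.smul_mem _ c hη, fun Φ hΦ p hp => ?_⟩
    rw [Pi.smul_apply c η p, ← hη' Φ hΦ p hp]
    rfl

/-- The invariant functions of `(P, θ, ω)`. -/
def IsInvariantFunction (f : P → ℝ) : Prop :=
  ContMDiff (𝓡 (n + r)) 𝓘(ℝ, ℝ) ∞ f ∧
    ∀ Φ : OpenPartialHomeomorph P P, S.IsLocalSelfEquivalence Φ → ∀ p ∈ Φ.source, f (Φ p) = f p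

/-- The space `{d_p f : f an invariant function} ⊆ T_p^* P`. -/
def invariantDifferentials (p : P) : Submodule ℝ (TangentSpace (𝓡 (n + r)) p →L[ℝ] ℝ) where
  carrier := {l | ∃ f : P → ℝ, S.IsInvariantFunction f ∧ mvfderiv (𝓡 (n + r)) f p = l}
  add_mem' := by
    rintro _ _ ⟨f, hf, rfl⟩ ⟨g, hg, rfl⟩
    refine ⟨f + g, ⟨hf.1.add hg.1, fun Φ hΦ q hq => ?_⟩, ?_⟩
    · simp [hf.2 Φ hΦ q hq, hg.2 Φ hΦ q hq]
    · exact mvfderiv_add (hf.1.mdifferentiable (by simp) p) (hg.1.mdifferentiable (by simp) p)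
  zero_mem' := ⟨0, ⟨contMDiff_const, fun _ _ _ _ => rfl⟩, by simp⟩
  smul_mem' := by
    rintro c _ ⟨f, hf, rfl⟩
    refine ⟨fun q => c * f q, ⟨contMDiff_const.mul hf.1, fun Φ hΦ q hq => ?_⟩, ?_⟩
    · simp [hf.2 Φ hΦ q hq]
    · have := mvfderiv_smul (I := 𝓡 (n + r)) (x := p) (a := fun _ : P => c) (g := f)
        mdifferentiableAt_const (hf.1.mdifferentiable (by simp) p)
      rw [mvfderiv_const] at this
      ext v
      have := congrArg (fun l => l v) this
      simp only [add_apply, smul_apply,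
        ContinuousLinearMap.smulRight_apply, zero_apply, zero_smul,
        add_zero] at this
      exact this

/-- `(P, θ, ω)` is fully regular of rank `d`. -/
def IsFullyRegular (d : ℕ) : Prop :=
  ∀ p : P, Module.finrank ℝ (S.invariantDifferentials p) = d

theorem preservesCoframe_refl : S.PreservesCoframe (OpenPartialHomeomorph.refl P) where
  contMDiffOn := contMDiffOn_id
  contMDiffOn_symm := contMDiffOn_id
  map_θ p _ ξ := by
    change S.θ p (mfderiv (𝓡 (n + r)) (𝓡 (n + r)) (id : P → P) p ξ) = S.θ p ξ
    rw [mfderiv_id]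
    rfl
  map_conn p _ ξ := by
    change S.conn p (mfderiv (𝓡 (n + r)) (𝓡 (n + r)) (id : P → P) p ξ) = S.conn p ξ
    rw [mfderiv_id]
    rfl

variable {S}

theorem PreservesCoframe.mdifferentiableAt {Φ : OpenPartialHomeomorph P P}
    (h : S.PreservesCoframe Φ) {p : P} (hp : p ∈ Φ.source) :
    MDifferentiableAt (𝓡 (n + r)) (𝓡 (n + r)) Φ p :=
  ((h.contMDiffOn p hp).contMDiffAt (Φ.open_source.mem_nhds hp)).mdifferentiableAt (by simp)

theorem PreservesCoframe.mdifferentiableAt_symm {Φ : OpenPartialHomeomorph P P}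
    (h : S.PreservesCoframe Φ) {p : P} (hp : p ∈ Φ.target) :
    MDifferentiableAt (𝓡 (n + r)) (𝓡 (n + r)) Φ.symm p :=
  ((h.contMDiffOn_symm p hp).contMDiffAt (Φ.open_target.mem_nhds hp)).mdifferentiableAt (by simp)

theorem PreservesCoframe.mfderiv_symm_apply {Φ : OpenPartialHomeomorph P P}
    (h : S.PreservesCoframe Φ) {p : P} (hp : p ∈ Φ.target) (ξ : TangentSpace (𝓡 (n + r)) p) :
    mfderiv (𝓡 (n + r)) (𝓡 (n + r)) Φ (Φ.symm p)
      (mfderiv (𝓡 (n + r)) (𝓡 (n + r)) Φ.symm p ξ) = ξ := by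
  have h1 := mfderiv_comp_apply p (h.mdifferentiableAt (Φ.map_target hp))
    (h.mdifferentiableAt_symm hp) ξ
  rw [← h1]
  have h2 : (Φ ∘ Φ.symm) =ᶠ[𝓝 p] id := by
    filter_upwards [Φ.open_target.mem_nhds hp] with q hq using Φ.right_inv hq
  rw [h2.mfderiv_eq, mfderiv_id]
  rfl

theorem PreservesCoframe.symm {Φ : OpenPartialHomeomorph P P} (h : S.PreservesCoframe Φ) :
    S.PreservesCoframe Φ.symm where
  contMDiffOn := h.contMDiffOn_symm
  contMDiffOn_symm := by simpa using h.contMDiffOn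
  map_θ p hp ξ := by
    rw [← h.map_θ _ (Φ.map_target hp), h.mfderiv_symm_apply hp ξ, Φ.right_inv hp]
  map_conn p hp ξ := by
    rw [← h.map_conn _ (Φ.map_target hp), h.mfderiv_symm_apply hp ξ, Φ.right_inv hp]

theorem PreservesCoframe.trans {Φ Ψ : OpenPartialHomeomorph P P} (h : S.PreservesCoframe Φ)
    (h' : S.PreservesCoframe Ψ) : S.PreservesCoframe (Φ.trans Ψ) where
  contMDiffOn := h'.contMDiffOn.comp' h.contMDiffOn
  contMDiffOn_symm := h.contMDiffOn_symm.comp' h'.contMDiffOn_symm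
  map_θ p hp ξ := by
    change S.θ (Ψ (Φ p)) (mfderiv (𝓡 (n + r)) (𝓡 (n + r)) (Ψ ∘ Φ) p ξ) = S.θ p ξ
    have hp1 : p ∈ Φ.source := hp.1
    have hp2 : Φ p ∈ Ψ.source := hp.2
    rw [mfderiv_comp_apply p (h'.mdifferentiableAt hp2) (h.mdifferentiableAt hp1),
      h'.map_θ _ hp2, h.map_θ _ hp1]
  map_conn p hp ξ := by
    change S.conn (Ψ (Φ p)) (mfderiv (𝓡 (n + r)) (𝓡 (n + r)) (Ψ ∘ Φ) p ξ) = S.conn p ξ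
    have hp1 : p ∈ Φ.source := hp.1
    have hp2 : Φ p ∈ Ψ.source := hp.2
    rw [mfderiv_comp_apply p (h'.mdifferentiableAt hp2) (h.mdifferentiableAt hp1),
      h'.map_conn _ hp2, h.map_conn _ hp1]

variable (S)

/-- Local equivalence of points: `p ∼ q` if some diffeomorphism `Φ : U_p → U_q` between open
neighbourhoods of `p` and `q` preserves `θ` and `ω` and has `Φ(p) = q`. (Such a `Φ` commutes with
the infinitesimal action of `𝔤`; the neighbourhoods need not be `G`-saturated.) -/
def localEquivalence : Setoid P where
  r p q := ∃ Φ : OpenPartialHomeomorph P P, S.PreservesCoframe Φ ∧ p ∈ Φ.source ∧ Φ p = q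
  iseqv :=
    { refl := fun p => ⟨_, S.preservesCoframe_refl, mem_univ p, rfl⟩
      symm := by
        rintro p _ ⟨Φ, h, hp, rfl⟩
        exact ⟨Φ.symm, h.symm, Φ.map_source hp, Φ.left_inv hp⟩
      trans := by
        rintro p _ _ ⟨Φ, h, hp, rfl⟩ ⟨Ψ, h', hq, rfl⟩
        exact ⟨Φ.trans Ψ, h.trans h', by simp [hp, hq], rfl⟩ }

/-- The classifying space `X = P / ∼`, with the quotient topology. -/
abbrev X : Type _ := Quotient S.localEquivalence

/-- The classifying map `h : P → X`. -/
def h (p : P) : S.X := Quotient.mk S.localEquivalence p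

/-- The typical fibre `ℝⁿ ⊕ 𝔤` of the trivial bundle `A`. -/
abbrev Fib (n r : ℕ) : Type := Eu n × LieAlg r

/-- The trivial vector bundle `A = X × (ℝⁿ ⊕ 𝔤) → X`. -/
abbrev A : S.X → Type := Bundle.Trivial S.X (Fib n r)

/-- The coframe as a bundle map `H = (θ, ω) : TP → A` covering `h`. -/
def H (p : P) : TangentSpace (𝓡 (n + r)) p →L[ℝ] S.A (S.h p) :=
  (S.θ p).prod (S.conn p)

end GStructureWithConnection

end GStructure

end GStr

end

/-! ### The Frobenius theorem for total differential equations. -/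

section Frobenius

open Metric NNReal ODE

variable {E F : Type*} [NormedAddCommGroup E] [NormedSpace ℝ E]
  [NormedAddCommGroup F] [NormedSpace ℝ F]

/-! The pair H = (θ, ω) is a coframe: ω inverts the infinitesimal action on vertical vectors, where
θ vanishes, and θ is onto, so each H_p is surjective between spaces of equal dimension. Vector
fields and forms on P thus become functions, their components in this coframe. A "symmetry" below is
any local diffeomorphism preserving H.

There are two notions of invariance to reconcile. Invariant functions are tested against
G-equivariant symmetries of saturated open sets, while ∼ uses all symmetries. A symmetry Φ commutes
with group elements near 1, since the curves Φ(p·γ) and Φ(p)·γ have the same velocity components and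
start at the same point (`exists_nhds_map_act`). If p and Φ(p) have trivial stabilizers, properness
keeps the remaining group elements away, and Φ extends equivariantly to a saturated set
(`exists_isLocalSelfEquivalence`). Points with trivial stabilizer are open and dense: a stabilizer
is finite and acts faithfully on ℝⁿ through ι, so a curve with generic velocity leaves all fixed
loci (`dense_freePoints`). By continuity, invariant functions are preserved by every symmetry
(`IsInvariantFunction.map_eq`).

Conversely, invariants separate classes locally. Near any point, d invariant functions with
independent differentials are completed to coordinates (z, y), and full regularity makes every
invariant map a function of z (`IsAdapted.eq_of_eq`). This applies to the derivatives of z along the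
frame and to the structure functions of H. A symmetry of the form (z, y) ↦ (z, u(z, y)) is a
solution of a total differential equation for u, whose integrability condition is then the structure
equation of H. Frobenius gives a solution through any prescribed value (`exists_coframe_symmetry`),
so points with equal z are equivalent (`IsAdapted.exists_preservesCoframe`). Hence z is a chart of X
in which h is the projection (z, y) ↦ z.

For any smooth structure making h a submersion, maps on P preserved by all symmetries are exactly
the pullbacks of smooth maps on X. Applied to components of forms this gives part 1
(`bijOn_pullback_H`). For part 2, sections of A lift to vector fields with the same components;
their brackets have invariant components and descend (`inducedAlgebroid`), and the Koszul formula on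
lifts turns the de Rham differential into d_A. The anchor is unique because h is onto and H is
fibrewise invertible; the bracket is unique because d_A on constant 1-forms determines it
(`eq_of_isMorphism`). -/

/-- Picard–Lindelöf on `[0, 1]`, with the solution confined to the ball on which the field is
controlled. -/
theorem IsPicardLindelof.exists_solution_mem_closedBall [CompleteSpace F] {f : ℝ → F → F} {y₀ : F}
    {a L K : ℝ≥0}
    (hf : IsPicardLindelof f (⟨0, by simp⟩ : Icc (0 : ℝ) 1) y₀ a 0 L K) :
    ∃ α : ℝ → F, α 0 = y₀ ∧ (∀ t, α t ∈ closedBall y₀ a) ∧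
      ∀ t ∈ Icc (0 : ℝ) 1, HasDerivWithinAt α (f t (α t)) (Icc 0 1) t := by
  obtain ⟨α, hα⟩ := FunSpace.exists_isFixedPt_next hf (mem_closedBall_self le_rfl)
  refine ⟨α.compProj, ?_, fun t => α.compProj_mem_closedBall hf.mul_max_le, fun t ht => ?_⟩
  · have := FunSpace.compProj_val (t := (⟨0, by simp⟩ : Icc (0 : ℝ) 1)) (α := α)
    rw [this, ← hα, FunSpace.next_apply₀]
  · apply hasDerivWithinAt_picard_Icc (⟨by simp, by simp⟩ : (0 : ℝ) ∈ Icc (0 : ℝ) 1)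
      hf.continuousOn_uncurry
      α.continuous_compProj.continuousOn (fun _ _ => α.compProj_mem_closedBall hf.mul_max_le)
      y₀ ht |>.congr_of_mem _ ht
    intro t' ht'
    nth_rw 1 [← hα]
    rw [FunSpace.compProj_of_mem ht', FunSpace.next_apply]

/-- Quadratic Taylor estimate from a Lipschitz derivative on a convex set. -/
theorem Convex.norm_sub_sub_fderiv_le {G : Type*} [NormedAddCommGroup G] [NormedSpace ℝ G]
    {A : E → G} {s : Set E} (hs : Convex ℝ s) (hA : ∀ z ∈ s, DifferentiableAt ℝ A z) {M : ℝ≥0}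
    (hL : LipschitzOnWith M (fderiv ℝ A) s) {z z' : E} (hz : z ∈ s) (hz' : z' ∈ s) :
    ‖A z' - A z - fderiv ℝ A z (z' - z)‖ ≤ M * ‖z' - z‖ * ‖z' - z‖ := by
  have hseg : segment ℝ z z' ⊆ s := hs.segment_subset hz hz'
  refine (convex_segment z z').norm_image_sub_le_of_norm_hasFDerivWithin_le'
    (f' := fderiv ℝ A) (φ := fderiv ℝ A z)
    (fun y hy => (hA y (hseg hy)).hasFDerivAt.hasFDerivWithinAt) (fun y hy => ?_)
    (left_mem_segment ℝ z z') (right_mem_segment ℝ z z')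
  refine (hL.norm_sub_le (hseg hy) hz).trans ?_
  gcongr
  obtain ⟨a, b, ha, hb, hab, rfl⟩ := hy
  have : a • z + b • z' - z = b • (z' - z) := by
    rw [smul_sub, show a = 1 - b by linarith, sub_smul, one_smul]; abel
  rw [this, norm_smul, Real.norm_of_nonneg hb]
  exact mul_le_of_le_one_left (norm_nonneg _) (by linarith)

/-- Local bounds for a `C²` map. -/
theorem ContDiffAt.exists_ball_bounds {G : Type*} [NormedAddCommGroup G] [NormedSpace ℝ G]
    {A : E → G} {z₀ : E} {U : Set E} (hU : U ∈ 𝓝 z₀) (hA : ContDiffAt ℝ 2 A z₀) :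
    ∃ R > 0, ∃ M : ℝ≥0, 1 ≤ M ∧ ball z₀ R ⊆ U ∧ (∀ z ∈ ball z₀ R, DifferentiableAt ℝ A z) ∧
      (∀ z ∈ ball z₀ R, ‖A z‖ ≤ M) ∧ (∀ z ∈ ball z₀ R, ‖fderiv ℝ A z‖ ≤ M) ∧
      LipschitzOnWith M A (ball z₀ R) ∧ LipschitzOnWith M (fderiv ℝ A) (ball z₀ R) := by
  have h1 : ContDiffAt ℝ 1 A z₀ := hA.of_le (by norm_num)
  have h2 : ContDiffAt ℝ 1 (fderiv ℝ A) z₀ := hA.fderiv_right (by norm_num)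
  obtain ⟨K₁, t₁, ht₁, hK₁⟩ := h1.exists_lipschitzOnWith
  obtain ⟨K₂, t₂, ht₂, hK₂⟩ := h2.exists_lipschitzOnWith
  have e1 : ∀ᶠ z in 𝓝 z₀, ‖A z‖ < ‖A z₀‖ + 1 :=
    h1.continuousAt.norm.eventually (gt_mem_nhds (lt_add_one _))
  have e2 : ∀ᶠ z in 𝓝 z₀, ‖fderiv ℝ A z‖ < ‖fderiv ℝ A z₀‖ + 1 :=
    h2.continuousAt.norm.eventually (gt_mem_nhds (lt_add_one _))
  have e3 : ∀ᶠ z in 𝓝 z₀, DifferentiableAt ℝ A z := by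
    filter_upwards [h1.eventually (by simp)] with z hz using hz.differentiableAt (by norm_num)
  obtain ⟨R, hR, hsub⟩ := Metric.eventually_nhds_iff_ball.1
    ((Filter.eventually_mem_set.2 hU).and ((Filter.eventually_mem_set.2 ht₁).and
      ((Filter.eventually_mem_set.2 ht₂).and (e1.and (e2.and e3)))))
  let M : ℝ≥0 := max (max 1 (max K₁ K₂)) (max (‖A z₀‖₊ + 1) (‖fderiv ℝ A z₀‖₊ + 1))
  have m0 : 1 ≤ M := (le_max_left _ _).trans (le_max_left _ _)
  have m1 : K₁ ≤ M := (le_max_left _ _).trans ((le_max_right _ _).trans (le_max_left _ _))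
  have m2 : K₂ ≤ M := (le_max_right _ _).trans ((le_max_right _ _).trans (le_max_left _ _))
  have m3 : ‖A z₀‖ + 1 ≤ M := by
    have : ‖A z₀‖₊ + 1 ≤ M := (le_max_left _ _).trans (le_max_right _ _)
    exact_mod_cast this
  have m4 : ‖fderiv ℝ A z₀‖ + 1 ≤ M := by
    have : ‖fderiv ℝ A z₀‖₊ + 1 ≤ M := (le_max_right _ _).trans (le_max_right _ _)
    exact_mod_cast this
  exact ⟨R, hR, M, m0, fun z hz => (hsub z hz).1, fun z hz => (hsub z hz).2.2.2.2.2,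
    fun z hz => (hsub z hz).2.2.2.1.le.trans m3, fun z hz => (hsub z hz).2.2.2.2.1.le.trans m4,
    (hK₁.mono fun z hz => (hsub z hz).2.1).weaken m1,
    (hK₂.mono fun z hz => (hsub z hz).2.2.1).weaken m2⟩

/-- **Frobenius theorem** for completely integrable total differential equations `u' = A(x, u)`. -/
theorem exists_hasFDerivAt_of_integrable [CompleteSpace F] {A : E × F → E →L[ℝ] F}
    {U : Set (E × F)} {x₀ : E} {y₀ : F} (hU : U ∈ 𝓝 (x₀, y₀)) (hA : ContDiffAt ℝ 2 A (x₀, y₀))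
    (hint : ∀ p ∈ U, ∀ v w, fderiv ℝ A p (v, A p v) w = fderiv ℝ A p (w, A p w) v) :
    ∃ u : E → F, ∃ ε > 0, u x₀ = y₀ ∧
      ∀ x ∈ ball x₀ ε, (x, u x) ∈ U ∧ HasFDerivAt u (A (x, u x)) x := by
  obtain ⟨R, hR, M, hM, hBU, hdiff, hb, hb', hL, hL'⟩ := hA.exists_ball_bounds hU
  have hM0 : (0 : ℝ) < M := lt_of_lt_of_le one_pos (by exact_mod_cast hM)
  have hM1 : (1 : ℝ) ≤ M := by exact_mod_cast hM
  -- The radius `a` confines the true solutions; the comparison curve below may move by another `a`,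
  -- hence the room `2 * a < R`.
  obtain ⟨a, ha0, haR⟩ : ∃ a : ℝ≥0, 0 < a ∧ 2 * (a : ℝ) < R :=
    ⟨⟨R / 3, by positivity⟩, by
      exact_mod_cast (div_pos hR three_pos : (0 : ℝ) < R / 3), by
      change 2 * (R / 3) < R; linarith⟩
  have ha0' : (0 : ℝ) < a := ha0
  -- With this choice `M * ε = a` bounds both the speed of a radial solution, which therefore stays
  -- within `a` over unit time, and its Lipschitz constant in `y`.
  set ε : ℝ := a / M with hε
  have hε0 : 0 < ε := by positivity
  have hMε : M * ε = a := by rw [hε]; field_simp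
  have hεa : ε ≤ a := div_le_self ha0'.le hM1
  have hball : ∀ (t : ℝ) (w : E) (y : F), t ∈ Icc (0 : ℝ) 1 → ‖w‖ ≤ ε → dist y y₀ ≤ 2 * a →
      (x₀ + t • w, y) ∈ ball (x₀, y₀) R := by
    intro t w y ht hw hy
    rw [mem_ball, Prod.dist_eq, max_lt_iff]
    refine ⟨?_, by linarith⟩
    simp only [dist_self_add_left, norm_smul, Real.norm_of_nonneg ht.1]
    have := mul_le_mul ht.2 hw (norm_nonneg _) zero_le_one
    linarith
  have hlip : ∀ (t : ℝ) (w : E), t ∈ Icc (0 : ℝ) 1 → ‖w‖ ≤ ε →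
      LipschitzOnWith a (fun y => A (x₀ + t • w, y) w) (closedBall y₀ (2 * a)) := by
    intro t w ht hw
    refine LipschitzOnWith.of_dist_le_mul fun y hy y' hy' => ?_
    rw [dist_eq_norm, ← sub_apply]
    refine (ContinuousLinearMap.le_opNorm _ _).trans ?_
    have := hL.norm_sub_le (hball t w y ht hw hy) (hball t w y' ht hw hy')
    have h2 : ‖((x₀ + t • w, y) : E × F) - (x₀ + t • w, y')‖ = dist y y' := by
      simp [Prod.norm_def, dist_eq_norm]
    rw [h2] at this
    calc _ ≤ (M * dist y y') * ε := by gcongr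
      _ = a * dist y y' := by rw [← hMε]; ring
  -- The total equation restricted to the ray `t ↦ x₀ + t • w` is an ordinary one. Its solution at
  -- time 1 is the only possible value of `u` at `x₀ + w`.
  have hsol : ∀ w : E, ‖w‖ ≤ ε → ∃ β : ℝ → F, β 0 = y₀ ∧ (∀ t, β t ∈ closedBall y₀ a) ∧
      ∀ t ∈ Icc (0 : ℝ) 1, HasDerivWithinAt β (A (x₀ + t • w, β t) w) (Icc 0 1) t := by
    intro w hw
    have hsub : closedBall y₀ (a : ℝ) ⊆ closedBall y₀ (2 * a) :=
      closedBall_subset_closedBall (by linarith)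
    refine IsPicardLindelof.exists_solution_mem_closedBall (f := fun t y => A (x₀ + t • w, y) w)
      (a := a) (L := a) (K := a) ⟨fun t ht => (hlip t w ht hw).mono hsub, fun y hy t ht => ?_,
        fun t ht y hy => ?_, by simp⟩
    · have h1 : ContinuousAt A (x₀ + t • w, y) := (hdiff _ (hball t w y ht hw (hsub hy))).continuousAt
      have h2 : ContinuousAt (fun t : ℝ => A (x₀ + t • w, y)) t :=
        ContinuousAt.comp (f := fun t : ℝ => ((x₀ + t • w, y) : E × F)) h1 (by fun_prop)
      exact (h2.clm_apply continuousAt_const).continuousWithinAt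
    · refine (ContinuousLinearMap.le_opNorm _ _).trans ?_
      calc _ ≤ M * ε := by
            gcongr
            exact hb _ (hball t w y ht hw (hsub hy))
        _ = a := hMε
  choose! β hβ0 hβa hβ using hsol
  have hderiv : ∀ w, ‖w‖ ≤ ε → ∀ t ∈ Ico (0 : ℝ) 1,
      HasDerivWithinAt (β w) (A (x₀ + t • w, β w t) w) (Ici t) t := by
    intro w hw t ht
    refine (hβ w hw t (Ico_subset_Icc_self ht)).mono_of_mem_nhdsWithin ?_
    exact Filter.mem_of_superset (Icc_mem_nhdsGE_of_mem ht) le_rfl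
  have hcont : ∀ w, ‖w‖ ≤ ε → ContinuousOn (β w) (Icc 0 1) := fun w hw t ht =>
    (hβ w hw t ht).continuousWithinAt
  have hmem : ∀ (w : E) (t : ℝ), ‖w‖ ≤ ε → t ∈ Icc (0 : ℝ) 1 →
      (x₀ + t • w, β w t) ∈ ball (x₀, y₀) R := fun w t hw ht =>
    hball t w _ ht hw ((mem_closedBall.1 (hβa w hw t)).trans (by linarith))
  refine ⟨fun x => β (x - x₀) 1, ε, hε0, ?_, fun x hx => ?_⟩
  · have h0 : ‖x₀ - x₀‖ ≤ ε := by simpa using hε0.le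
    have := constant_of_has_deriv_right_zero (hcont _ h0) (fun t ht => by
      simpa using hderiv _ h0 t ht) 1 (by simp)
    change β (x₀ - x₀) 1 = y₀
    rw [this, hβ0 _ h0]
  obtain ⟨w, rfl⟩ : ∃ w, x = x₀ + w := ⟨x - x₀, by simp⟩
  have hw : ‖w‖ < ε := by simpa using hx
  simp only [add_sub_cancel_left]
  have hmem1 : (x₀ + w, β w 1) ∈ ball (x₀, y₀) R := by
    simpa using hmem w 1 hw.le (by simp)
  refine ⟨hBU hmem1, ?_⟩
  rw [hasFDerivAt_iff_isLittleO_nhds_zero]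
  -- It remains to differentiate across rays. The curve `g` below, obtained by displacing the
  -- solution for `w` by `t • A δ`, solves the equation for `w + δ` up to an error quadratic in `δ`.
  -- Gronwall then bounds the distance at time 1.
  obtain ⟨C, hC⟩ : ∃ C : ℝ, ∀ δ : E, ‖δ‖ ≤ ε → ‖w + δ‖ ≤ ε →
      ‖β (w + δ) 1 - β w 1 - A (x₀ + w, β w 1) δ‖ ≤ C * ‖δ‖ ^ 2 := by
    refine ⟨(M ^ 2 + M ^ 3 * ε) * (1 / a * (Real.exp a - 1)), fun δ hδ hwδ => ?_⟩
    let g : ℝ → F := fun t => β w t + t • A (x₀ + t • w, β w t) δ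
    let g' : ℝ → F := fun t => A (x₀ + t • w, β w t) w + (A (x₀ + t • w, β w t) δ +
      t • fderiv ℝ A (x₀ + t • w, β w t) (w, A (x₀ + t • w, β w t) w) δ)
    have hg : ∀ t ∈ Ico (0 : ℝ) 1, HasDerivWithinAt g (g' t) (Ici t) t := by
      intro t ht
      have hz := hmem w t hw.le (Ico_subset_Icc_self ht)
      have h1 : HasDerivWithinAt (fun t => ((x₀ + t • w, β w t) : E × F))
          (w, A (x₀ + t • w, β w t) w) (Ici t) t := by
        refine HasDerivWithinAt.prodMk ?_ (hderiv w hw.le t ht)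
        simpa using! (((hasDerivAt_id t).smul_const w).const_add x₀).hasDerivWithinAt
      have h2 := (hdiff _ hz).hasFDerivAt.comp_hasDerivWithinAt t h1
      have h3 := h2.clm_apply (hasDerivWithinAt_const t (Ici t) δ)
      have h4 := (hderiv w hw.le t ht).add ((hasDerivAt_id t).hasDerivWithinAt.smul h3)
      refine h4.congr_deriv ?_
      simp only [g', id_eq, map_zero, add_zero, one_smul, Function.comp_apply]
      abel
    have hgball : ∀ t ∈ Icc (0 : ℝ) 1, dist (g t) y₀ ≤ 2 * a := by
      intro t ht
      have h1 : ‖A (x₀ + t • w, β w t) δ‖ ≤ M * ε :=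
        (ContinuousLinearMap.le_opNorm _ _).trans (by
          gcongr; exact hb _ (hmem w t hw.le ht))
      have h2 : dist (g t) (β w t) ≤ a := by
        simp only [g, dist_self_add_left, norm_smul, Real.norm_of_nonneg ht.1]
        calc _ ≤ 1 * (M * ε) := by gcongr; exact ht.2
          _ = a := by rw [one_mul, hMε]
      have := dist_triangle (g t) (β w t) y₀
      have h3 := mem_closedBall.1 (hβa w hw.le t)
      linarith
    have hgb : ∀ t ∈ Ico (0 : ℝ) 1, dist (g' t) (A (x₀ + t • (w + δ), g t) (w + δ)) ≤
        (M ^ 2 + M ^ 3 * ε) * ‖δ‖ ^ 2 := by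
      intro t ht
      have ht' := Ico_subset_Icc_self ht
      have hz := hmem w t hw.le ht'
      have hz' := hball t (w + δ) (g t) ht' hwδ (hgball t ht')
      set z : E × F := (x₀ + t • w, β w t) with hzdef
      set z' : E × F := (x₀ + t • (w + δ), g t) with hzdef'
      have hζ : z' - z = t • ((δ, A z δ) : E × F) := by
        simp only [hzdef, hzdef', g, Prod.mk_sub_mk, Prod.smul_mk, smul_add]
        congr 1 <;> abel
      have hζn : ‖z' - z‖ ≤ M * ‖δ‖ := by
        rw [hζ, norm_smul, Real.norm_of_nonneg ht.1, Prod.norm_def]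
        calc _ ≤ 1 * (M * ‖δ‖) := by
              gcongr
              · exact ht'.2
              · refine max_le (le_mul_of_one_le_left (norm_nonneg _) hM1) ?_
                exact (ContinuousLinearMap.le_opNorm _ _).trans (by gcongr; exact hb _ hz)
          _ = _ := one_mul _
      have hT := (convex_ball _ _).norm_sub_sub_fderiv_le hdiff hL' hz hz'
      set Rm := A z' - A z - fderiv ℝ A z (z' - z) with hRm
      have hT' : ‖Rm‖ ≤ M ^ 3 * ‖δ‖ ^ 2 := hT.trans (by
        calc _ ≤ M * (M * ‖δ‖) * (M * ‖δ‖) := by gcongr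
          _ = _ := by ring)
      have key : g' t - A z' (w + δ) = - (fderiv ℝ A z (z' - z) δ + Rm (w + δ)) := by
        have e1 : A z' = A z + fderiv ℝ A z (z' - z) + Rm := by rw [hRm]; abel
        -- This is the only use of integrability: it swaps `w` and `δ`, so that the first-order
        -- errors cancel.
        have e2 : fderiv ℝ A z (z' - z) w = t • fderiv ℝ A z (w, A z w) δ := by
          rw [hζ, map_smul, smul_apply, hint z (hBU hz)]
        simp only [g', e1, add_apply, map_add, e2]
        simp only [← hzdef]
        abel
      rw [dist_eq_norm, key, norm_neg]
      have h1 : ‖fderiv ℝ A z (z' - z) δ‖ ≤ M * (M * ‖δ‖) * ‖δ‖ :=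
        (ContinuousLinearMap.le_opNorm _ _).trans (by
          gcongr
          exact (ContinuousLinearMap.le_opNorm _ _).trans (by gcongr; exact hb' _ hz))
      have h2 : ‖Rm (w + δ)‖ ≤ M ^ 3 * ‖δ‖ ^ 2 * ε :=
        (ContinuousLinearMap.le_opNorm _ _).trans (by gcongr)
      calc _ ≤ _ := norm_add_le _ _
        _ ≤ M * (M * ‖δ‖) * ‖δ‖ + M ^ 3 * ‖δ‖ ^ 2 * ε := add_le_add h1 h2
        _ = _ := by ring
    have hgc : ContinuousOn g (Icc 0 1) := by
      have h1 : ContinuousOn (fun t => A (x₀ + t • w, β w t)) (Icc 0 1) := by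
        refine ContinuousOn.comp (t := ball (x₀, y₀) R) (fun z hz => (hdiff z hz).continuousAt.continuousWithinAt)
          (ContinuousOn.prodMk (by fun_prop) (hcont w hw.le)) fun t ht => hmem w t hw.le ht
      exact (hcont w hw.le).add (continuousOn_id.smul (h1.clm_apply continuousOn_const))
    have := dist_le_of_approx_trajectories_ODE_of_mem (K := a) (a := 0) (b := 1) (δ := 0)
      (v := fun t y => A (x₀ + t • (w + δ), y) (w + δ)) (s := fun _ => closedBall y₀ (2 * a))
      (fun t ht => hlip t (w + δ) (Ico_subset_Icc_self ht) hwδ) (hcont _ hwδ) (hderiv _ hwδ)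
      (fun t _ => (dist_self _).le)
      (fun t _ => closedBall_subset_closedBall (by linarith) (hβa _ hwδ t))
      hgc hg hgb (fun t ht => hgball t (Ico_subset_Icc_self ht))
      (by simp [g, hβ0 _ hw.le, hβ0 _ hwδ]) 1 (by simp)
    rw [gronwallBound_of_K_ne_0 ha0'.ne', dist_eq_norm] at this
    simp only [g, one_smul] at this
    rw [← sub_sub] at this
    refine this.trans (le_of_eq ?_)
    simp only [sub_zero, mul_one]
    ring
  refine Asymptotics.IsBigO.trans_isLittleO (g := fun δ : E => ‖δ‖ ^ 2) ?_ ?_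
  · refine Asymptotics.IsBigO.of_bound C ?_
    have h1 : ∀ᶠ δ in 𝓝 (0 : E), ‖δ‖ < ε - ‖w‖ := by
      have : ball (0 : E) (ε - ‖w‖) ∈ 𝓝 0 := ball_mem_nhds _ (by linarith)
      filter_upwards [this] with δ hδ using by simpa using hδ
    filter_upwards [h1] with δ hδ
    rw [Real.norm_of_nonneg (by positivity), add_assoc, add_sub_cancel_left, add_sub_cancel_left]
    refine hC δ (by linarith [norm_nonneg w]) ((norm_add_le _ _).trans (by linarith))
  · have := Asymptotics.isLittleO_norm_pow_id (E' := E) (n := 2) (by norm_num)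
    simpa using this

end Frobenius

/-! ### Smooth solutions, smooth local inverses, uniqueness of frame curves. -/

section Smooth

open Metric

variable {E E' F V : Type*} [NormedAddCommGroup E] [NormedSpace ℝ E]
  [NormedAddCommGroup E'] [NormedSpace ℝ E']
  [NormedAddCommGroup F] [NormedSpace ℝ F] [NormedAddCommGroup V] [NormedSpace ℝ V]

/-- A map into a finite-dimensional space is smooth as soon as its images under a separating finite
family of functionals are. -/
theorem contMDiffWithinAt_of_separating {EM HM : Type*} [NormedAddCommGroup EM] [NormedSpace ℝ EM]
    [TopologicalSpace HM] {I : ModelWithCorners ℝ EM HM} {M : Type*} [TopologicalSpace M]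
    [ChartedSpace HM M] {k : ℕ∞ω} {ι : Type*} [Fintype ι] {f : M → F} {s : Set M} {x : M}
    (Λ : ι → F →ₗ[ℝ] ℝ) (hΛ : ∀ y, (∀ i, Λ i y = 0) → y = 0)
    (hf : ∀ i, ContMDiffWithinAt I 𝓘(ℝ, ℝ) k (fun x => Λ i (f x)) s x) :
    ContMDiffWithinAt I 𝓘(ℝ, F) k f s x := by
  let L : F →ₗ[ℝ] (ι → ℝ) := LinearMap.pi Λ
  have hL : LinearMap.ker L = ⊥ := by
    rw [LinearMap.ker_eq_bot']
    exact fun y hy => hΛ y fun i => congrFun hy i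
  obtain ⟨g, hg⟩ := L.exists_leftInverse_of_injective hL
  have h1 : ContMDiffWithinAt I 𝓘(ℝ, ι → ℝ) k (fun x => L (f x)) s x :=
    contMDiffWithinAt_pi_space.2 hf
  have h2 := (LinearMap.toContinuousLinearMap g).contMDiff.contMDiffAt.comp_contMDiffWithinAt x h1
  refine h2.congr_of_eventuallyEq (Filter.Eventually.of_forall fun y => ?_) ?_
  · exact (LinearMap.congr_fun hg (f y)).symm
  · exact (LinearMap.congr_fun hg (f x)).symm

/-- The inverse function theorem, with smoothness of the inverse on the whole target. -/
theorem ContDiffOn.exists_localInverse [CompleteSpace E] {f : E → E'} {U : Set E} (hU : IsOpen U)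
    (hf : ContDiffOn ℝ ∞ f U) {x₀ : E} (hx₀ : x₀ ∈ U) {f' : E ≃L[ℝ] E'}
    (hf' : HasFDerivAt f (f' : E →L[ℝ] E') x₀) :
    ∃ e : OpenPartialHomeomorph E E', x₀ ∈ e.source ∧ e.source ⊆ U ∧ ⇑e = f ∧
      ContDiffOn ℝ ∞ e.symm e.target := by
  have hat : ∀ x ∈ U, ContDiffAt ℝ ∞ f x := fun x hx => hf.contDiffAt (hU.mem_nhds hx)
  let e := (hat x₀ hx₀).toOpenPartialHomeomorph f hf' (by simp)
  have he : ⇑e = f := (hat x₀ hx₀).toOpenPartialHomeomorph_coe hf' (by simp)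
  have hxe : x₀ ∈ e.source := (hat x₀ hx₀).mem_toOpenPartialHomeomorph_source hf' (by simp)
  have hc : ContinuousOn (fderiv ℝ f) U := hf.continuousOn_fderiv_of_isOpen hU (by simp)
  -- Invertibility of the derivative is an open condition; shrinking to where it holds makes the
  -- inverse smooth at every point of the target.
  obtain ⟨W, hW, hWo, hxW⟩ : ∃ W ⊆ U ∩ {x | fderiv ℝ f x ∈ range
      ((↑) : (E ≃L[ℝ] E') → E →L[ℝ] E')}, IsOpen W ∧ x₀ ∈ W := by
    refine mem_nhds_iff.1 (Filter.inter_mem (hU.mem_nhds hx₀) ?_)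
    refine (hc.continuousAt (hU.mem_nhds hx₀)).preimage_mem_nhds
      (ContinuousLinearEquiv.isOpen.mem_nhds ⟨f', hf'.fderiv.symm⟩)
  let e' := e.restrOpen W hWo
  refine ⟨e', ⟨hxe, hxW⟩, fun x hx => (hW hx.2).1, he, fun y hy => ?_⟩
  have hy' : e.symm y ∈ W := (e'.map_target hy).2
  obtain ⟨g', hg'⟩ := (hW hy').2
  have h1 : HasFDerivAt e' (g' : E →L[ℝ] E') (e'.symm y) := by
    change HasFDerivAt e (g' : E →L[ℝ] E') (e.symm y)
    rw [he, hg']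
    exact ((hat _ (hW hy').1).differentiableAt (by simp)).hasFDerivAt
  refine (e'.contDiffAt_symm hy h1 ?_).contDiffWithinAt
  change ContDiffAt ℝ ∞ e (e.symm y)
  rw [he]
  exact hat _ (hW hy').1

/-- Solutions of a smooth total differential equation are smooth. -/
theorem contDiffOn_of_hasFDerivAt_comp {A : E × F → E →L[ℝ] F} {U : Set (E × F)}
    (hA : ContDiffOn ℝ ∞ A U) {S : Set E} (hS : IsOpen S) {u : E → F}
    (hu : ∀ x ∈ S, (x, u x) ∈ U ∧ HasFDerivAt u (A (x, u x)) x) : ContDiffOn ℝ ∞ u S := by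
  rw [contDiffOn_infty]
  intro k
  -- Bootstrap: if `u` is C^k, then so is its derivative `x ↦ A (x, u x)`, and `u` is C^(k+1).
  induction k with
  | zero =>
    exact contDiffOn_zero.2 fun x hx => (hu x hx).2.continuousAt.continuousWithinAt
  | succ k ih =>
    have h := contDiffOn_succ_iff_fderiv_of_isOpen (𝕜 := ℝ) (n := k) (f := u) hS
    rw [Nat.cast_add, Nat.cast_one, h]
    refine ⟨fun x hx => (hu x hx).2.differentiableAt.differentiableWithinAt, by simp, ?_⟩
    refine ContDiffOn.congr (f := fun x => A (x, u x)) ?_ fun x hx => (hu x hx).2.fderiv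
    exact (hA.of_le (by exact_mod_cast le_top)).comp (contDiffOn_id.prodMk ih) fun x hx => (hu x hx).1

/-- Uniqueness for the curves with a prescribed velocity in a moving frame. -/
theorem exists_nhds_frame_curve_unique {Y : E → V →L[ℝ] E} {y₀ : E} (hY : ContDiffAt ℝ 1 Y y₀) :
    ∃ W ∈ 𝓝 y₀, ∀ (a : ℝ → V) (C : ℝ) (γ₁ γ₂ : ℝ → E),
      (∀ t ∈ Ico (0 : ℝ) 1, ‖a t‖ ≤ C) →
      (∀ t ∈ Icc (0 : ℝ) 1, γ₁ t ∈ W ∧ HasDerivAt γ₁ (Y (γ₁ t) (a t)) t) →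
      (∀ t ∈ Icc (0 : ℝ) 1, γ₂ t ∈ W ∧ HasDerivAt γ₂ (Y (γ₂ t) (a t)) t) →
      γ₁ 0 = γ₂ 0 → γ₁ 1 = γ₂ 1 := by
  obtain ⟨K, W, hW, hK⟩ := hY.exists_lipschitzOnWith
  refine ⟨W, hW, fun a C γ₁ γ₂ ha h₁ h₂ h0 => ?_⟩
  refine ODE_solution_unique_of_mem_Icc_right (K := K * C.toNNReal) (a := 0) (b := 1)
    (v := fun t y => Y y (a t)) (s := fun _ => W) (fun t ht => ?_)
    (fun t ht => (h₁ t ht).2.continuousAt.continuousWithinAt)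
    (fun t ht => (h₁ t (Ico_subset_Icc_self ht)).2.hasDerivWithinAt)
    (fun t ht => (h₁ t (Ico_subset_Icc_self ht)).1)
    (fun t ht => (h₂ t ht).2.continuousAt.continuousWithinAt)
    (fun t ht => (h₂ t (Ico_subset_Icc_self ht)).2.hasDerivWithinAt)
    (fun t ht => (h₂ t (Ico_subset_Icc_self ht)).1) h0 (right_mem_Icc.2 zero_le_one)
  refine LipschitzOnWith.of_dist_le_mul fun y hy y' hy' => ?_
  rw [dist_eq_norm, ← sub_apply, dist_eq_norm]
  calc ‖(Y y - Y y') (a t)‖ ≤ ‖Y y - Y y'‖ * ‖a t‖ := ContinuousLinearMap.le_opNorm _ _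
    _ ≤ (K * ‖y - y'‖) * C := by
        gcongr
        · exact hK.norm_sub_le hy hy'
        · exact ha t ht
    _ = K * C * ‖y - y'‖ := by ring
    _ ≤ _ := by
        push_cast
        gcongr
        exact Real.le_coe_toNNReal C

end Smooth

/-! ### Constructing symmetries of a coframe in coordinates. -/

section Coframe

variable {E₁ E₂ V : Type*} [NormedAddCommGroup E₁] [NormedSpace ℝ E₁]
  [NormedAddCommGroup E₂] [NormedSpace ℝ E₂] [NormedAddCommGroup V] [NormedSpace ℝ V]

/-- Local equivalence of a coframe with itself: if the first components of the dual frame `Y` and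
the structure function `T` depend on the first variable only, then points with the same first
component are related by a symmetry of the coframe `B = Y⁻¹`. -/
theorem exists_coframe_symmetry [FiniteDimensional ℝ E₁] [FiniteDimensional ℝ E₂]
    {s₁ : Set E₁} {s₂ : Set E₂} (hs₁ : IsOpen s₁) (hs₂ : IsOpen s₂)
    {Y : E₁ × E₂ → V →L[ℝ] E₁ × E₂} {B : E₁ × E₂ → E₁ × E₂ →L[ℝ] V}
    (hY : ContDiffOn ℝ ∞ Y (s₁ ×ˢ s₂)) (hB : ContDiffOn ℝ ∞ B (s₁ ×ˢ s₂))
    (hYB : ∀ q ∈ s₁ ×ˢ s₂, ∀ w, Y q (B q w) = w) (hBY : ∀ q ∈ s₁ ×ˢ s₂, ∀ v, B q (Y q v) = v)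
    (hfst : ∀ z ∈ s₁, ∀ y ∈ s₂, ∀ y' ∈ s₂, ∀ v, (Y (z, y) v).1 = (Y (z, y') v).1)
    {T : E₁ × E₂ → V → V → V}
    (hT : ∀ q ∈ s₁ ×ˢ s₂, ∀ v w, fderiv ℝ Y q (Y q v) w - fderiv ℝ Y q (Y q w) v = Y q (T q v w))
    (hT' : ∀ z ∈ s₁, ∀ y ∈ s₂, ∀ y' ∈ s₂, ∀ v w, T (z, y) v w = T (z, y') v w)
    {z₀ : E₁} {y₁ y₂ : E₂} (hz₀ : z₀ ∈ s₁) (hy₁ : y₁ ∈ s₂) (hy₂ : y₂ ∈ s₂) :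
    ∃ Φ : OpenPartialHomeomorph (E₁ × E₂) (E₁ × E₂), (z₀, y₁) ∈ Φ.source ∧
      Φ.source ⊆ s₁ ×ˢ s₂ ∧ Φ.target ⊆ s₁ ×ˢ s₂ ∧ Φ (z₀, y₁) = (z₀, y₂) ∧
      ContDiffOn ℝ ∞ Φ Φ.source ∧ ContDiffOn ℝ ∞ Φ.symm Φ.target ∧
      ∀ q ∈ Φ.source, HasFDerivAt Φ ((Y (Φ q)).comp (B q)) q := by
  have := FiniteDimensional.complete ℝ E₁
  have := FiniteDimensional.complete ℝ E₂
  set O : Set (E₁ × E₂) := s₁ ×ˢ s₂ with hO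
  have hOo : IsOpen O := hs₁.prod hs₂
  let ψ : (E₁ × E₂) × E₂ →L[ℝ] E₁ × E₂ :=
    ((ContinuousLinearMap.fst ℝ E₁ E₂).comp (ContinuousLinearMap.fst ℝ _ _)).prod
      (ContinuousLinearMap.snd ℝ _ _)
  -- The symmetry is sought as `(z, y) ↦ (z, u (z, y))` with derivative `Y (Φ q) ∘ B q`. The second
  -- component of this equation is `u' = A (q, u)`; the first holds automatically by `hAfst`.
  let A : (E₁ × E₂) × E₂ → E₁ × E₂ →L[ℝ] E₂ := fun p =>
    (ContinuousLinearMap.snd ℝ E₁ E₂).comp ((Y (ψ p)).comp (B p.1))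
  set U : Set ((E₁ × E₂) × E₂) := O ×ˢ s₂ with hUdef
  have hUo : IsOpen U := hOo.prod hs₂
  have hψ : ∀ p ∈ U, ψ p ∈ O := fun p hp => ⟨hp.1.1, hp.2⟩
  have hA : ContDiffOn ℝ ∞ A U :=
    contDiffOn_const.clm_comp ((hY.comp ψ.contDiff.contDiffOn hψ).clm_comp
      (hB.comp contDiff_fst.contDiffOn fun p hp => hp.1))
  have hAfst : ∀ p ∈ U, ∀ w, Y (ψ p) (B p.1 w) = (w.1, A p w) := by
    rintro ⟨⟨z, y⟩, η⟩ ⟨⟨hz, hy⟩, hη⟩ w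
    refine Prod.ext ?_ rfl
    rw [show ψ ((z, y), η) = (z, η) from rfl, hfst z hz η hη y hy, hYB _ ⟨hz, hy⟩]
  have hYd : ∀ q ∈ O, HasFDerivAt Y (fderiv ℝ Y q) q := fun q hq =>
    ((hY.contDiffAt (hOo.mem_nhds hq)).differentiableAt (by simp)).hasFDerivAt
  have hBd : ∀ q ∈ O, HasFDerivAt B (fderiv ℝ B q) q := fun q hq =>
    ((hB.contDiffAt (hOo.mem_nhds hq)).differentiableAt (by simp)).hasFDerivAt
  -- Differentiation of `B q (Y q w) = w`.
  have hDB : ∀ q ∈ O, ∀ v w, fderiv ℝ B q v (Y q w) = - B q (fderiv ℝ Y q v w) := by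
    intro q hq v w
    have h1 := (hBd q hq).clm_apply ((hYd q hq).clm_apply (hasFDerivAt_const w q))
    have h2 : HasFDerivAt (fun q => B q (Y q w)) (0 : E₁ × E₂ →L[ℝ] V) q := by
      refine (hasFDerivAt_const w q).congr_of_eventuallyEq ?_
      filter_upwards [hOo.mem_nhds hq] with q' hq' using hBY q' hq' w
    have h3 := DFunLike.congr_fun (h1.unique h2) v
    simp at h3
    exact eq_neg_of_add_eq_zero_right h3
  have hint : ∀ p ∈ U, ∀ v w, fderiv ℝ A p (v, A p v) w = fderiv ℝ A p (w, A p w) v := by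
    intro p hp v w
    have key : ∀ v w, fderiv ℝ A p (v, A p v) w =
        (fderiv ℝ Y (ψ p) (Y (ψ p) (B p.1 v)) (B p.1 w) + Y (ψ p) (fderiv ℝ B p.1 v w)).2 := by
      intro v w
      have h1 : HasFDerivAt (fun p => A p w) _ p :=
        (ContinuousLinearMap.snd ℝ E₁ E₂).hasFDerivAt.comp p
          (((hYd _ (hψ p hp)).comp p ψ.hasFDerivAt).clm_apply
            (((hBd _ hp.1).comp p hasFDerivAt_fst).clm_apply (hasFDerivAt_const w p)))
      have h2 : HasFDerivAt (fun p => A p w) _ p :=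
        ((hA.contDiffAt (hUo.mem_nhds hp)).differentiableAt (by simp)).hasFDerivAt.clm_apply
          (hasFDerivAt_const w p)
      have h3 := DFunLike.congr_fun (h2.unique h1) (v, A p v)
      -- The direction in which `A` is differentiated projects under `ψ` to a frame direction, which
      -- makes the structure equation applicable.
      have h4 : ψ (v, A p v) = Y (ψ p) (B p.1 v) := (hAfst p hp v).symm
      simp [h4] at h3
      rw [h3, Prod.snd_add, add_comm]
    rw [key, key, ← sub_eq_zero, ← Prod.snd_sub]
    have h1 := hT _ (hψ p hp) (B p.1 v) (B p.1 w)
    have h2 := hT _ hp.1 (B p.1 v) (B p.1 w)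
    -- The structure equation in its dual form, dB = -T(B, B).
    have h3 : fderiv ℝ B p.1 v w - fderiv ℝ B p.1 w v = - T p.1 (B p.1 v) (B p.1 w) := by
      have e1 := hDB p.1 hp.1 v (B p.1 w)
      have e2 := hDB p.1 hp.1 w (B p.1 v)
      rw [hYB _ hp.1] at e1 e2
      rw [hYB _ hp.1, hYB _ hp.1] at h2
      rw [e1, e2, ← hBY p.1 hp.1 (T p.1 _ _), ← h2, map_sub]
      abel
    have h4 : T (ψ p) (B p.1 v) (B p.1 w) = T p.1 (B p.1 v) (B p.1 w) :=
      hT' p.1.1 hp.1.1 _ hp.2 _ hp.1.2 _ _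
    -- The structure functions at the target point `ψ p` and the source point `p.1` coincide, as the
    -- two points share `z`; their contributions from `Y` and from `B` cancel.
    have h5 : fderiv ℝ Y (ψ p) (Y (ψ p) (B p.1 v)) (B p.1 w) + Y (ψ p) (fderiv ℝ B p.1 v w) -
        (fderiv ℝ Y (ψ p) (Y (ψ p) (B p.1 w)) (B p.1 v) + Y (ψ p) (fderiv ℝ B p.1 w v)) = 0 := by
      rw [add_sub_add_comm, h1, h4, ← map_sub, h3, map_neg, add_neg_cancel]
    rw [h5, Prod.snd_zero]
  have hp₀ : (((z₀, y₁), y₂) : (E₁ × E₂) × E₂) ∈ U := ⟨⟨hz₀, hy₁⟩, hy₂⟩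
  obtain ⟨u, ε, hε, hu0, hu⟩ := exists_hasFDerivAt_of_integrable (hUo.mem_nhds hp₀)
    ((hA.contDiffAt (hUo.mem_nhds hp₀)).of_le (WithTop.coe_le_coe.2 (le_top : (2 : ℕ∞) ≤ ⊤))) hint
  set S := Metric.ball ((z₀, y₁) : E₁ × E₂) ε
  have hus : ContDiffOn ℝ ∞ u S := contDiffOn_of_hasFDerivAt_comp hA Metric.isOpen_ball hu
  let f : E₁ × E₂ → E₁ × E₂ := fun q => (q.1, u q)
  have hf : ContDiffOn ℝ ∞ f S := contDiff_fst.contDiffOn.prodMk hus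
  have hfO : ∀ q ∈ S, f q ∈ O := fun q hq => hψ _ (hu q hq).1
  have hf' : ∀ q ∈ S, HasFDerivAt f ((Y (f q)).comp (B q)) q := by
    intro q hq
    refine (hasFDerivAt_fst.prodMk (hu q hq).2).congr_fderiv ?_
    exact ContinuousLinearMap.ext fun w => (hAfst (q, u q) (hu q hq).1 w).symm
  have hq₀ : ((z₀, y₁) : E₁ × E₂) ∈ S := Metric.mem_ball_self hε
  -- The inverse of the derivative `Y (f q) ∘ B q` is `Y q ∘ B (f q)`.
  let f' : (E₁ × E₂) ≃L[ℝ] (E₁ × E₂) := ContinuousLinearEquiv.equivOfInverse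
    ((Y (f (z₀, y₁))).comp (B (z₀, y₁))) ((Y (z₀, y₁)).comp (B (f (z₀, y₁))))
    (fun w => by simp [hBY _ (hfO _ hq₀), hYB _ (hu _ hq₀).1.1])
    (fun w => by simp [hYB _ (hfO _ hq₀), hBY _ (hu _ hq₀).1.1])
  obtain ⟨Φ, h1, h2, h3, h4⟩ := hf.exists_localInverse Metric.isOpen_ball hq₀ (f' := f')
    (hf' _ hq₀)
  refine ⟨Φ, h1, fun q hq => (hu q (h2 hq)).1.1, fun q hq => ?_, ?_, ?_, h4, fun q hq => ?_⟩
  · rw [← Φ.right_inv hq, h3]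
    exact hfO _ (h2 (Φ.map_target hq))
  · rw [h3]; simp only [f, hu0]
  · rw [h3]; exact hf.mono h2
  · rw [h3]; exact hf' q (h2 hq)

end Coframe

/-! ### Vector fields and brackets in coordinates. -/

section SmoothCoordinates

variable {E E' : Type*} [NormedAddCommGroup E] [NormedSpace ℝ E]
  [NormedAddCommGroup E'] [NormedSpace ℝ E']
  {M : Type*} [TopologicalSpace M] [ChartedSpace E M]

/-- A differentiable vector field on a normed space is a differentiable function. -/
theorem MDifferentiableAt.snd_of_model {V : E → E} {x : E}
    (hV : MDifferentiableAt 𝓘(ℝ, E) 𝓘(ℝ, E).tangent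
      (fun x => (⟨x, V x⟩ : TangentBundle 𝓘(ℝ, E) E)) x) : DifferentiableAt ℝ V x := by
  exact (((contMDiff_snd_tangentBundle_modelSpace E 𝓘(ℝ, E) (n := 1)).mdifferentiable
    (by simp) _).comp x hV).differentiableAt

theorem VectorField.mlieBracket_eq_lieBracket (V W : E → E) (x : E) :
    (VectorField.mlieBracket 𝓘(ℝ, E) V W x : E) = VectorField.lieBracket ℝ V W x := by
  have h := congrFun (VectorField.mlieBracketWithin_eq_lieBracketWithin (𝕜 := ℝ) (V := V) (W := W)
    (s := univ)) x
  rw [VectorField.lieBracketWithin_univ] at h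
  exact (congrFun VectorField.mlieBracketWithin_univ x).symm.trans h

variable (E) in
/-- `e` is a diffeomorphism between an open subset of `M` and an open subset of `E'`. -/
structure OpenPartialHomeomorph.IsSmoothCoordinates (e : OpenPartialHomeomorph M E') : Prop where
  contMDiffOn : ContMDiffOn 𝓘(ℝ, E) 𝓘(ℝ, E') ∞ e e.source
  contMDiffOn_symm : ContMDiffOn 𝓘(ℝ, E') 𝓘(ℝ, E) ∞ e.symm e.target

theorem OpenPartialHomeomorph.isSmoothCoordinates_chartAt [IsManifold 𝓘(ℝ, E) ∞ M] (x : M) :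
    (chartAt E x).IsSmoothCoordinates E :=
  ⟨contMDiffOn_chart, contMDiffOn_chart_symm⟩

/-- The vector field `V` in the coordinates `e`. -/
noncomputable def OpenPartialHomeomorph.pushforward (e : OpenPartialHomeomorph M E')
    (V : Π x : M, TangentSpace 𝓘(ℝ, E) x) (y : E') : E' :=
  mfderiv 𝓘(ℝ, E) 𝓘(ℝ, E') e (e.symm y) (V (e.symm y))

theorem OpenPartialHomeomorph.pushforward_apply (e : OpenPartialHomeomorph M E')
    {V : Π x : M, TangentSpace 𝓘(ℝ, E) x} {q : M} (hq : q ∈ e.source) :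
    e.pushforward V (e q) = mfderiv 𝓘(ℝ, E) 𝓘(ℝ, E') e q (V q) := by
  -- The points `e.symm (e q)` and `q` carry different tangent space types that unfold to the same
  -- model space. Stating the equality for a variable point and substituting avoids casts; the same
  -- device recurs below.
  have h : ∀ q' : M, q' = q → (mfderiv 𝓘(ℝ, E) 𝓘(ℝ, E') e q' (V q') : E') =
      (mfderiv 𝓘(ℝ, E) 𝓘(ℝ, E') e q (V q) : E') := by rintro _ rfl; rfl
  exact h _ (e.left_inv hq)

namespace OpenPartialHomeomorph.IsSmoothCoordinates

variable {e : OpenPartialHomeomorph M E'} (he : e.IsSmoothCoordinates E)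
include he

theorem contMDiffAt {q : M} (hq : q ∈ e.source) : ContMDiffAt 𝓘(ℝ, E) 𝓘(ℝ, E') ∞ e q :=
  he.contMDiffOn.contMDiffAt (e.open_source.mem_nhds hq)

theorem contMDiffAt_symm {y : E'} (hy : y ∈ e.target) :
    ContMDiffAt 𝓘(ℝ, E') 𝓘(ℝ, E) ∞ e.symm y :=
  he.contMDiffOn_symm.contMDiffAt (e.open_target.mem_nhds hy)

theorem mdifferentiableAt {q : M} (hq : q ∈ e.source) :
    MDifferentiableAt 𝓘(ℝ, E) 𝓘(ℝ, E') e q :=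
  (he.contMDiffAt hq).mdifferentiableAt (by simp)

theorem mdifferentiableAt_symm {y : E'} (hy : y ∈ e.target) :
    MDifferentiableAt 𝓘(ℝ, E') 𝓘(ℝ, E) e.symm y :=
  (he.contMDiffAt_symm hy).mdifferentiableAt (by simp)

theorem mfderiv_apply_symm {y : E'} (hy : y ∈ e.target) (w : E') :
    mfderiv 𝓘(ℝ, E) 𝓘(ℝ, E') e (e.symm y) (mfderiv 𝓘(ℝ, E') 𝓘(ℝ, E) e.symm y w) = w := by
  have h1 := mfderiv_comp_apply y (he.mdifferentiableAt (e.map_target hy))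
    (he.mdifferentiableAt_symm hy) w
  rw [← h1]
  have h2 : (e ∘ e.symm) =ᶠ[𝓝 y] id := by
    filter_upwards [e.open_target.mem_nhds hy] with z hz using e.right_inv hz
  rw [h2.mfderiv_eq, mfderiv_id]
  rfl

theorem mfderiv_symm_apply {q : M} (hq : q ∈ e.source) (ξ : TangentSpace 𝓘(ℝ, E) q) :
    mfderiv 𝓘(ℝ, E') 𝓘(ℝ, E) e.symm (e q) (mfderiv 𝓘(ℝ, E) 𝓘(ℝ, E') e q ξ) = ξ := by
  have h1 := mfderiv_comp_apply q (he.mdifferentiableAt_symm (e.map_source hq))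
    (he.mdifferentiableAt hq) ξ
  rw [← h1]
  have h2 : (e.symm ∘ e) =ᶠ[𝓝 q] id := by
    filter_upwards [e.open_source.mem_nhds hq] with z hz using e.left_inv hz
  rw [h2.mfderiv_eq, mfderiv_id]
  rfl

theorem mfderiv_symm_inverse {y : E'} (hy : y ∈ e.target) :
    (mfderiv 𝓘(ℝ, E') 𝓘(ℝ, E) e.symm y).inverse =
      mfderiv 𝓘(ℝ, E) 𝓘(ℝ, E') e (e.symm y) := by
  have h := he.mfderiv_symm_apply (e.map_target hy)
  rw [e.right_inv hy] at h
  exact ContinuousLinearMap.inverse_eq (ContinuousLinearMap.ext fun ξ => h ξ)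
    (ContinuousLinearMap.ext fun w => he.mfderiv_apply_symm hy w)

theorem isInvertible_mfderiv_symm {y : E'} (hy : y ∈ e.target) :
    (mfderiv 𝓘(ℝ, E') 𝓘(ℝ, E) e.symm y).IsInvertible := by
  have h := he.mfderiv_symm_apply (e.map_target hy)
  rw [e.right_inv hy] at h
  exact ⟨ContinuousLinearEquiv.equivOfInverse (mfderiv 𝓘(ℝ, E') 𝓘(ℝ, E) e.symm y)
    (mfderiv 𝓘(ℝ, E) 𝓘(ℝ, E') e (e.symm y)) (he.mfderiv_apply_symm hy) h, rfl⟩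

theorem mvfderiv_apply {F : Type*} [NormedAddCommGroup F] [NormedSpace ℝ F] {f : M → F} {q : M}
    (hq : q ∈ e.source) (hf : MDifferentiableAt 𝓘(ℝ, E) 𝓘(ℝ, F) f q) (ξ : TangentSpace 𝓘(ℝ, E) q) :
    mvfderiv 𝓘(ℝ, E) f q ξ =
      fderiv ℝ (f ∘ e.symm) (e q) (mfderiv 𝓘(ℝ, E) 𝓘(ℝ, E') e q ξ) := by
  have hq' := e.map_source hq
  have h1 : MDifferentiableAt 𝓘(ℝ, E) 𝓘(ℝ, F) f (e.symm (e q)) := by rwa [e.left_inv hq]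
  have h2 := mfderiv_comp_apply (e q) h1 (he.mdifferentiableAt_symm hq')
    (mfderiv 𝓘(ℝ, E) 𝓘(ℝ, E') e q ξ)
  rw [mfderiv_eq_fderiv, he.mfderiv_symm_apply hq, e.left_inv hq] at h2
  exact h2.symm

/-- Pushing forward by a chart is pulling back by its inverse, so the naturality results for
`mpullback` carry over to coordinates. -/
theorem mpullback_symm_eq {V : Π x : M, TangentSpace 𝓘(ℝ, E) x} {y : E'} (hy : y ∈ e.target) :
    VectorField.mpullback 𝓘(ℝ, E') 𝓘(ℝ, E) e.symm V y = e.pushforward V y := by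
  rw [VectorField.mpullback_apply, he.mfderiv_symm_inverse hy]
  rfl

variable [IsManifold 𝓘(ℝ, E) ∞ M] [CompleteSpace E] [CompleteSpace E']

theorem differentiableAt_pushforward {V : Π x : M, TangentSpace 𝓘(ℝ, E) x} {q : M}
    (hq : q ∈ e.source)
    (hV : MDifferentiableAt 𝓘(ℝ, E) 𝓘(ℝ, E).tangent (fun x => (⟨x, V x⟩ : TangentBundle 𝓘(ℝ, E) M)) q) :
    DifferentiableAt ℝ (e.pushforward V) (e q) := by
  have hq' := e.map_source hq
  have h1 : MDifferentiableAt 𝓘(ℝ, E) 𝓘(ℝ, E).tangent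
    (fun x => (⟨x, V x⟩ : TangentBundle 𝓘(ℝ, E) M)) (e.symm (e q)) := by rwa [e.left_inv hq]
  have : IsManifold 𝓘(ℝ, E) 2 M := IsManifold.of_le (n := ∞) (WithTop.coe_le_coe.2 (le_top : (2 : ℕ∞) ≤ ⊤))
  have h2 := MDifferentiableAt.mpullback_vectorField h1 (he.contMDiffAt_symm hq')
    (he.isInvertible_mfderiv_symm hq') (WithTop.coe_le_coe.2 (le_top : (2 : ℕ∞) ≤ ⊤))
  have h3 := MDifferentiableAt.snd_of_model h2
  refine h3.congr_of_eventuallyEq ?_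
  filter_upwards [e.open_target.mem_nhds hq'] with y hy using (he.mpullback_symm_eq hy).symm

/-- Naturality of the bracket under pullback by `e.symm`, where the bracket on the model space is
the usual one. -/
theorem mfderiv_mlieBracket {V W : Π x : M, TangentSpace 𝓘(ℝ, E) x} {q : M} (hq : q ∈ e.source)
    (hV : MDifferentiableAt 𝓘(ℝ, E) 𝓘(ℝ, E).tangent (fun x => (⟨x, V x⟩ : TangentBundle 𝓘(ℝ, E) M)) q)
    (hW : MDifferentiableAt 𝓘(ℝ, E) 𝓘(ℝ, E).tangent (fun x => (⟨x, W x⟩ : TangentBundle 𝓘(ℝ, E) M)) q) :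
    mfderiv 𝓘(ℝ, E) 𝓘(ℝ, E') e q (VectorField.mlieBracket 𝓘(ℝ, E) V W q) =
      VectorField.lieBracket ℝ (e.pushforward V) (e.pushforward W) (e q) := by
  have hq' := e.map_source hq
  have hV' : MDifferentiableAt 𝓘(ℝ, E) 𝓘(ℝ, E).tangent
    (fun x => (⟨x, V x⟩ : TangentBundle 𝓘(ℝ, E) M)) (e.symm (e q)) := by rwa [e.left_inv hq]
  have hW' : MDifferentiableAt 𝓘(ℝ, E) 𝓘(ℝ, E).tangent
    (fun x => (⟨x, W x⟩ : TangentBundle 𝓘(ℝ, E) M)) (e.symm (e q)) := by rwa [e.left_inv hq]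
  have hle : minSmoothness ℝ 3 ≤ (∞ : ℕ∞ω) := by
    rw [minSmoothness_of_isRCLikeNormedField]
    exact WithTop.coe_le_coe.2 (le_top : (3 : ℕ∞) ≤ ⊤)
  have : IsManifold 𝓘(ℝ, E) (minSmoothness ℝ 3) M := IsManifold.of_le (n := ∞) hle
  have h := VectorField.mpullback_mlieBracket hV' hW' (he.contMDiffAt_symm hq')
    (le_trans (minSmoothness_monotone (by norm_num)) hle)
  have e1 : ∀ V : Π x : M, TangentSpace 𝓘(ℝ, E) x,
      VectorField.mpullback 𝓘(ℝ, E') 𝓘(ℝ, E) e.symm V =ᶠ[𝓝 (e q)] e.pushforward V := by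
    intro V
    filter_upwards [e.open_target.mem_nhds hq'] with y hy using he.mpullback_symm_eq hy
  have h' := (he.mpullback_symm_eq (V := VectorField.mlieBracket 𝓘(ℝ, E) V W) hq').symm.trans h
  exact (e.pushforward_apply hq).symm.trans (h'.trans
    (((e1 V).mlieBracket_vectorField_eq (e1 W)).trans
      (VectorField.mlieBracket_eq_lieBracket _ _ _)))

theorem mvfderiv_apply_field {F : Type*} [NormedAddCommGroup F] [NormedSpace ℝ F] {f : M → F}
    {V : Π x : M, TangentSpace 𝓘(ℝ, E) x} {q : M}
    (hq : q ∈ e.source) (hf : MDifferentiableAt 𝓘(ℝ, E) 𝓘(ℝ, F) f q) :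
    mvfderiv 𝓘(ℝ, E) f q (V q) = fderiv ℝ (f ∘ e.symm) (e q) (e.pushforward V (e q)) := by
  rw [he.mvfderiv_apply hq hf, e.pushforward_apply hq]

/-- The iterated derivative `W (V f)` in coordinates. -/
theorem mvfderiv_mvfderiv_apply {F : Type*} [NormedAddCommGroup F] [NormedSpace ℝ F] {f : M → F}
    {V W : Π x : M, TangentSpace 𝓘(ℝ, E) x} {q : M} (hq : q ∈ e.source)
    (hf : ∀ᶠ x in 𝓝 q, MDifferentiableAt 𝓘(ℝ, E) 𝓘(ℝ, F) f x)
    (hf' : DifferentiableAt ℝ (fderiv ℝ (f ∘ e.symm)) (e q))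
    (hV : MDifferentiableAt 𝓘(ℝ, E) 𝓘(ℝ, E).tangent (fun x => (⟨x, V x⟩ : TangentBundle 𝓘(ℝ, E) M)) q) :
    mvfderiv 𝓘(ℝ, E) (fun x => mvfderiv 𝓘(ℝ, E) f x (V x)) q (W q) =
      fderiv ℝ (fderiv ℝ (f ∘ e.symm)) (e q) (e.pushforward W (e q)) (e.pushforward V (e q)) +
        fderiv ℝ (f ∘ e.symm) (e q) (fderiv ℝ (e.pushforward V) (e q) (e.pushforward W (e q))) := by
  have hq' := e.map_source hq
  have h1 : (fun x => mvfderiv 𝓘(ℝ, E) f x (V x)) =ᶠ[𝓝 q]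
      (fun y => fderiv ℝ (f ∘ e.symm) y (e.pushforward V y)) ∘ e := by
    filter_upwards [hf, e.open_source.mem_nhds hq] with x hx hx'
    exact he.mvfderiv_apply_field hx' hx
  have hPV : DifferentiableAt ℝ (e.pushforward V) (e q) := he.differentiableAt_pushforward hq hV
  have h2 : HasFDerivAt (fun y => fderiv ℝ (f ∘ e.symm) y (e.pushforward V y)) _ (e q) :=
    hf'.hasFDerivAt.clm_apply hPV.hasFDerivAt
  have h3 : MDifferentiableAt 𝓘(ℝ, E) 𝓘(ℝ, F) (fun x => mvfderiv 𝓘(ℝ, E) f x (V x)) q := by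
    refine MDifferentiableAt.congr_of_eventuallyEq ?_ h1
    exact MDifferentiableAt.comp q h2.differentiableAt.mdifferentiableAt (he.mdifferentiableAt hq)
  have h4 : (fun x => mvfderiv 𝓘(ℝ, E) f x (V x)) ∘ e.symm =ᶠ[𝓝 (e q)]
      (fun y => fderiv ℝ (f ∘ e.symm) y (e.pushforward V y)) := by
    have h5 : Filter.Tendsto e.symm (𝓝 (e q)) (𝓝 q) := by
      simpa [ContinuousAt, e.left_inv hq] using e.continuousAt_symm hq'
    filter_upwards [e.open_target.mem_nhds hq', h5.eventually h1] with y hy hy'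
    simpa [e.right_inv hy] using hy'
  rw [he.mvfderiv_apply_field hq h3, h4.fderiv_eq, h2.fderiv, add_comm]
  rfl

end OpenPartialHomeomorph.IsSmoothCoordinates

/-- The Lie bracket of vector fields acts on functions as the commutator of derivations. -/
theorem VectorField.mvfderiv_mlieBracket [IsManifold 𝓘(ℝ, E) ∞ M] [CompleteSpace E]
    {F : Type*} [NormedAddCommGroup F] [NormedSpace ℝ F]
    {V W : Π x : M, TangentSpace 𝓘(ℝ, E) x} {f : M → F} {q : M}
    (hV : MDifferentiableAt 𝓘(ℝ, E) 𝓘(ℝ, E).tangent (fun x => (⟨x, V x⟩ : TangentBundle 𝓘(ℝ, E) M)) q)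
    (hW : MDifferentiableAt 𝓘(ℝ, E) 𝓘(ℝ, E).tangent (fun x => (⟨x, W x⟩ : TangentBundle 𝓘(ℝ, E) M)) q)
    (hf : ContMDiffAt 𝓘(ℝ, E) 𝓘(ℝ, F) 2 f q) :
    mvfderiv 𝓘(ℝ, E) f q (VectorField.mlieBracket 𝓘(ℝ, E) V W q) =
      mvfderiv 𝓘(ℝ, E) (fun x => mvfderiv 𝓘(ℝ, E) f x (W x)) q (V q) -
        mvfderiv 𝓘(ℝ, E) (fun x => mvfderiv 𝓘(ℝ, E) f x (V x)) q (W q) := by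
  have hqs : q ∈ (chartAt E q).source := mem_chart_source E q
  set e := chartAt E q
  have he : e.IsSmoothCoordinates E := OpenPartialHomeomorph.isSmoothCoordinates_chartAt q
  have hq' := e.map_source hqs
  have h2 : (2 : ℕ∞ω) ≤ ∞ := WithTop.coe_le_coe.2 (le_top : (2 : ℕ∞) ≤ ⊤)
  have hf2 : ContDiffAt ℝ 2 (f ∘ e.symm) (e q) := by
    rw [← contMDiffAt_iff_contDiffAt]
    exact ContMDiffAt.comp_of_eq hf ((he.contMDiffAt_symm hq').of_le h2) (e.left_inv hqs)
  have hfd : DifferentiableAt ℝ (fderiv ℝ (f ∘ e.symm)) (e q) :=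
    (hf2.fderiv_right (m := 1) (by norm_num)).differentiableAt (by norm_num)
  have : IsManifold 𝓘(ℝ, E) 2 M := IsManifold.of_le (n := ∞) h2
  have hnear : ∀ᶠ x in 𝓝 q, MDifferentiableAt 𝓘(ℝ, E) 𝓘(ℝ, F) f x := by
    filter_upwards [(contMDiffAt_iff_contMDiffAt_nhds (by simp)).1 hf] with x hx
      using hx.mdifferentiableAt (by simp)
  rw [he.mvfderiv_mvfderiv_apply hqs hnear hfd hV, he.mvfderiv_mvfderiv_apply hqs hnear hfd hW,
    he.mvfderiv_apply hqs (hf.mdifferentiableAt (by simp)),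
    he.mfderiv_mlieBracket hqs hV hW, VectorField.lieBracket, map_sub]
  -- The second-derivative terms cancel by symmetry; the terms left over are the coordinate bracket.
  have hsymm : IsSymmSndFDerivAt ℝ (f ∘ e.symm) (e q) := hf2.isSymmSndFDerivAt (by simp)
  rw [hsymm.eq (e.pushforward W (e q)) (e.pushforward V (e q))]
  abel

end SmoothCoordinates

/-! ### The de Rham differential through the Koszul formula. -/

section DeRham

/-- Cartan's formula for the exterior derivative, in degree `k ≥ 0`, with the brackets `[Vᵢ, Vⱼ]`
standing in the place of `Vᵢ`. -/
theorem extDeriv_apply_vectorField_update {E : Type*} [NormedAddCommGroup E] [NormedSpace ℝ E]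
    {k : ℕ} {τ : E → E [⋀^Fin k]→L[ℝ] ℝ} {V : Fin (k + 1) → E → E} {x : E}
    (hτ : DifferentiableAt ℝ τ x) (hV : ∀ i, DifferentiableAt ℝ (V i) x) :
    extDeriv τ x (V · x) =
      (∑ i : Fin (k + 1), (-1 : ℝ) ^ (i : ℕ) *
        fderiv ℝ (fun y => τ y (fun l => V (i.succAbove l) y)) x (V i x)) +
      ∑ j : Fin (k + 1), ∑ i : Fin k, if i.castSucc < j then
        (-1 : ℝ) ^ (j : ℕ) * τ x (Function.update (fun l => V (j.succAbove l) x) i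
          (VectorField.lieBracket ℝ (V i.castSucc) (V j) x)) else 0 := by
  cases k with
  | zero =>
    simp only [Finset.univ_eq_empty, Finset.sum_empty, Finset.sum_const_zero, add_zero]
    -- In degree 0 there is only one field, so the commutation hypothesis is vacuous and no bracket
    -- terms occur.
    rw [extDeriv_apply_vectorField_of_pairwise_commute hτ hV
      (fun i j hij => absurd (Subsingleton.elim (α := Fin 1) i j) hij)]
    refine Finset.sum_congr rfl fun i _ => ?_
    simp only [zsmul_eq_mul, Int.cast_pow, Int.cast_neg, Int.cast_one]
    rfl
  | succ m =>
    rw [extDeriv_apply_vectorField hτ hV, sub_eq_add_neg]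
    congr 1
    · refine Finset.sum_congr rfl fun i _ => ?_
      simp only [zsmul_eq_mul, Int.cast_pow, Int.cast_neg, Int.cast_one]
      rfl
    conv_rhs => rw [Finset.sum_comm]
    rw [← Finset.sum_neg_distrib]
    refine Finset.sum_congr rfl fun i _ => ?_
    conv_rhs => rw [Fin.sum_univ_succ, if_neg (Fin.not_lt_zero _), zero_add]
    rw [← Finset.sum_neg_distrib, ← Finset.sum_filter]
    -- The index `0` contributes no pair; after shifting the larger index by one, `i.castSucc <
    -- j.succ` means `i ≤ j`.
    have hf : Finset.filter (fun j : Fin (m + 1) => i.castSucc < j.succ) Finset.univ =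
        Finset.Ici i := by
      ext j
      simp [Fin.castSucc_lt_succ_iff]
    rw [hf]
    refine Finset.sum_congr rfl fun j hj => ?_
    rw [Finset.mem_Ici] at hj
    have H₁ : i.castSucc.succAbove j = j.succ := by simp [Fin.succAbove_of_le_castSucc, hj]
    have H₂ : j.predAbove i.castSucc = i := by simp [Fin.predAbove_of_le_castSucc, hj]
    -- Updating entry `i` amounts to deleting it and inserting the bracket there. Moving the
    -- inserted vector to the front costs the sign (-1)^i.
    have h := Fin.insertNth_removeNth i (VectorField.lieBracket ℝ (V i.castSucc) (V j.succ) x)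
      (j.succ.removeNth (V · x))
    have h' : (fun l => V (j.succ.succAbove l) x) = j.succ.removeNth (V · x) := rfl
    rw [h', ← h, ContinuousAlternatingMap.map_insertNth, Fin.removeNth_removeNth_eq_swap, H₁, H₂]
    simp only [smul_eq_mul, Fin.val_succ, pow_succ, pow_add]
    simp only [zsmul_eq_mul, Int.cast_mul, Int.cast_pow, Int.cast_neg, Int.cast_one,
      smul_eq_mul]
    ring

variable {E E' : Type*} [NormedAddCommGroup E] [NormedSpace ℝ E]
  [NormedAddCommGroup E'] [NormedSpace ℝ E']
  {M : Type*} [TopologicalSpace M] [ChartedSpace E M] {k : ℕ}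

/-- The form `Ω` in the coordinates `e`. -/
noncomputable def OpenPartialHomeomorph.pullbackForm (e : OpenPartialHomeomorph M E')
    (Ω : Π x : M, TangentSpace 𝓘(ℝ, E) x [⋀^Fin k]→L[ℝ] ℝ) (y : E') : E' [⋀^Fin k]→L[ℝ] ℝ :=
  (Ω (e.symm y)).compContinuousLinearMap (mfderiv 𝓘(ℝ, E') 𝓘(ℝ, E) e.symm y)

theorem OpenPartialHomeomorph.IsSmoothCoordinates.pullbackForm_apply
    {e : OpenPartialHomeomorph M E'} (he : e.IsSmoothCoordinates E)
    (Ω : Π x : M, TangentSpace 𝓘(ℝ, E) x [⋀^Fin k]→L[ℝ] ℝ) {q : M} (hq : q ∈ e.source)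
    (v : Fin k → TangentSpace 𝓘(ℝ, E) q) :
    e.pullbackForm Ω (e q) (fun i => mfderiv 𝓘(ℝ, E) 𝓘(ℝ, E') e q (v i)) = Ω q v := by
  have h1 : ∀ q' : M, ∀ hq' : q' = q, ∀ w : Fin k → TangentSpace 𝓘(ℝ, E) q,
      Ω q' (fun i => hq' ▸ w i) = Ω q w := by rintro _ rfl w; rfl
  have h2 : ∀ q' : M, ∀ hq' : q' = q, ∀ w : TangentSpace 𝓘(ℝ, E) q,
      (hq' ▸ w : TangentSpace 𝓘(ℝ, E) q') = (show E from w) := by rintro _ rfl w; rfl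
  refine Eq.trans ?_ (h1 _ (e.left_inv hq) v)
  refine congrArg (Ω (e.symm (e q))) (funext fun i => ?_)
  exact (he.mfderiv_symm_apply hq (v i)).trans (h2 _ (e.left_inv hq) (v i)).symm

variable [IsManifold 𝓘(ℝ, E) ∞ M]

/-- The tangent bundle trivialization used in the definition of `forms` is, over the chart domain,
the derivative of the inverse chart, so it produces exactly the coordinate expression of `Ω`. -/
theorem GStr.differentiableAt_pullbackForm_chartAt
    {Ω : Π x : M, TangentSpace 𝓘(ℝ, E) x [⋀^Fin k]→L[ℝ] ℝ}
    (hΩ : Ω ∈ GStr.forms 𝓘(ℝ, E) E (TangentSpace 𝓘(ℝ, E) : M → Type _) k) (p : M) :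
    DifferentiableAt ℝ ((chartAt E p).pullbackForm Ω) (chartAt E p p) := by
  have h := hΩ p
  have hp := mem_chart_source E p
  have he : (chartAt E p).IsSmoothCoordinates E :=
    OpenPartialHomeomorph.isSmoothCoordinates_chartAt p
  have hp' := (chartAt E p).map_source hp
  have h2 := ContMDiffAt.comp_of_eq h (he.contMDiffAt_symm hp') ((chartAt E p).left_inv hp)
  have h3 := (contMDiffAt_iff_contDiffAt.1 h2).differentiableAt (by simp)
  refine h3.congr_of_eventuallyEq ?_
  filter_upwards [(chartAt E p).open_target.mem_nhds hp'] with y hy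
  have hy' := (chartAt E p).map_target hy
  have h4 := TangentBundle.symmL_trivializationAt (𝕜 := ℝ) (I := 𝓘(ℝ, E)) (x₀ := p) hy'
  have h5 : extChartAt 𝓘(ℝ, E) p ((chartAt E p).symm y) = y := by
    simpa using (chartAt E p).right_inv hy
  rw [h5] at h4
  have h6 : mfderivWithin 𝓘(ℝ, E) 𝓘(ℝ, E) (extChartAt 𝓘(ℝ, E) p).symm (range 𝓘(ℝ, E)) y =
      mfderiv 𝓘(ℝ, E) 𝓘(ℝ, E) (chartAt E p).symm y := by
    rw [ModelWithCorners.range_eq_univ, mfderivWithin_univ]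
    rfl
  rw [h6] at h4
  exact (congrArg (fun A => (Ω ((chartAt E p).symm y)).compContinuousLinearMap A) h4).symm

/-- The de Rham differential of a smooth form on `M` exists pointwise. -/
theorem GStr.exists_isDifferential_tangentAlgebroid [CompleteSpace E]
    {Ω : Π x : M, TangentSpace 𝓘(ℝ, E) x [⋀^Fin k]→L[ℝ] ℝ}
    (hΩ : Ω ∈ GStr.forms 𝓘(ℝ, E) E (TangentSpace 𝓘(ℝ, E) : M → Type _) k) :
    ∃ ζ : Π x : M, TangentSpace 𝓘(ℝ, E) x [⋀^Fin (k + 1)]→L[ℝ] ℝ,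
      (GStr.tangentAlgebroid 𝓘(ℝ, E) M).IsDifferential Ω ζ := by
  -- Each value is computed in the preferred chart at `p`, so nothing has to be glued. Smoothness in
  -- `p` is not claimed; where it is needed it is recovered on X by
  -- `exists_isDifferential_inducedAlgebroid`.
  refine ⟨fun p => (extDeriv ((chartAt E p).pullbackForm Ω)
    (chartAt E p p)).compContinuousLinearMap (mfderiv 𝓘(ℝ, E) 𝓘(ℝ, E) (chartAt E p) p), ?_⟩
  intro s p
  have hp := mem_chart_source E p
  have he : (chartAt E p).IsSmoothCoordinates E :=
    OpenPartialHomeomorph.isSmoothCoordinates_chartAt p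
  have hd := GStr.differentiableAt_pullbackForm_chartAt hΩ p
  set e := chartAt E p
  have hs : ∀ i, MDifferentiableAt 𝓘(ℝ, E) 𝓘(ℝ, E).tangent
      (fun x => (⟨x, s i x⟩ : TangentBundle 𝓘(ℝ, E) M)) p :=
    fun i => (s i).contMDiff.mdifferentiable (by simp) p
  set V : Fin (k + 1) → E → E := fun i => e.pushforward (s i)
  have hV : ∀ i, DifferentiableAt ℝ (V i) (e p) :=
    fun i => he.differentiableAt_pushforward hp (hs i)
  have hVp : ∀ i, V i (e p) = mfderiv 𝓘(ℝ, E) 𝓘(ℝ, E) e p (s i p) :=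
    fun i => e.pushforward_apply hp
  have h1 := extDeriv_apply_vectorField_update hd hV
  refine Eq.trans ?_ (h1.trans ?_)
  · exact congrArg (extDeriv (e.pullbackForm Ω) (e p)) (funext fun i => (hVp i).symm)
  unfold LieAlgebroid.diffOnSections
  congr 1
  · refine Finset.sum_congr rfl fun i _ => ?_
    congr 1
    have h2 : (fun y => Ω y (fun l => s (i.succAbove l) y)) =ᶠ[𝓝 p]
        (fun y => e.pullbackForm Ω y (fun l => V (i.succAbove l) y)) ∘ e := by
      filter_upwards [e.open_source.mem_nhds hp] with q hq
      refine (he.pullbackForm_apply Ω hq _).symm.trans ?_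
      exact congrArg (e.pullbackForm Ω (e q)) (funext fun l => (e.pushforward_apply hq).symm)
    have h3 : DifferentiableAt ℝ (fun y => e.pullbackForm Ω y (fun l => V (i.succAbove l) y))
        (e p) := hd.continuousAlternatingMap_apply (fun l => hV _)
    have h4 : MDifferentiableAt 𝓘(ℝ, E) 𝓘(ℝ, ℝ) (fun y => Ω y (fun l => s (i.succAbove l) y)) p :=
      MDifferentiableAt.congr_of_eventuallyEq
        (MDifferentiableAt.comp p h3.mdifferentiableAt (he.mdifferentiableAt hp)) h2
    refine Eq.trans ?_ (he.mvfderiv_apply_field (V := s i) hp h4).symm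
    have h5 : Filter.Tendsto e.symm (𝓝 (e p)) (𝓝 p) := by
      simpa [ContinuousAt, e.left_inv hp] using e.continuousAt_symm (e.map_source hp)
    refine congrArg (fun A : E →L[ℝ] ℝ => A (V i (e p))) (Filter.EventuallyEq.fderiv_eq ?_)
    filter_upwards [e.open_target.mem_nhds (e.map_source hp), h5.eventually h2] with y hy hy'
    simpa [e.right_inv hy] using hy'.symm
  · refine Finset.sum_congr rfl fun j _ => Finset.sum_congr rfl fun i _ => ?_
    split_ifs
    · congr 1
      refine Eq.trans ?_ (he.pullbackForm_apply Ω hp _)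
      refine congrArg (e.pullbackForm Ω (e p)) (funext fun l => ?_)
      by_cases hl : l = i
      · subst hl
        rw [Function.update_self, Function.update_self]
        exact (he.mfderiv_mlieBracket hp (hs _) (hs _)).symm
      · rw [Function.update_of_ne hl, Function.update_of_ne hl]
        exact hVp _
    · rfl

end DeRham

/-! ### Smoothness of families of alternating and linear maps. -/

section Alternating

variable {F : Type*} [NormedAddCommGroup F] [NormedSpace ℝ F]
  {EM HM : Type*} [NormedAddCommGroup EM] [NormedSpace ℝ EM]
  [TopologicalSpace HM] {I : ModelWithCorners ℝ EM HM} {M : Type*} [TopologicalSpace M]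
  [ChartedSpace HM M] {m : ℕ∞ω} {k : ℕ}

theorem ContMDiffWithinAt.continuousAlternatingMap_apply_const {f : M → F [⋀^Fin k]→L[ℝ] ℝ}
    {s : Set M} {x : M} (hf : ContMDiffWithinAt I 𝓘(ℝ, F [⋀^Fin k]→L[ℝ] ℝ) m f s x)
    (v : Fin k → F) : ContMDiffWithinAt I 𝓘(ℝ, ℝ) m (fun y => f y v) s x :=
  (((ContinuousMultilinearMap.apply ℝ (fun _ : Fin k => F) ℝ v).comp
    (ContinuousAlternatingMap.toContinuousMultilinearMapCLM (𝕜 := ℝ) (E := F) (F := ℝ)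
      (ι := Fin k) ℝ)).contDiff.contMDiff.contMDiffAt).comp_contMDiffWithinAt x hf

/-- Expanding the arguments in a basis writes the value as a finite sum of products of coordinates
with values on constant basis vectors. -/
theorem ContMDiffWithinAt.continuousAlternatingMap_apply [FiniteDimensional ℝ F]
    {f : M → F [⋀^Fin k]→L[ℝ] ℝ} {v : Fin k → M → F} {s : Set M} {x : M}
    (hf : ContMDiffWithinAt I 𝓘(ℝ, F [⋀^Fin k]→L[ℝ] ℝ) m f s x)
    (hv : ∀ i, ContMDiffWithinAt I 𝓘(ℝ, F) m (v i) s x) :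
    ContMDiffWithinAt I 𝓘(ℝ, ℝ) m (fun y => f y (fun i => v i y)) s x := by
  let b := Module.finBasis ℝ F
  have h : ∀ y, f y (fun i => v i y) = ∑ J : Fin k → Fin (Module.finrank ℝ F),
      (∏ i, b.repr (v i y) (J i)) * f y (fun i => b (J i)) := by
    intro y
    have h1 : (fun i => v i y) = fun i => ∑ j, b.repr (v i y) j • b j :=
      funext fun i => (b.sum_repr _).symm
    conv_lhs => rw [h1]
    refine ((f y).toMultilinearMap.map_sum _).trans (Finset.sum_congr rfl fun J _ => ?_)
    exact (f y).toMultilinearMap.map_smul_univ _ _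
  simp only [h]
  refine ContMDiffWithinAt.sum fun J _ => ContMDiffWithinAt.mul (ContMDiffWithinAt.prod fun i _ => ?_)
    (hf.continuousAlternatingMap_apply_const _)
  exact (LinearMap.toContinuousLinearMap
    (b.coord (J i))).contDiff.contMDiff.contMDiffAt.comp_contMDiffWithinAt x (hv i)

/-- Evaluations on tuples of basis vectors are finitely many and separate alternating forms. -/
theorem contMDiffWithinAt_continuousAlternatingMap_iff [FiniteDimensional ℝ F]
    {f : M → F [⋀^Fin k]→L[ℝ] ℝ} {s : Set M} {x : M} :
    ContMDiffWithinAt I 𝓘(ℝ, F [⋀^Fin k]→L[ℝ] ℝ) m f s x ↔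
      ∀ v : Fin k → F, ContMDiffWithinAt I 𝓘(ℝ, ℝ) m (fun y => f y v) s x := by
  refine ⟨fun h v => h.continuousAlternatingMap_apply_const v, fun h => ?_⟩
  let b := Module.finBasis ℝ F
  refine contMDiffWithinAt_of_separating (ι := Fin k → Fin (Module.finrank ℝ F))
    (fun J => { toFun := fun g => g (fun i => b (J i)), map_add' := fun _ _ => rfl,
                map_smul' := fun _ _ => rfl }) (fun g hg => ?_) fun J => h _
  refine ContinuousAlternatingMap.toAlternatingMap_injective ?_
  refine Module.Basis.ext_alternating b fun J _ => ?_
  exact hg J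

theorem contMDiffWithinAt_clm_iff [FiniteDimensional ℝ F] {F' : Type*} [NormedAddCommGroup F']
    [NormedSpace ℝ F'] {f : M → F →L[ℝ] F'} {s : Set M} {x : M} :
    ContMDiffWithinAt I 𝓘(ℝ, F →L[ℝ] F') m f s x ↔
      ∀ v : F, ContMDiffWithinAt I 𝓘(ℝ, F') m (fun y => f y v) s x := by
  refine ⟨fun h v => h.clm_apply contMDiffWithinAt_const, fun h => ?_⟩
  let b := Module.finBasis ℝ F
  -- `d` reassembles a linear map from its values on the basis; it is itself continuous linear,
  -- hence smooth.
  let d : (Fin (Module.finrank ℝ F) → F') →L[ℝ] (F →L[ℝ] F') :=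
    ∑ i, (ContinuousLinearMap.smulRightL ℝ F F' (LinearMap.toContinuousLinearMap (b.coord i))).comp
      (ContinuousLinearMap.proj i)
  have h1 : ContMDiffWithinAt I 𝓘(ℝ, Fin (Module.finrank ℝ F) → F') m (fun y i => f y (b i)) s x :=
    contMDiffWithinAt_pi_space.2 fun i => h (b i)
  have h2 := d.contDiff.contMDiff.contMDiffAt.comp_contMDiffWithinAt x h1
  have h3 : ∀ g : F →L[ℝ] F', g = d (fun i => g (b i)) := by
    intro g
    ext v
    conv_lhs => rw [← b.sum_repr v, map_sum]
    simp [d]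
  exact h2.congr (fun y _ => h3 _) (h3 _)

end Alternating

/-! ### Coframes on manifolds and their dual frames. -/

section Coframe

variable {E E' V : Type*} [NormedAddCommGroup E] [NormedSpace ℝ E]
  [NormedAddCommGroup E'] [NormedSpace ℝ E'] [NormedAddCommGroup V] [NormedSpace ℝ V]
  {M : Type*} [TopologicalSpace M] [ChartedSpace E M] [IsManifold 𝓘(ℝ, E) ∞ M]

/-- `H` is a smooth coframe on `M` with values in `V`. -/
structure IsCoframe (H : Π p : M, TangentSpace 𝓘(ℝ, E) p →L[ℝ] V) : Prop where
  contMDiff : ContMDiff 𝓘(ℝ, E).tangent 𝓘(ℝ, V) ∞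
    (fun ξ : TangentBundle 𝓘(ℝ, E) M => H ξ.1 ξ.2)
  isInvertible : ∀ p, (H p).IsInvertible

/-- The vector field with the components `a` with respect to the coframe `H`. -/
noncomputable def frameField (H : Π p : M, TangentSpace 𝓘(ℝ, E) p →L[ℝ] V) (a : M → V) (p : M) :
    TangentSpace 𝓘(ℝ, E) p :=
  (H p).inverse (a p)

/-- The coframe `H` in the coordinates `e`. -/
noncomputable def coframeCoord (e : OpenPartialHomeomorph M E')
    (H : Π p : M, TangentSpace 𝓘(ℝ, E) p →L[ℝ] V) (y : E') : E' →L[ℝ] V :=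
  (H (e.symm y)).comp (mfderiv 𝓘(ℝ, E') 𝓘(ℝ, E) e.symm y)

/-- The frame dual to the coframe `H` in the coordinates `e`. -/
noncomputable def frameCoord (e : OpenPartialHomeomorph M E')
    (H : Π p : M, TangentSpace 𝓘(ℝ, E) p →L[ℝ] V) (y : E') : V →L[ℝ] E' :=
  (mfderiv 𝓘(ℝ, E) 𝓘(ℝ, E') e (e.symm y)).comp (H (e.symm y)).inverse

namespace IsCoframe

variable {H : Π p : M, TangentSpace 𝓘(ℝ, E) p →L[ℝ] V} (hH : IsCoframe H)
include hH

theorem apply_frameField (a : M → V) (p : M) : H p (frameField H a p) = a p :=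
  (((hH.isInvertible p).inverse_apply_eq).1 rfl).symm

theorem eq_of_apply_eq {p : M} {ξ η : TangentSpace 𝓘(ℝ, E) p} (h : H p ξ = H p η) : ξ = η :=
  (((hH.isInvertible p).inverse_apply_eq).2 rfl).symm.trans
    (((hH.isInvertible p).inverse_apply_eq).2 h)

theorem inverse_apply {p : M} (ξ : TangentSpace 𝓘(ℝ, E) p) : (H p).inverse (H p ξ) = ξ :=
  ((hH.isInvertible p).inverse_apply_eq).2 rfl

/-- The components of a smooth vector field are smooth. -/
theorem contMDiffAt_apply {m : ℕ∞ω} (hm : m ≤ ∞) {U : Π p : M, TangentSpace 𝓘(ℝ, E) p} {p : M}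
    (hU : ContMDiffAt 𝓘(ℝ, E) 𝓘(ℝ, E).tangent m (fun q => (⟨q, U q⟩ : TangentBundle 𝓘(ℝ, E) M)) p) :
    ContMDiffAt 𝓘(ℝ, E) 𝓘(ℝ, V) m (fun q => H q (U q)) p :=
  (hH.contMDiff.of_le hm).contMDiffAt.comp p hU

variable {e : OpenPartialHomeomorph M E'}

/-- In finite dimension it suffices to test on a constant vector, where the expression is the
coframe composed with the tangent map of the inverse coordinates. -/
theorem contDiffOn_coframeCoord [FiniteDimensional ℝ E'] (he : e.IsSmoothCoordinates E) :
    ContDiffOn ℝ ∞ (coframeCoord e H) e.target := by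
  rw [contDiffOn_clm_apply]
  intro w
  rw [← contMDiffOn_iff_contDiffOn]
  have h1 := ContMDiffOn.contMDiffOn_tangentMapWithin (m := ∞) he.contMDiffOn_symm (by simp)
    e.open_target.uniqueMDiffOn
  intro y hy
  have hy' : ∀ z ∈ e.target, (⟨z, w⟩ : TangentBundle 𝓘(ℝ, E') E') ∈
    (TotalSpace.proj ⁻¹' e.target : Set (TangentBundle 𝓘(ℝ, E') E')) := fun z hz => hz
  have h2 : ContMDiffWithinAt 𝓘(ℝ, E') 𝓘(ℝ, E').tangent ∞
      (fun z : E' => (⟨z, w⟩ : TangentBundle 𝓘(ℝ, E') E')) e.target y :=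
    (contMDiffAt_vectorSpace_iff_contDiffAt.2 contDiffAt_const).contMDiffWithinAt
  have h3 := hH.contMDiff.contMDiffAt.comp_contMDiffWithinAt y ((h1 _ (hy' y hy)).comp y h2 hy')
  refine h3.congr (fun z hz => ?_) ?_
  · change _ = H (e.symm z) (mfderivWithin 𝓘(ℝ, E') 𝓘(ℝ, E) e.symm e.target z w)
    rw [mfderivWithin_of_isOpen e.open_target hz]
    rfl
  · change _ = H (e.symm y) (mfderivWithin 𝓘(ℝ, E') 𝓘(ℝ, E) e.symm e.target y w)
    rw [mfderivWithin_of_isOpen e.open_target hy]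
    rfl

theorem coframeCoord_frameCoord (he : e.IsSmoothCoordinates E) {y : E'} (hy : y ∈ e.target) (v : V) :
    coframeCoord e H y (frameCoord e H y v) = v := by
  have h := he.mfderiv_symm_apply (e.map_target hy) ((H (e.symm y)).inverse v)
  rw [e.right_inv hy] at h
  exact (congrArg (H (e.symm y)) h).trans (hH.apply_frameField (fun _ => v) _)

theorem frameCoord_coframeCoord (he : e.IsSmoothCoordinates E) {y : E'} (hy : y ∈ e.target) (w : E') :
    frameCoord e H y (coframeCoord e H y w) = w :=
  (congrArg (mfderiv 𝓘(ℝ, E) 𝓘(ℝ, E') e (e.symm y)) (hH.inverse_apply _)).trans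
    (he.mfderiv_apply_symm hy w)

/-- The frame is the pointwise inverse of the smooth coframe, and operator inversion is smooth. -/
theorem contDiffOn_frameCoord [FiniteDimensional ℝ E'] (he : e.IsSmoothCoordinates E) :
    ContDiffOn ℝ ∞ (frameCoord e H) e.target := by
  have := FiniteDimensional.complete ℝ E'
  intro y hy
  let c : E' ≃L[ℝ] V := ContinuousLinearEquiv.equivOfInverse (coframeCoord e H y)
    (frameCoord e H y) (hH.frameCoord_coframeCoord he hy) (hH.coframeCoord_frameCoord he hy)
  have h := ContDiffAt.comp_contDiffWithinAt y (contDiffAt_map_inverse (𝕜 := ℝ) (n := ∞) c)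
    (hH.contDiffOn_coframeCoord he y hy)
  have h1 : ∀ z ∈ e.target, frameCoord e H z =
      (ContinuousLinearMap.inverse ∘ coframeCoord e H) z := fun z hz =>
    (ContinuousLinearMap.inverse_eq (f := coframeCoord e H z) (g := frameCoord e H z)
      (ContinuousLinearMap.ext fun v => hH.coframeCoord_frameCoord he hz v)
      (ContinuousLinearMap.ext fun v => hH.frameCoord_coframeCoord he hz v)).symm
  exact h.congr h1 (h1 y hy)

omit hH in
theorem pushforward_frameField (a : M → V) (y : E') :
    e.pushforward (frameField H a) y = frameCoord e H y (a (e.symm y)) :=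
  rfl

/-- A vector field with smooth components is smooth. -/
theorem contMDiffAt_frameField [FiniteDimensional ℝ E] {m : ℕ∞ω} (hm : m ≤ ∞) {a : M → V} {p : M}
    (ha : ContMDiffAt 𝓘(ℝ, E) 𝓘(ℝ, V) m a p) :
    ContMDiffAt 𝓘(ℝ, E) 𝓘(ℝ, E).tangent m
      (fun q => (⟨q, frameField H a q⟩ : TangentBundle 𝓘(ℝ, E) M)) p := by
  refine (contMDiffAt_section p).2 ?_
  have hp := mem_chart_source E p
  have he : (chartAt E p).IsSmoothCoordinates E :=
    OpenPartialHomeomorph.isSmoothCoordinates_chartAt p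
  have h1 : ContMDiffAt 𝓘(ℝ, E) 𝓘(ℝ, V →L[ℝ] E) m
      (fun q => frameCoord (chartAt E p) H (chartAt E p q)) p :=
    ContMDiffAt.comp p ((hH.contDiffOn_frameCoord he).contDiffAt
      ((chartAt E p).open_target.mem_nhds ((chartAt E p).map_source hp))).contMDiffAt
      (he.contMDiffAt hp) |>.of_le hm
  refine (h1.clm_apply ha).congr_of_eventuallyEq ?_
  filter_upwards [(chartAt E p).open_source.mem_nhds hp] with q hq
  have h2 := TangentBundle.continuousLinearMapAt_trivializationAt (𝕜 := ℝ) (I := 𝓘(ℝ, E))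
    (x₀ := p) hq
  have h3 : q ∈ (trivializationAt E (TangentSpace 𝓘(ℝ, E) : M → Type _) p).baseSet := by
    simpa using hq
  have h4 := Trivialization.coe_linearMapAt_of_mem (R := ℝ)
    (trivializationAt E (TangentSpace 𝓘(ℝ, E) : M → Type _) p) h3
  have h5 : (trivializationAt E (TangentSpace 𝓘(ℝ, E) : M → Type _) p
      ⟨q, frameField H a q⟩).2 = mfderiv 𝓘(ℝ, E) 𝓘(ℝ, E) (chartAt E p) q (frameField H a q) :=
    (congrFun h4 _).symm.trans (congrArg (fun A => A (frameField H a q)) h2)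
  refine h5.trans (((chartAt E p).pushforward_apply hq).symm.trans ?_)
  rw [pushforward_frameField, (chartAt E p).left_inv hq]

end IsCoframe

end Coframe

/-! ### Brackets, symmetries and forms expressed in a coframe. -/

section Coframe

theorem ContMDiff.mvfderiv_apply {E HM : Type*} [NormedAddCommGroup E] [NormedSpace ℝ E]
    [TopologicalSpace HM] {I : ModelWithCorners ℝ E HM} {M : Type*} [TopologicalSpace M]
    [ChartedSpace HM M] [IsManifold I ∞ M] {F : Type*} [NormedAddCommGroup F] [NormedSpace ℝ F]
    {f : M → F} {U : Π p : M, TangentSpace I p} (hf : ContMDiff I 𝓘(ℝ, F) ∞ f)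
    (hU : ContMDiff I I.tangent ∞ (fun q => (⟨q, U q⟩ : TangentBundle I M))) :
    ContMDiff I 𝓘(ℝ, F) ∞ (fun q => mvfderiv I f q (U q)) :=
  (contMDiff_snd_tangentBundle_modelSpace F 𝓘(ℝ, F)).comp
    ((hf.contMDiff_tangentMap (m := ∞) (by simp)).comp hU)

variable {E E' V : Type*} [NormedAddCommGroup E] [NormedSpace ℝ E]
  [NormedAddCommGroup E'] [NormedSpace ℝ E'] [NormedAddCommGroup V] [NormedSpace ℝ V]
  {M : Type*} [TopologicalSpace M] [ChartedSpace E M] [IsManifold 𝓘(ℝ, E) ∞ M]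

/-- The components of the Lie bracket of the vector fields with components `a` and `b`. -/
noncomputable def coframeBracket (H : Π p : M, TangentSpace 𝓘(ℝ, E) p →L[ℝ] V) (a b : M → V) (p : M) :
    V :=
  H p (VectorField.mlieBracket 𝓘(ℝ, E) (frameField H a) (frameField H b) p)

namespace IsCoframe

variable {H : Π p : M, TangentSpace 𝓘(ℝ, E) p →L[ℝ] V} (hH : IsCoframe H)
include hH

theorem contMDiff_frameField [FiniteDimensional ℝ E] {a : M → V} (ha : ContMDiff 𝓘(ℝ, E) 𝓘(ℝ, V) ∞ a) :
    ContMDiff 𝓘(ℝ, E) 𝓘(ℝ, E).tangent ∞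
      (fun q => (⟨q, frameField H a q⟩ : TangentBundle 𝓘(ℝ, E) M)) :=
  fun p => hH.contMDiffAt_frameField le_rfl (ha p)

theorem frameField_coframeBracket (a b : M → V) (p : M) :
    frameField H (coframeBracket H a b) p =
      VectorField.mlieBracket 𝓘(ℝ, E) (frameField H a) (frameField H b) p :=
  hH.inverse_apply _

theorem contMDiff_coframeBracket [FiniteDimensional ℝ E] {a b : M → V}
    (ha : ContMDiff 𝓘(ℝ, E) 𝓘(ℝ, V) ∞ a) (hb : ContMDiff 𝓘(ℝ, E) 𝓘(ℝ, V) ∞ b) :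
    ContMDiff 𝓘(ℝ, E) 𝓘(ℝ, V) ∞ (coframeBracket H a b) := by
  have hle : minSmoothness ℝ 2 ≤ (∞ : ℕ∞ω) := by
    rw [minSmoothness_of_isRCLikeNormedField]
    exact WithTop.coe_le_coe.2 (le_top : (2 : ℕ∞) ≤ ⊤)
  have : IsManifold 𝓘(ℝ, E) (minSmoothness ℝ 2) M := IsManifold.of_le (n := ∞) hle
  have : IsManifold 𝓘(ℝ, E) (((⊤ : ℕ∞) : ℕ∞ω) + 1) M := inferInstanceAs (IsManifold 𝓘(ℝ, E) ∞ M)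
  have := FiniteDimensional.complete ℝ E
  intro p
  refine hH.contMDiffAt_apply le_rfl ?_
  exact ContMDiffAt.mlieBracket_vectorField (n := ⊤) (m := ⊤) (hH.contMDiff_frameField ha p)
    (hH.contMDiff_frameField hb p) (by simp)

section Map

variable {Φ : M → M} {p : M}

theorem isInvertible_mfderiv_of_map
    (h : ∀ ξ, H (Φ p) (mfderiv 𝓘(ℝ, E) 𝓘(ℝ, E) Φ p ξ) = H p ξ) :
    (mfderiv 𝓘(ℝ, E) 𝓘(ℝ, E) Φ p).IsInvertible := by
  have h1 : mfderiv 𝓘(ℝ, E) 𝓘(ℝ, E) Φ p = (H (Φ p)).inverse.comp (H p) := by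
    ext ξ
    exact hH.eq_of_apply_eq ((h ξ).trans (hH.apply_frameField (fun _ => H p ξ) (Φ p)).symm)
  rw [h1]
  obtain ⟨A, hA⟩ := hH.isInvertible p
  obtain ⟨B, hB⟩ := hH.isInvertible (Φ p)
  refine ⟨A.trans B.symm, ?_⟩
  rw [← hA, ← hB, ContinuousLinearMap.inverse_equiv]
  rfl

/-- A symmetry carries a field with invariant components to itself, because the coframe determines a
vector by its components. The same principle drives the pullback and derivative variants that
follow. -/
theorem mfderiv_frameField_of_map
    (h : ∀ ξ, H (Φ p) (mfderiv 𝓘(ℝ, E) 𝓘(ℝ, E) Φ p ξ) = H p ξ) {a : M → V} (ha : a (Φ p) = a p) :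
    mfderiv 𝓘(ℝ, E) 𝓘(ℝ, E) Φ p (frameField H a p) = frameField H a (Φ p) :=
  hH.eq_of_apply_eq ((h _).trans ((hH.apply_frameField a p).trans
    (ha.symm.trans (hH.apply_frameField a (Φ p)).symm)))

theorem mpullback_frameField_of_map
    (h : ∀ ξ, H (Φ p) (mfderiv 𝓘(ℝ, E) 𝓘(ℝ, E) Φ p ξ) = H p ξ) {a : M → V} (ha : a (Φ p) = a p) :
    VectorField.mpullback 𝓘(ℝ, E) 𝓘(ℝ, E) Φ (frameField H a) p = frameField H a p :=
  ((hH.isInvertible_mfderiv_of_map h).inverse_apply_eq).2 (hH.mfderiv_frameField_of_map h ha).symm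

theorem mvfderiv_frameField_of_map {F : Type*} [NormedAddCommGroup F] [NormedSpace ℝ F]
    (hΦ : MDifferentiableAt 𝓘(ℝ, E) 𝓘(ℝ, E) Φ p)
    (h : ∀ ξ, H (Φ p) (mfderiv 𝓘(ℝ, E) 𝓘(ℝ, E) Φ p ξ) = H p ξ) {a : M → V} (ha : a (Φ p) = a p)
    {f : M → F} (hf : MDifferentiableAt 𝓘(ℝ, E) 𝓘(ℝ, F) f (Φ p)) (hfΦ : f ∘ Φ =ᶠ[𝓝 p] f) :
    mvfderiv 𝓘(ℝ, E) f (Φ p) (frameField H a (Φ p)) = mvfderiv 𝓘(ℝ, E) f p (frameField H a p) := by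
  have h1 := mfderiv_comp_apply p hf hΦ (frameField H a p)
  rw [hH.mfderiv_frameField_of_map h ha] at h1
  refine h1.symm.trans ?_
  have h2 : ∀ g : M → F, g =ᶠ[𝓝 p] f → (mfderiv 𝓘(ℝ, E) 𝓘(ℝ, F) g p (frameField H a p) : F) =
      mvfderiv 𝓘(ℝ, E) f p (frameField H a p) := by
    intro g hg
    rw [hg.mfderiv_eq]
    rfl
  exact h2 _ hfΦ

/-- The two fields are their own pullbacks near `p`, and brackets commute with pullback. For
constant components this says that the structure functions of the coframe are invariants. -/
theorem coframeBracket_of_map [FiniteDimensional ℝ E] (hΦ : ContMDiffAt 𝓘(ℝ, E) 𝓘(ℝ, E) ∞ Φ p)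
    (h : ∀ᶠ q in 𝓝 p, ∀ ξ, H (Φ q) (mfderiv 𝓘(ℝ, E) 𝓘(ℝ, E) Φ q ξ) = H q ξ) {a b : M → V}
    (ha : ContMDiff 𝓘(ℝ, E) 𝓘(ℝ, V) ∞ a) (hb : ContMDiff 𝓘(ℝ, E) 𝓘(ℝ, V) ∞ b)
    (haΦ : a ∘ Φ =ᶠ[𝓝 p] a) (hbΦ : b ∘ Φ =ᶠ[𝓝 p] b) :
    coframeBracket H a b (Φ p) = coframeBracket H a b p := by
  have hle : minSmoothness ℝ 2 ≤ (∞ : ℕ∞ω) := by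
    rw [minSmoothness_of_isRCLikeNormedField]
    exact WithTop.coe_le_coe.2 (le_top : (2 : ℕ∞) ≤ ⊤)
  have : IsManifold 𝓘(ℝ, E) (minSmoothness ℝ 2) M := IsManifold.of_le (n := ∞) hle
  have := FiniteDimensional.complete ℝ E
  have h1 := VectorField.mpullback_mlieBracket
    ((hH.contMDiff_frameField ha).mdifferentiable (by simp) (Φ p))
    ((hH.contMDiff_frameField hb).mdifferentiable (by simp) (Φ p)) hΦ hle
  have h2 : ∀ {c : M → V}, c ∘ Φ =ᶠ[𝓝 p] c →
      VectorField.mpullback 𝓘(ℝ, E) 𝓘(ℝ, E) Φ (frameField H c) =ᶠ[𝓝 p] frameField H c := by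
    intro c hc
    filter_upwards [h, hc] with q hq hcq using hH.mpullback_frameField_of_map hq hcq
  have h3 := h1.trans ((h2 haΦ).mlieBracket_vectorField_eq (h2 hbΦ))
  have h4 := ((hH.isInvertible_mfderiv_of_map h.self_of_nhds).inverse_apply_eq).1 h3
  exact (congrArg (H (Φ p)) h4).trans (h.self_of_nhds _)

end Map

/-- The structure equation of the coframe in coordinates. -/
theorem fderiv_frameCoord_sub [FiniteDimensional ℝ E] [FiniteDimensional ℝ E']
    {e : OpenPartialHomeomorph M E'}
    (he : e.IsSmoothCoordinates E) {y : E'} (hy : y ∈ e.target) (v w : V) :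
    fderiv ℝ (frameCoord e H) y (frameCoord e H y v) w -
      fderiv ℝ (frameCoord e H) y (frameCoord e H y w) v =
        frameCoord e H y (coframeBracket H (fun _ => v) (fun _ => w) (e.symm y)) := by
  have := FiniteDimensional.complete ℝ E
  have := FiniteDimensional.complete ℝ E'
  have hd : DifferentiableAt ℝ (frameCoord e H) y :=
    ((hH.contDiffOn_frameCoord he).contDiffAt (e.open_target.mem_nhds hy)).differentiableAt (by simp)
  have h1 := he.mfderiv_mlieBracket (e.map_target hy)
    ((hH.contMDiff_frameField (a := fun _ => v) contMDiff_const).mdifferentiable (by simp) _)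
    ((hH.contMDiff_frameField (a := fun _ => w) contMDiff_const).mdifferentiable (by simp) _)
  rw [e.right_inv hy] at h1
  have h2 : frameCoord e H y (coframeBracket H (fun _ => v) (fun _ => w) (e.symm y)) =
      VectorField.lieBracket ℝ (e.pushforward (frameField H fun _ => v))
        (e.pushforward (frameField H fun _ => w)) y :=
    (congrArg (mfderiv 𝓘(ℝ, E) 𝓘(ℝ, E') e (e.symm y)) (hH.inverse_apply _)).trans h1
  rw [h2, VectorField.lieBracket]
  have h3 : ∀ u : V, fderiv ℝ (e.pushforward (frameField H fun _ => u)) y =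
      (fderiv ℝ (frameCoord e H) y).flip u := by
    intro u
    have h4 := hd.hasFDerivAt.clm_apply (hasFDerivAt_const u y)
    refine h4.fderiv.trans ?_
    ext z
    simp
  rw [h3, h3]
  rfl

/-- The change between the coframe and a local trivialization of the tangent bundle is smooth in
both directions, so smoothness may be tested on components. This is what turns forms into
vector-valued functions. -/
theorem mem_forms_iff [FiniteDimensional ℝ E] [FiniteDimensional ℝ V] {k : ℕ}
    {Ω : Π x : M, TangentSpace 𝓘(ℝ, E) x [⋀^Fin k]→L[ℝ] ℝ} :
    Ω ∈ GStr.forms 𝓘(ℝ, E) E (TangentSpace 𝓘(ℝ, E) : M → Type _) k ↔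
      ContMDiff 𝓘(ℝ, E) 𝓘(ℝ, V [⋀^Fin k]→L[ℝ] ℝ) ∞
        (fun p => (Ω p).compContinuousLinearMap (H p).inverse) := by
  refine forall_congr' fun p => ?_
  set τ := trivializationAt E (TangentSpace 𝓘(ℝ, E) : M → Type _) p
  have hbase : ∀ᶠ q in 𝓝 p, q ∈ τ.baseSet :=
    τ.open_baseSet.mem_nhds (mem_baseSet_trivializationAt E _ p)
  constructor
  · intro h
    rw [← contMDiffWithinAt_univ, contMDiffWithinAt_continuousAlternatingMap_iff]
    intro v
    rw [contMDiffWithinAt_univ]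
    have h1 : ∀ i, ContMDiffAt 𝓘(ℝ, E) 𝓘(ℝ, E) ∞
        (fun q => (τ ⟨q, frameField H (fun _ => v i) q⟩).2) p := fun i =>
      (contMDiffAt_section p).1 (hH.contMDiffAt_frameField le_rfl contMDiffAt_const)
    refine ContMDiffAt.congr_of_eventuallyEq (contMDiffWithinAt_univ.1
      ((contMDiffWithinAt_univ.2 h).continuousAlternatingMap_apply
        fun i => contMDiffWithinAt_univ.2 (h1 i))) ?_
    filter_upwards [hbase] with q hq
    refine congrArg (Ω q) (funext fun i => ?_)
    have h2 := τ.symmL_continuousLinearMapAt (R := ℝ) hq (frameField H (fun _ => v i) q)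
    have h3 := congrFun (τ.coe_linearMapAt_of_mem (R := ℝ) hq) (frameField H (fun _ => v i) q)
    exact h2.symm.trans (congrArg (τ.symmL ℝ q) h3)
  · intro h
    rw [← contMDiffWithinAt_univ, contMDiffWithinAt_continuousAlternatingMap_iff]
    intro v
    rw [contMDiffWithinAt_univ]
    have h1 : ∀ i, ContMDiffAt 𝓘(ℝ, E) 𝓘(ℝ, V) ∞ (fun q => H q (τ.symmL ℝ q (v i))) p := by
      intro i
      refine hH.contMDiffAt_apply le_rfl ((contMDiffAt_section p).2 ?_)
      refine (contMDiffAt_const (c := v i)).congr_of_eventuallyEq ?_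
      filter_upwards [hbase] with q hq
      have h2 := τ.continuousLinearMapAt_symmL (R := ℝ) hq (v i)
      have h3 := congrFun (τ.coe_linearMapAt_of_mem (R := ℝ) hq) (τ.symmL ℝ q (v i))
      exact h3.symm.trans h2
    refine ContMDiffAt.congr_of_eventuallyEq (contMDiffWithinAt_univ.1
      ((contMDiffWithinAt_univ.2 h).continuousAlternatingMap_apply
        fun i => contMDiffWithinAt_univ.2 (h1 i))) ?_
    filter_upwards [hbase] with q hq
    exact congrArg (Ω q) (funext fun i => (hH.inverse_apply _).symm)

end IsCoframe

end Coframe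

/-- An immersion is locally injective. -/
theorem ContMDiffAt.exists_injOn_of_injective_mfderiv {E HM : Type*} [NormedAddCommGroup E]
    [NormedSpace ℝ E] [FiniteDimensional ℝ E] [TopologicalSpace HM] {I : ModelWithCorners ℝ E HM}
    [I.Boundaryless] {M : Type*} [TopologicalSpace M] [ChartedSpace HM M]
    {E' HM' : Type*} [NormedAddCommGroup E']
    [NormedSpace ℝ E'] [FiniteDimensional ℝ E'] [TopologicalSpace HM'] {I' : ModelWithCorners ℝ E' HM'}
    {M' : Type*} [TopologicalSpace M'] [ChartedSpace HM' M']
    {f : M → M'} {x : M} (hf : ContMDiffAt I I' 1 f x)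
    (h : Injective (mfderiv I I' f x)) : ∃ U ∈ 𝓝 x, InjOn f U := by
  have := FiniteDimensional.complete ℝ E
  have := FiniteDimensional.complete ℝ E'
  set F := writtenInExtChartAt I I' x f
  have h1 : ContDiffAt ℝ 1 F (extChartAt I x x) := by
    have := (contMDiffAt_iff.1 hf).2
    rwa [I.range_eq_univ, contDiffWithinAt_univ] at this
  have h2 : mfderiv I I' f x = fderiv ℝ F (extChartAt I x x) := by
    rw [(hf.mdifferentiableAt (by simp)).mfderiv, I.range_eq_univ, fderivWithin_univ]
  have h3 := h1.hasStrictFDerivAt (by simp)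
  -- Composing with a left inverse of the derivative gives a map with identity derivative, to which
  -- the inverse function theorem applies.
  obtain ⟨g, hg⟩ := LinearMap.exists_leftInverse_of_injective
    (fderiv ℝ F (extChartAt I x x)).toLinearMap (LinearMap.ker_eq_bot.2 (by
      have h4 := h
      rw [h2] at h4
      exact h4))
  set g' : E' →L[ℝ] E := LinearMap.toContinuousLinearMap g
  have h5 : HasStrictFDerivAt (g' ∘ F) ((ContinuousLinearEquiv.refl ℝ E : E ≃L[ℝ] E) : E →L[ℝ] E)
      (extChartAt I x x) := by
    have h6 := g'.hasStrictFDerivAt.comp (extChartAt I x x) h3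
    have h7 : ((ContinuousLinearEquiv.refl ℝ E : E ≃L[ℝ] E) : E →L[ℝ] E) =
        g'.comp (fderiv ℝ F (extChartAt I x x)) := by
      ext v
      exact (LinearMap.congr_fun hg v).symm
    rw [h7]
    exact h6
  set W := (h5.toOpenPartialHomeomorph (g' ∘ F)).source
  have hW : W ∈ 𝓝 (extChartAt I x x) :=
    (h5.toOpenPartialHomeomorph (g' ∘ F)).open_source.mem_nhds h5.mem_toOpenPartialHomeomorph_source
  have hinj : InjOn (g' ∘ F) W := (h5.toOpenPartialHomeomorph (g' ∘ F)).injOn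
  refine ⟨(extChartAt I x).source ∩ (extChartAt I x) ⁻¹' W, Filter.inter_mem
    (extChartAt_source_mem_nhds x) ((continuousAt_extChartAt x).preimage_mem_nhds hW), ?_⟩
  intro a ha b hb hab
  refine (extChartAt I x).injOn ha.1 hb.1 (hinj ha.2 hb.2 ?_)
  simp only [F, writtenInExtChartAt, comp_apply, (extChartAt I x).left_inv ha.1,
    (extChartAt I x).left_inv hb.1, hab]

/-! ### The coframe of a G-structure with connection. -/

namespace GStr

namespace GStructureWithConnection

variable {n r : ℕ} {G : Type*} [Group G] [TopologicalSpace G] [ChartedSpace (Eu r) G]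
  {ι : G →* (Eu n →L[ℝ] Eu n)ˣ}
  {P : Type*} [TopologicalSpace P] [ChartedSpace (Eu (n + r)) P] [IsManifold (𝓡 (n + r)) ∞ P]
  [MulAction Gᵐᵒᵖ P] (S : GStructureWithConnection r ι P)

/-- The coframe `(θ, ω)` with values in the fixed vector space `ℝⁿ ⊕ 𝔤`. -/
noncomputable def coframe (p : P) : TangentSpace (𝓡 (n + r)) p →L[ℝ] Fib n r :=
  (S.θ p).prod (S.conn p)

omit [TopologicalSpace P] [TopologicalSpace G] [ChartedSpace (Eu r) G]
  [ChartedSpace (Eu (n + r)) P] [IsManifold (𝓡 (n + r)) ∞ P] in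
theorem act_act (p : P) (g k : G) : (p <• g) <• k = p <• (g * k) := by
  rw [MulOpposite.op_mul, mul_smul]

omit [TopologicalSpace P] [TopologicalSpace G] [ChartedSpace (Eu r) G]
  [ChartedSpace (Eu (n + r)) P] [IsManifold (𝓡 (n + r)) ∞ P] in
theorem act_one (p : P) : p <• (1 : G) = p := by
  rw [MulOpposite.op_one, one_smul]

theorem coframe_congr {p q : P} (h : p = q) (v : Eu (n + r)) :
    S.coframe p v = S.coframe q v := by
  subst h
  rfl

theorem coframe_generator (p : P) (α : LieAlg r) :
    S.coframe (p <• (1 : G)) (mfderiv (𝓡 r) (𝓡 (n + r)) (fun g : G => p <• g) 1 α) = (0, α) :=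
  Prod.ext (S.θ_horizontal p α) (S.conn_vertical p α)

/-- A preimage under θ is corrected by a vertical vector to have any prescribed ω-value; since the
dimensions agree, surjectivity gives invertibility. -/
theorem isCoframe : IsCoframe (M := P) S.coframe where
  contMDiff := S.contMDiff_θ.prodMk_space S.contMDiff_conn
  isInvertible p := by
    have hs : Surjective (S.coframe p) := by
      rintro ⟨x, α⟩
      obtain ⟨ξ, hξ⟩ := S.θ_surjective p x
      have h1 := (S.coframe_congr (act_one (G := G) p) _).symm.trans
        (S.coframe_generator p (α - S.conn p ξ))
      let η : TangentSpace (𝓡 (n + r)) p :=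
        mfderiv (𝓡 r) (𝓡 (n + r)) (fun g : G => p <• g) 1 (α - S.conn p ξ)
      refine ⟨ξ + η, ?_⟩
      refine (map_add (S.coframe p) _ _).trans ((congrArg (S.coframe p ξ + ·) h1).trans ?_)
      refine Prod.ext ?_ ?_
      · simpa [coframe] using hξ
      · simp [coframe]
    have hs' : Surjective (show Eu (n + r) →L[ℝ] Fib n r from S.coframe p) := hs
    let A : Eu (n + r) →ₗ[ℝ] Fib n r := (show Eu (n + r) →L[ℝ] Fib n r from S.coframe p).toLinearMap
    have hd : Module.finrank ℝ (Eu (n + r)) = Module.finrank ℝ (Fib n r) := by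
      simp [Module.finrank_prod]
    let A' := LinearEquiv.ofBijective A
      ⟨(LinearMap.injective_iff_surjective_of_finrank_eq_finrank hd).2 hs', hs'⟩
    exact ⟨A'.toContinuousLinearEquiv, by ext ξ <;> rfl⟩

variable [LieGroup (𝓡 r) ∞ G]

include S in
omit [LieGroup (𝓡 r) ∞ G] in
theorem contMDiff_act_left (g : G) :
    ContMDiff (𝓡 (n + r)) (𝓡 (n + r)) ∞ (fun p : P => p <• g) :=
  S.contMDiff_action.comp (contMDiff_id.prodMk contMDiff_const)

include S in
omit [LieGroup (𝓡 r) ∞ G] in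
theorem contMDiff_act_right (p : P) :
    ContMDiff (𝓡 r) (𝓡 (n + r)) ∞ (fun g : G => p <• g) :=
  S.contMDiff_action.comp (contMDiff_const.prodMk contMDiff_id)

/-- The velocity of the orbit map is vertical, with the left Maurer-Cartan form as its component. -/
theorem coframe_mfderiv_orbit (p : P) (g : G) (α : TangentSpace (𝓡 r) g) :
    S.coframe (p <• g) (mfderiv (𝓡 r) (𝓡 (n + r)) (fun k : G => p <• k) g α) =
      (0, (mfderiv (𝓡 r) (𝓡 r) (fun k : G => g⁻¹ * k) g α : Eu r)) := by
  have h1 : (fun k : G => p <• k) = (fun k : G => (p <• g) <• k) ∘ (fun k : G => g⁻¹ * k) := by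
    funext k
    simp only [comp_apply]
    rw [act_act, mul_inv_cancel_left]
  have hL : ContMDiff (𝓡 r) (𝓡 r) ∞ (fun k : G => g⁻¹ * k) := contMDiff_mul_left
  have h2 := mfderiv_comp_apply g ((S.contMDiff_act_right (p <• g)).mdifferentiable (by simp) _)
    (hL.mdifferentiable (by simp) g) α
  have h3 : ∀ k : G, k = 1 → ∀ β : Eu r, S.coframe ((p <• g) <• k)
      (mfderiv (𝓡 r) (𝓡 (n + r)) (fun k : G => (p <• g) <• k) k β) = (0, β) := by
    rintro _ rfl β
    exact S.coframe_generator (p <• g) β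
  have h4 : ∀ f : G → P, f = (fun k : G => (p <• g) <• k) ∘ (fun k : G => g⁻¹ * k) →
      (mfderiv (𝓡 r) (𝓡 (n + r)) f g α : Eu (n + r)) = mfderiv (𝓡 r) (𝓡 (n + r))
        ((fun k : G => (p <• g) <• k) ∘ (fun k : G => g⁻¹ * k)) g α := by rintro _ rfl; rfl
  refine (congrArg (S.coframe (p <• g)) ((h4 _ h1).trans h2)).trans ?_
  refine (S.coframe_congr ?_ _).trans (h3 (g⁻¹ * g) (inv_mul_cancel g) _)
  rw [inv_mul_cancel, act_one]

-- At a general `g` the ω-component of the velocity is the translate of `α` to the identity by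
-- `g⁻¹`, and translation is invertible.
include S in
theorem injective_mfderiv_orbit (p : P) (g : G) :
    Injective (mfderiv (𝓡 r) (𝓡 (n + r)) (fun k : G => p <• k) g) := by
  intro α β h
  have h1 := ((S.coframe_mfderiv_orbit p g α).symm.trans (congrArg (S.coframe (p <• g)) h)).trans
    (S.coframe_mfderiv_orbit p g β)
  have h2 := congrArg Prod.snd h1
  have hL : ContMDiff (𝓡 r) (𝓡 r) ∞ (fun k : G => g⁻¹ * k) := contMDiff_mul_left
  have hL' : ContMDiff (𝓡 r) (𝓡 r) ∞ (fun k : G => g * k) := contMDiff_mul_left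
  have h3 : ∀ γ : TangentSpace (𝓡 r) g, (mfderiv (𝓡 r) (𝓡 r) (fun k : G => g * k) (g⁻¹ * g)
      (mfderiv (𝓡 r) (𝓡 r) (fun k : G => g⁻¹ * k) g γ) : Eu r) = γ := by
    intro γ
    have h4 := mfderiv_comp_apply g (hL'.mdifferentiable (by simp) (g⁻¹ * g))
      (hL.mdifferentiable (by simp) g) γ
    have h5 : (fun k : G => g * k) ∘ (fun k : G => g⁻¹ * k) = id := by
      funext k
      simp
    have h6 : ∀ f : G → G, f = id → (mfderiv (𝓡 r) (𝓡 r) f g γ : Eu r) = γ := by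
      rintro _ rfl
      rw [mfderiv_id]
      rfl
    exact h4.symm.trans (h6 _ h5)
  exact (h3 α).symm.trans ((congrArg (mfderiv (𝓡 r) (𝓡 r) (fun k : G => g * k) (g⁻¹ * g)) h2).trans
    (h3 β))

/-- The coframe transforms linearly under the group. -/
theorem coframe_equivariant (g : G) (p : P) (ξ : TangentSpace (𝓡 (n + r)) p) :
    S.coframe (p <• g) (mfderiv (𝓡 (n + r)) (𝓡 (n + r)) (fun q : P => q <• g) p ξ) =
      Prod.map (ι g⁻¹ : Eu n →L[ℝ] Eu n) (Ad g⁻¹ : LieAlg r →L[ℝ] LieAlg r) (S.coframe p ξ) :=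
  Prod.ext (S.θ_equivariant g p ξ) (S.conn_equivariant g p ξ)

end GStructureWithConnection

end GStr

/-! ### Stabilizers and the set of points with trivial stabilizer. -/

namespace GStr

/-- The points with trivial stabilizer. -/
def freePoints (G P : Type*) [Group G] [MulAction Gᵐᵒᵖ P] : Set P :=
  {p | ∀ g : G, p <• g = p → g = 1}

namespace GStructureWithConnection

variable {n r : ℕ} {G : Type*} [Group G] [TopologicalSpace G] [ChartedSpace (Eu r) G]
  {ι : G →* (Eu n →L[ℝ] Eu n)ˣ}
  {P : Type*} [TopologicalSpace P] [ChartedSpace (Eu (n + r)) P] [IsManifold (𝓡 (n + r)) ∞ P]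
  [MulAction Gᵐᵒᵖ P] (S : GStructureWithConnection r ι P)

include S

/-- The set is the image of a closed set under the proper, hence closed, map (g, y) ↦ (y·g, y). With
`C` the complement of a neighbourhood, this is how properness excludes unwanted group elements
throughout. -/
theorem isClosed_setOf_act_eq {C : Set G} (hC : IsClosed C) :
    IsClosed {x : P × P | ∃ g ∈ C, x.2 <• g = x.1} := by
  have h1 : IsClosed (((MulOpposite.unop : Gᵐᵒᵖ → G) ⁻¹' C) ×ˢ (univ : Set P)) :=
    (hC.preimage MulOpposite.continuous_unop).prod isClosed_univ
  have h2 := S.proper.isProperMap_smul_pair.isClosedMap _ h1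
  convert h2 using 1
  ext ⟨x, y⟩
  constructor
  · rintro ⟨g, hg, h⟩
    exact ⟨(MulOpposite.op g, y), ⟨hg, mem_univ _⟩, Prod.ext h rfl⟩
  · rintro ⟨⟨g, z⟩, ⟨hg, -⟩, h⟩
    rw [Prod.mk.injEq] at h
    obtain ⟨h3, rfl⟩ := h
    exact ⟨g.unop, hg, h3⟩

theorem continuous_act : Continuous (fun x : P × G => x.1 <• x.2) :=
  S.contMDiff_action.continuous

theorem isCompact_stabilizer [T2Space P] (p : P) : IsCompact {g : G | p <• g = p} := by
  have h1 := S.proper.isProperMap_smul_pair.isCompact_preimage (isCompact_singleton (x := (p, p)))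
  have h2 := h1.image (MulOpposite.continuous_unop.comp continuous_fst)
  convert h2 using 1
  ext g
  constructor
  · exact fun h => ⟨(MulOpposite.op g, p), Prod.ext h rfl, rfl⟩
  · rintro ⟨⟨k, z⟩, h, rfl⟩
    have h3 : ((k • z, z) : P × P) = (p, p) := h
    rw [Prod.mk.injEq] at h3
    obtain ⟨h4, rfl⟩ := h3
    exact h4

variable [LieGroup (𝓡 r) ∞ G]

/-- The action of the elements close to `1` is free, locally uniformly on `P`. -/
theorem eventually_eq_one_of_act_eq (p : P) :
    ∀ᶠ x in 𝓝 (p, (1 : G)), x.1 <• x.2 = x.1 → x.2 = 1 := by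
  have hsm : ContMDiff ((𝓡 (n + r)).prod (𝓡 r)) ((𝓡 (n + r)).prod (𝓡 (n + r))) ∞
    (fun x : P × G => (x.1, x.1 <• x.2)) := contMDiff_fst.prodMk S.contMDiff_action
  -- The map (x, g) ↦ (x, x·g) is an immersion at (p, 1) by local freeness. It is thus injective
  -- nearby, and a fixed pair (x, g) has the same image as (x, 1).
  have hinj : Injective (mfderiv ((𝓡 (n + r)).prod (𝓡 r)) ((𝓡 (n + r)).prod (𝓡 (n + r)))
      (fun x : P × G => (x.1, x.1 <• x.2)) (p, (1 : G))) := by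
    rw [mfderiv_prodMk mdifferentiableAt_fst (S.contMDiff_action.mdifferentiable (by simp) _)]
    refine (injective_iff_map_eq_zero _).2 ?_
    rintro ⟨u, α⟩ h
    have h1 := congrArg Prod.fst h
    have h2 := congrArg Prod.snd h
    have h3 : u = 0 := by
      have h4 : (mfderiv ((𝓡 (n + r)).prod (𝓡 r)) (𝓡 (n + r)) (Prod.fst : P × G → P) (p, 1)) (u, α)
        = 0 := h1
      rw [mfderiv_fst] at h4
      exact h4
    subst h3
    have h5 : (mfderiv ((𝓡 (n + r)).prod (𝓡 r)) (𝓡 (n + r)) (fun x : P × G => x.1 <• x.2) (p, 1))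
        (0, α) = 0 := h2
    have h6 := mfderiv_comp_apply (1 : G)
      (S.contMDiff_action.mdifferentiable (by simp) (p, (1 : G)))
      (mdifferentiableAt_const.prodMk mdifferentiableAt_id :
        MDifferentiableAt (𝓡 r) ((𝓡 (n + r)).prod (𝓡 r)) (fun g : G => (p, g)) 1) α
    have h7 : (mfderiv (𝓡 r) ((𝓡 (n + r)).prod (𝓡 r)) (fun g : G => (p, g)) 1 α :
        Eu (n + r) × Eu r) = (0, α) := by
      have hc : MDifferentiableAt (𝓡 r) (𝓡 (n + r)) (fun _ : G => p) 1 := mdifferentiableAt_const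
      have hi : MDifferentiableAt (𝓡 r) (𝓡 r) (id : G → G) 1 := mdifferentiableAt_id
      refine (congrArg (fun A => A α) (mfderiv_prodMk hc hi)).trans ?_
      refine Prod.ext ?_ ?_
      · exact congrArg (fun A => A α) (mfderiv_const (I := 𝓡 r) (I' := 𝓡 (n + r)) (c := p)
          (x := (1 : G)))
      · exact congrArg (fun A => A α) (mfderiv_id (I := 𝓡 r) (x := (1 : G)))
    have h8 : (mfderiv (𝓡 r) (𝓡 (n + r)) (fun g : G => p <• g) 1) α = 0 :=
      h6.trans ((congrArg (mfderiv ((𝓡 (n + r)).prod (𝓡 r)) (𝓡 (n + r))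
        (fun x : P × G => x.1 <• x.2) (p, 1)) h7).trans h5)
    have h9 : α = 0 := S.locallyFree p (h8.trans (map_zero _).symm)
    rw [h9]
    rfl
  obtain ⟨U, hU, hUinj⟩ := ContMDiffAt.exists_injOn_of_injective_mfderiv
    ((hsm (p, (1 : G))).of_le (by simp)) hinj
  have h1 : ∀ᶠ x in 𝓝 (p, (1 : G)), (x.1, (1 : G)) ∈ U := by
    have : Continuous (fun x : P × G => (x.1, (1 : G))) := by fun_prop
    exact this.continuousAt.preimage_mem_nhds hU
  filter_upwards [hU, h1] with x hx hx1 h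
  have h2 := hUinj hx hx1 (Prod.ext rfl (h.trans (act_one (G := G) x.1).symm))
  exact congrArg Prod.snd h2

/-- Near a point with trivial stabilizer, elements close to 1 act freely by local freeness, and the
points fixed by some element away from 1 form a closed set missing `p`. -/
theorem isOpen_freePoints : IsOpen (freePoints G P) := by
  rw [isOpen_iff_mem_nhds]
  intro p hp
  obtain ⟨U, hU, O, hO, hUO⟩ := Filter.mem_prod_iff.1
    ((nhds_prod_eq (x := p) (y := (1 : G))) ▸ S.eventually_eq_one_of_act_eq p)
  obtain ⟨O', hO'O, hO', h1⟩ := mem_nhds_iff.1 hO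
  have hcl : IsClosed {q : P | ∃ g ∈ O'ᶜ, q <• g = q} :=
    (S.isClosed_setOf_act_eq hO'.isClosed_compl).preimage (continuous_id.prodMk continuous_id)
  have hpn : p ∉ {q : P | ∃ g ∈ O'ᶜ, q <• g = q} := by
    rintro ⟨g, hg, h⟩
    exact hg (hp g h ▸ h1)
  filter_upwards [hU, hcl.isOpen_compl.mem_nhds hpn] with q hq hq' g hg
  by_cases hgO : g ∈ O'
  · exact hUO (⟨hq, hO'O hgO⟩ : (q, g) ∈ U ×ˢ O) hg
  · exact absurd ⟨g, hgO, hg⟩ hq'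

/-- Compact by properness and discrete by local freeness, the neighbourhood of 1 being translated to
any other element. -/
theorem finite_stabilizer [T2Space P] (p : P) : {g : G | p <• g = p}.Finite := by
  have := topologicalGroup_of_lieGroup (𝓡 r) ∞ (G := G)
  refine (S.isCompact_stabilizer p).finite ?_
  refine ⟨discreteTopology_iff_isOpen_singleton.2 ?_⟩
  rintro ⟨g, hg⟩
  have h1 : ∀ᶠ k in 𝓝 (1 : G), p <• k = p → k = 1 := by
    have : Continuous (fun k : G => (p, k)) := by fun_prop
    exact this.continuousAt.eventually (S.eventually_eq_one_of_act_eq p)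
  have h2 : ∀ᶠ k in 𝓝 g, p <• (g⁻¹ * k) = p → g⁻¹ * k = 1 := by
    have h3 : Filter.Tendsto (fun k => g⁻¹ * k) (𝓝 g) (𝓝 1) := by
      have : Continuous (fun k : G => g⁻¹ * k) := by fun_prop
      simpa using this.tendsto g
    exact h3.eventually h1
  have hginv : p <• g⁻¹ = p := by
    conv_lhs => rw [← (show p <• g = p from hg)]
    rw [act_act, mul_inv_cancel, act_one]
  have h4 : ({⟨g, hg⟩} : Set {g : G | p <• g = p}) ∈ 𝓝 (⟨g, hg⟩ : {g : G | p <• g = p}) := by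
    rw [nhds_subtype_eq_comap]
    refine Filter.mem_comap.2 ⟨_, h2, ?_⟩
    rintro ⟨k, hk⟩ hk'
    have h5 : g⁻¹ * k = 1 := by
      refine hk' ?_
      rw [← act_act, hginv]
      exact hk
    exact Subtype.ext (inv_mul_eq_one.1 h5).symm
  exact isOpen_singleton_iff_nhds_eq_pure _ |>.2 (le_antisymm (by simpa using h4) (pure_le_nhds _))

end GStructureWithConnection

end GStr

/-! ### Density of the points with trivial stabilizer. -/

namespace GStr

namespace GStructureWithConnection

variable {n r : ℕ} {G : Type*} [Group G] [TopologicalSpace G] [ChartedSpace (Eu r) G]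
  {ι : G →* (Eu n →L[ℝ] Eu n)ˣ}
  {P : Type*} [TopologicalSpace P] [ChartedSpace (Eu (n + r)) P] [IsManifold (𝓡 (n + r)) ∞ P]
  [MulAction Gᵐᵒᵖ P] (S : GStructureWithConnection r ι P)

variable [LieGroup (𝓡 r) ∞ G]

include S in
/-- A curve whose initial velocity is moved by `g₀ ≠ 1` leaves the fixed points of the elements
close to `g₀`. -/
theorem eventually_act_ne_of_curve {c : ℝ → P} (hc : ContMDiffAt 𝓘(ℝ, ℝ) (𝓡 (n + r)) ∞ c 0)
    {g₀ : G} (hg₀ : c 0 <• g₀ = c 0)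
    (hξ : (ι g₀⁻¹ : Eu n →L[ℝ] Eu n) (S.θ (c 0) (mfderiv 𝓘(ℝ, ℝ) (𝓡 (n + r)) c 0 (1 : ℝ))) ≠
      S.θ (c 0) (mfderiv 𝓘(ℝ, ℝ) (𝓡 (n + r)) c 0 (1 : ℝ))) :
    ∀ᶠ x in 𝓝 ((0 : ℝ), g₀), x.1 ≠ 0 → c x.1 <• x.2 ≠ c x.1 := by
  set e := chartAt (Eu (n + r)) (c 0)
  have he : e.IsSmoothCoordinates (Eu (n + r)) :=
    OpenPartialHomeomorph.isSmoothCoordinates_chartAt (c 0)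
  have hp : c 0 ∈ e.source := mem_chart_source _ _
  have hc1 : ContMDiffAt (𝓘(ℝ, ℝ).prod (𝓡 r)) (𝓡 (n + r)) ∞ (fun x : ℝ × G => c x.1) (0, g₀) :=
    ContMDiffAt.comp (0, g₀) hc contMDiffAt_fst
  have hA : ContMDiffAt (𝓘(ℝ, ℝ).prod (𝓡 r)) (𝓡 (n + r)) ∞ (fun x : ℝ × G => c x.1 <• x.2) (0, g₀) :=
    (S.contMDiff_action _).comp (0, g₀) (hc1.prodMk contMDiffAt_snd)
  have heA : ContMDiffAt (𝓘(ℝ, ℝ).prod (𝓡 r)) 𝓘(ℝ, Eu (n + r)) ∞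
      (e ∘ fun x : ℝ × G => c x.1 <• x.2) (0, g₀) :=
    ContMDiffAt.comp_of_eq (he.contMDiffAt hp) hA hg₀
  have hec : ContMDiffAt (𝓘(ℝ, ℝ).prod (𝓡 r)) 𝓘(ℝ, Eu (n + r)) ∞
      (e ∘ fun x : ℝ × G => c x.1) (0, g₀) :=
    ContMDiffAt.comp _ (he.contMDiffAt hp) hc1
  -- `f` vanishes whenever `c t` is fixed by `g`, in particular at `(0, g₀)`. Once `f` is an
  -- immersion there, local injectivity leaves no other zeros nearby.
  set f : ℝ × G → Eu (n + r) :=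
    (e ∘ fun x : ℝ × G => c x.1 <• x.2) - (e ∘ fun x : ℝ × G => c x.1) with hf
  have hfs : ContMDiffAt (𝓘(ℝ, ℝ).prod (𝓡 r)) 𝓘(ℝ, Eu (n + r)) ∞ f (0, g₀) := heA.sub hec
  have hinj : Injective (mfderiv (𝓘(ℝ, ℝ).prod (𝓡 r)) 𝓘(ℝ, Eu (n + r)) f (0, g₀)) := by
    refine (injective_iff_map_eq_zero _).2 ?_
    rintro ⟨τ, β⟩ h
    have h1 := ((heA.mdifferentiableAt (by simp)).hasMFDerivAt.sub
      (hec.mdifferentiableAt (by simp)).hasMFDerivAt).mfderiv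
    have h2 : (mfderiv (𝓘(ℝ, ℝ).prod (𝓡 r)) 𝓘(ℝ, Eu (n + r))
        (e ∘ fun x : ℝ × G => c x.1 <• x.2) (0, g₀) (τ, β) : Eu (n + r)) =
        mfderiv (𝓘(ℝ, ℝ).prod (𝓡 r)) 𝓘(ℝ, Eu (n + r)) (e ∘ fun x : ℝ × G => c x.1) (0, g₀) (τ, β) :=
      sub_eq_zero.1 ((congrArg (fun A => A (τ, β)) h1).symm.trans h)
    have h3 := mfderiv_comp_apply (0, g₀) (he.mdifferentiableAt (show c 0 <• g₀ ∈ e.source by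
      rwa [hg₀])) (hA.mdifferentiableAt (by simp)) (τ, β)
    have h4 := mfderiv_comp_apply (0, g₀) (he.mdifferentiableAt hp)
      (hc1.mdifferentiableAt (by simp)) (τ, β)
    have h5 : (mfderiv (𝓘(ℝ, ℝ).prod (𝓡 r)) (𝓡 (n + r))
        (fun x : ℝ × G => c x.1 <• x.2) (0, g₀) (τ, β) : Eu (n + r)) =
        mfderiv (𝓘(ℝ, ℝ).prod (𝓡 r)) (𝓡 (n + r)) (fun x : ℝ × G => c x.1) (0, g₀) (τ, β) := by
      have h6 := (h3.symm.trans h2).trans h4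
      have h7 := congrArg (fun B : Eu (n + r) →L[ℝ] Eu (n + r) => B
        (mfderiv (𝓘(ℝ, ℝ).prod (𝓡 r)) (𝓡 (n + r))
        (fun x : ℝ × G => c x.1 <• x.2) (0, g₀) (τ, β)))
        (mfderiv_congr_point (I := 𝓡 (n + r)) (I' := 𝓘(ℝ, Eu (n + r))) (f := e) hg₀)
      have h8 := h7.symm.trans h6
      exact (he.mfderiv_symm_apply hp _).symm.trans ((congrArg (mfderiv 𝓘(ℝ, Eu (n + r)) (𝓡 (n + r))
        e.symm (e (c 0))) h8).trans (he.mfderiv_symm_apply hp _))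
    have hcd : MDifferentiableAt 𝓘(ℝ, ℝ) (𝓡 (n + r)) c 0 := hc.mdifferentiableAt (by simp)
    have h6 : (mfderiv (𝓘(ℝ, ℝ).prod (𝓡 r)) (𝓡 (n + r)) (fun x : ℝ × G => c x.1) (0, g₀) (τ, β) :
        Eu (n + r)) = mfderiv 𝓘(ℝ, ℝ) (𝓡 (n + r)) c 0 τ := by
      have := mfderiv_comp_apply ((0 : ℝ), g₀) (I := 𝓘(ℝ, ℝ).prod (𝓡 r)) (f := Prod.fst) hcd
        mdifferentiableAt_fst (τ, β)
      rw [mfderiv_fst] at this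
      exact this
    have h7 := mfderiv_prod_eq_add_apply (v := ((τ, β) : ℝ × Eu r)) (hA.mdifferentiableAt (by simp))
    have h8 := mfderiv_comp_apply (0 : ℝ)
      ((S.contMDiff_act_left g₀).mdifferentiable (by simp) (c 0)) hcd τ
    have h9 := S.coframe_equivariant g₀ (c 0) (mfderiv 𝓘(ℝ, ℝ) (𝓡 (n + r)) c 0 τ)
    have h10 := S.coframe_mfderiv_orbit (c 0) g₀ β
    have h11 := congrArg (S.coframe (c 0 <• g₀)) ((h7.symm.trans h5).trans h6)
    rw [map_add] at h11
    have h12 := (congrArg₂ (· + ·) ((congrArg (S.coframe (c 0 <• g₀)) h8).trans h9) h10).symm.trans h11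
    have h13 := h12.trans (S.coframe_congr hg₀ _)
    have h14 : mfderiv 𝓘(ℝ, ℝ) (𝓡 (n + r)) c 0 τ =
        τ • mfderiv 𝓘(ℝ, ℝ) (𝓡 (n + r)) c 0 (1 : ℝ) := by
      exact (congrArg (mfderiv 𝓘(ℝ, ℝ) (𝓡 (n + r)) c 0) (mul_one τ).symm).trans
        (map_smul (mfderiv 𝓘(ℝ, ℝ) (𝓡 (n + r)) c 0) τ (1 : ℝ))
    -- The θ-component does not see the group direction `β`, so a kernel vector would make `g₀` fix
    -- τ times the velocity of the curve. This forces `τ = 0`, and then `β = 0` because orbit maps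
    -- are immersions.
    have h15 : (ι g₀⁻¹ : Eu n →L[ℝ] Eu n) (S.θ (c 0) (mfderiv 𝓘(ℝ, ℝ) (𝓡 (n + r)) c 0 τ)) + 0 =
        S.θ (c 0) (mfderiv 𝓘(ℝ, ℝ) (𝓡 (n + r)) c 0 τ) := congrArg Prod.fst h13
    rw [add_zero, h14, map_smul, map_smul] at h15
    have hτ : τ = 0 := by
      by_contra hτ
      exact hξ (smul_right_injective _ hτ h15)
    subst hτ
    have h16 := (h7.symm.trans h5).trans h6
    have h17 : (mfderiv (𝓡 r) (𝓡 (n + r)) (fun k : G => c 0 <• k) g₀ β : Eu (n + r)) = 0 := by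
      have h18 : (mfderiv 𝓘(ℝ, ℝ) (𝓡 (n + r)) (fun z => c z <• g₀) 0 (0 : ℝ) : Eu (n + r)) = 0 :=
        map_zero (mfderiv 𝓘(ℝ, ℝ) (𝓡 (n + r)) (fun z => c z <• g₀) 0)
      have h19 : (mfderiv 𝓘(ℝ, ℝ) (𝓡 (n + r)) c 0 (0 : ℝ) : Eu (n + r)) = 0 :=
        map_zero (mfderiv 𝓘(ℝ, ℝ) (𝓡 (n + r)) c 0)
      exact (zero_add _).symm.trans ((congrArg (· + _) h18).symm.trans (h16.trans h19))
    have h18 : β = 0 := S.injective_mfderiv_orbit (c 0) g₀ (h17.trans (map_zero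
      (mfderiv (𝓡 r) (𝓡 (n + r)) (fun k : G => c 0 <• k) g₀)).symm)
    rw [h18]
    rfl
  obtain ⟨U, hU, hUinj⟩ := ContMDiffAt.exists_injOn_of_injective_mfderiv (hfs.of_le (by simp)) hinj
  filter_upwards [hU] with x hx hx0 h
  have h1 : f x = f (0, g₀) := by
    simp [hf, h, hg₀]
  exact hx0 (congrArg Prod.fst (hUinj hx (mem_of_mem_nhds hU) h1))

-- A curve through `p₀` is given a velocity whose θ-value is fixed by no nontrivial element of the
-- finite stabilizer. Off `t = 0` it avoids fixed points of elements near the stabilizer, and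
-- properness handles all others.
include S in
theorem dense_freePoints [T2Space P] (hι : Injective ι) : Dense (freePoints G P) := by
  intro p₀
  have hfin := S.finite_stabilizer p₀
  -- Injectivity of ι makes each fixed subspace proper, and a real vector space is not a finite
  -- union of proper subspaces.
  obtain ⟨ξ₀, hξ₀⟩ : ∃ ξ₀ : Eu n, ∀ g : G, p₀ <• g = p₀ → g ≠ 1 →
      (ι g⁻¹ : Eu n →L[ℝ] Eu n) ξ₀ ≠ ξ₀ := by
    let K : G → Submodule ℝ (Eu n) := fun g =>
      LinearMap.ker ((ι g⁻¹ : Eu n →L[ℝ] Eu n) - ContinuousLinearMap.id ℝ (Eu n)).toLinearMap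
    have hfin' : {g : G | p₀ <• g = p₀ ∧ g ≠ 1}.Finite := hfin.subset fun g hg => hg.1
    have htop : (⊤ : Submodule ℝ (Eu n)) ∉ hfin'.toFinset.image K := by
      intro h
      obtain ⟨g, hg, hgK⟩ := Finset.mem_image.1 h
      have hg1 : g ≠ 1 := ((hfin'.mem_toFinset).1 hg).2
      refine hg1 (inv_eq_one.1 (hι ?_))
      rw [map_one]
      refine Units.ext (ContinuousLinearMap.ext fun v => ?_)
      have : v ∈ K g := hgK ▸ Submodule.mem_top
      exact sub_eq_zero.1 this
    have h1 := Subspace.biUnion_ne_univ_of_top_notMem htop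
    obtain ⟨v, hv⟩ := (ne_univ_iff_exists_notMem _).1 h1
    refine ⟨v, fun g hg hg1 h => hv ?_⟩
    simp only [mem_iUnion]
    exact ⟨K g, Finset.mem_image_of_mem K (hfin'.mem_toFinset.2 ⟨hg, hg1⟩), sub_eq_zero.2 h⟩
  obtain ⟨ξ, hξ⟩ := S.θ_surjective p₀ ξ₀
  set e := chartAt (Eu (n + r)) p₀
  have he : e.IsSmoothCoordinates (Eu (n + r)) := OpenPartialHomeomorph.isSmoothCoordinates_chartAt p₀
  have hp : p₀ ∈ e.source := mem_chart_source _ _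
  set w : Eu (n + r) := mfderiv (𝓡 (n + r)) 𝓘(ℝ, Eu (n + r)) e p₀ ξ
  set l : ℝ → Eu (n + r) := fun t => e p₀ + t • w with hl
  have hld : HasDerivAt l w 0 := by
    have h := ((hasDerivAt_id (0 : ℝ)).smul_const w).const_add (e p₀)
    rw [one_smul] at h
    exact h
  have hl0 : l 0 = e p₀ := by simp [hl]
  set c : ℝ → P := e.symm ∘ l with hcdef
  have hc0 : c 0 = p₀ := by
    simp only [hcdef, comp_apply, hl0]
    exact e.left_inv hp
  have hls : ContDiff ℝ ∞ l := by
    simp only [hl]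
    fun_prop
  have hes := he.contMDiffAt_symm (e.map_source hp)
  have hc : ContMDiffAt 𝓘(ℝ, ℝ) (𝓡 (n + r)) ∞ c 0 :=
    ContMDiffAt.comp_of_eq hes hls.contMDiff.contMDiffAt hl0
  have hvel : S.θ (c 0) (mfderiv 𝓘(ℝ, ℝ) (𝓡 (n + r)) c 0 (1 : ℝ)) = ξ₀ := by
    have h1 := mfderiv_comp_apply (0 : ℝ) (by rw [hl0]; exact hes.mdifferentiableAt (by simp))
      (hls.contMDiff.mdifferentiable (by simp) 0 : MDifferentiableAt 𝓘(ℝ, ℝ) 𝓘(ℝ, Eu (n + r)) l 0)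
      (1 : ℝ)
    have h2 : (mfderiv 𝓘(ℝ, ℝ) 𝓘(ℝ, Eu (n + r)) l 0 (1 : ℝ) : Eu (n + r)) = w := by
      rw [mfderiv_eq_fderiv]
      exact hld.hasFDerivAt.fderiv ▸ one_smul ℝ w
    have h3 := congrArg (fun B : Eu (n + r) →L[ℝ] Eu (n + r) => B w)
        (mfderiv_congr_point (I := 𝓘(ℝ, Eu (n + r))) (I' := 𝓡 (n + r)) (f := e.symm) hl0)
    have h4 : (mfderiv 𝓘(ℝ, ℝ) (𝓡 (n + r)) c 0 (1 : ℝ) : Eu (n + r)) = ξ :=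
      (h1.trans (congrArg (mfderiv 𝓘(ℝ, Eu (n + r)) (𝓡 (n + r)) e.symm (l 0)) h2)).trans
        (h3.trans (he.mfderiv_symm_apply hp ξ))
    have h5 : ∀ q : P, q = p₀ → S.θ q (ξ : Eu (n + r)) = ξ₀ := by
      rintro _ rfl
      exact hξ
    exact (congrArg (S.θ (c 0)) h4).trans (h5 _ hc0)
  have hev : ∀ g : G, p₀ <• g = p₀ → ∀ᶠ x in 𝓝 ((0 : ℝ), g), x.1 ≠ 0 → c x.1 <• x.2 = c x.1 →
      x.2 = 1 := by
    intro g hg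
    by_cases hg1 : g = 1
    · subst hg1
      have h1 : ContinuousAt (fun x : ℝ × G => (c x.1, x.2)) ((0 : ℝ), (1 : G)) :=
        (ContinuousAt.comp_of_eq (g := c) (f := Prod.fst) hc.continuousAt continuousAt_fst
          rfl).prodMk continuousAt_snd
      have h2 := S.eventually_eq_one_of_act_eq (G := G) p₀
      rw [← hc0] at h2
      filter_upwards [h1.eventually h2] with x hx _ using hx
    · have h1 := S.eventually_act_ne_of_curve hc (g₀ := g) (by rw [hc0]; exact hg)
        (by rw [hvel]; exact hξ₀ g hg hg1)
      filter_upwards [h1] with x hx hx0 h using absurd h (hx hx0)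
  have hev' : ∀ g : {g : G | p₀ <• g = p₀}, ∃ O : Set G, IsOpen O ∧ g.1 ∈ O ∧ ∃ A ∈ 𝓝 (0 : ℝ),
      ∀ t ∈ A, ∀ k ∈ O, t ≠ 0 → c t <• k = c t → k = 1 := by
    intro g
    obtain ⟨A, hA, B, hB, hAB⟩ := Filter.mem_prod_iff.1
      ((nhds_prod_eq (x := (0 : ℝ)) (y := g.1)) ▸ hev g.1 g.2)
    obtain ⟨O, hOB, hO, hgO⟩ := mem_nhds_iff.1 hB
    exact ⟨O, hO, hgO, A, hA, fun t ht k hk => hAB (⟨ht, hOB hk⟩ : (t, k) ∈ A ×ˢ B)⟩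
  choose O hO hgO A hA hAO using hev'
  have := hfin.to_subtype
  -- The finitely many sets `O g` cover the stabilizer of `p₀`. Elements outside them fix no point
  -- near `p₀`.
  have hcl : IsClosed {q : P | ∃ g ∈ (⋃ g, O g)ᶜ, q <• g = q} :=
    (S.isClosed_setOf_act_eq (isOpen_iUnion hO).isClosed_compl).preimage
      (continuous_id.prodMk continuous_id)
  have hpn : c 0 ∉ {q : P | ∃ g ∈ (⋃ g, O g)ᶜ, q <• g = q} := by
    rw [hc0]
    rintro ⟨g, hg, h⟩
    exact hg (mem_iUnion.2 ⟨⟨g, h⟩, hgO _⟩)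
  have hfree : ∀ᶠ t in 𝓝 (0 : ℝ), t ≠ 0 → c t ∈ freePoints G P := by
    filter_upwards [Filter.iInter_mem.2 hA,
      hc.continuousAt.preimage_mem_nhds (hcl.isOpen_compl.mem_nhds hpn)] with t ht ht' ht0 k hk
    by_cases hkO : k ∈ ⋃ g, O g
    · obtain ⟨g, hg⟩ := mem_iUnion.1 hkO
      exact hAO g t (mem_iInter.1 ht g) k hg ht0 hk
    · exact absurd ⟨k, hkO, hk⟩ ht'
  have hlim : Filter.Tendsto c (𝓝[≠] 0) (𝓝 p₀) := by
    have := hc.continuousAt.tendsto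
    rw [hc0] at this
    exact this.mono_left nhdsWithin_le_nhds
  exact mem_closure_of_tendsto hlim (eventually_nhdsWithin_iff.2 hfree)

end GStructureWithConnection

end GStr

/-- The components of its velocity make a curve the solution of an ordinary differential equation in
coordinates, so curves with equal components can be compared by `exists_nhds_frame_curve_unique`. -/
theorem IsCoframe.hasDerivAt_comp_curve {E E' V : Type*} [NormedAddCommGroup E] [NormedSpace ℝ E]
    [NormedAddCommGroup E'] [NormedSpace ℝ E'] [NormedAddCommGroup V] [NormedSpace ℝ V]
    {M : Type*} [TopologicalSpace M] [ChartedSpace E M] [IsManifold 𝓘(ℝ, E) ∞ M]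
    {H : Π p : M, TangentSpace 𝓘(ℝ, E) p →L[ℝ] V} (hH : IsCoframe H)
    {e : OpenPartialHomeomorph M E'} (he : e.IsSmoothCoordinates E) {κ : ℝ → M} {t : ℝ}
    (hκ : MDifferentiableAt 𝓘(ℝ, ℝ) 𝓘(ℝ, E) κ t) (ht : κ t ∈ e.source) :
    HasDerivAt (e ∘ κ) (frameCoord e H (e (κ t))
      (H (κ t) (mfderiv 𝓘(ℝ, ℝ) 𝓘(ℝ, E) κ t (1 : ℝ)))) t := by
  have h0 : HasFDerivAt (e ∘ κ) (show ℝ →L[ℝ] E' from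
      (mfderiv 𝓘(ℝ, E) 𝓘(ℝ, E') e (κ t)).comp (mfderiv 𝓘(ℝ, ℝ) 𝓘(ℝ, E) κ t)) t :=
    ((he.mdifferentiableAt ht).hasMFDerivAt.comp t hκ.hasMFDerivAt).hasFDerivAt
  have h1 := h0.hasDerivAt
  have h2 : (frameCoord e H (e (κ t)) (H (κ t) (mfderiv 𝓘(ℝ, ℝ) 𝓘(ℝ, E) κ t (1 : ℝ)))) =
      mfderiv 𝓘(ℝ, E) 𝓘(ℝ, E') e (κ t) (mfderiv 𝓘(ℝ, ℝ) 𝓘(ℝ, E) κ t (1 : ℝ)) := by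
    have h3 : ∀ q : M, q = κ t → (mfderiv 𝓘(ℝ, E) 𝓘(ℝ, E') e q) ((H q).inverse
        (H (κ t) (mfderiv 𝓘(ℝ, ℝ) 𝓘(ℝ, E) κ t (1 : ℝ)))) = (mfderiv 𝓘(ℝ, E) 𝓘(ℝ, E') e (κ t)
          (mfderiv 𝓘(ℝ, ℝ) 𝓘(ℝ, E) κ t (1 : ℝ)) : E') := by
      rintro q rfl
      exact congrArg _ (hH.inverse_apply _)
    exact h3 _ (e.left_inv ht)
  rw [h2]
  exact h1

/-! ### Symmetries commute with small group elements. -/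

namespace GStr

namespace GStructureWithConnection

variable {n r : ℕ} {G : Type*} [Group G] [TopologicalSpace G] [ChartedSpace (Eu r) G]
  {ι : G →* (Eu n →L[ℝ] Eu n)ˣ}
  {P : Type*} [TopologicalSpace P] [ChartedSpace (Eu (n + r)) P] [IsManifold (𝓡 (n + r)) ∞ P]
  [MulAction Gᵐᵒᵖ P] {S : GStructureWithConnection r ι P}

theorem PreservesCoframe.map_coframe {Φ : OpenPartialHomeomorph P P} (hΦ : S.PreservesCoframe Φ)
    {p : P} (hp : p ∈ Φ.source) (ξ : TangentSpace (𝓡 (n + r)) p) :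
    S.coframe (Φ p) (mfderiv (𝓡 (n + r)) (𝓡 (n + r)) Φ p ξ) = S.coframe p ξ :=
  Prod.ext (hΦ.map_θ p hp ξ) (hΦ.map_conn p hp ξ)

theorem preservesCoframe_of_map_coframe {Φ : OpenPartialHomeomorph P P}
    (h1 : ContMDiffOn (𝓡 (n + r)) (𝓡 (n + r)) ∞ Φ Φ.source)
    (h2 : ContMDiffOn (𝓡 (n + r)) (𝓡 (n + r)) ∞ Φ.symm Φ.target)
    (h : ∀ p ∈ Φ.source, ∀ ξ : TangentSpace (𝓡 (n + r)) p,
      S.coframe (Φ p) (mfderiv (𝓡 (n + r)) (𝓡 (n + r)) Φ p ξ) = S.coframe p ξ) :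
    S.PreservesCoframe Φ :=
  ⟨h1, h2, fun p hp ξ => congrArg Prod.fst (h p hp ξ), fun p hp ξ => congrArg Prod.snd (h p hp ξ)⟩

variable [LieGroup (𝓡 r) ∞ G]

-- The right-hand side does not involve `p`: all orbit curves driven by the same `γ` share their
-- velocity components.
variable (S) in
theorem coframe_mfderiv_orbit_curve {γ : ℝ → G} {t : ℝ}
    (hγ : MDifferentiableAt 𝓘(ℝ, ℝ) (𝓡 r) γ t) (p : P) :
    S.coframe (p <• γ t) (mfderiv 𝓘(ℝ, ℝ) (𝓡 (n + r)) (fun s => p <• γ s) t (1 : ℝ)) =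
      (0, (mfderiv (𝓡 r) (𝓡 r) (fun k : G => (γ t)⁻¹ * k) (γ t)
        (mfderiv 𝓘(ℝ, ℝ) (𝓡 r) γ t (1 : ℝ)) : Eu r)) := by
  have h1 := mfderiv_comp_apply t ((S.contMDiff_act_right p).mdifferentiable (by simp) (γ t)) hγ
    (1 : ℝ)
  exact (congrArg (S.coframe (p <• γ t)) h1).trans (S.coframe_mfderiv_orbit p (γ t) _)

/-- A symmetry of the coframe commutes with the elements close to `1`. -/
theorem PreservesCoframe.exists_nhds_map_act {Φ : OpenPartialHomeomorph P P}
    (hΦ : S.PreservesCoframe Φ) {p : P} (hp : p ∈ Φ.source) :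
    ∃ U ∈ 𝓝 p, ∃ O ∈ 𝓝 (1 : G), ∀ p' ∈ U, ∀ g ∈ O,
      Φ (p' <• g) = Φ p' <• g := by
  set e := chartAt (Eu (n + r)) (Φ p)
  have he : e.IsSmoothCoordinates (Eu (n + r)) :=
    OpenPartialHomeomorph.isSmoothCoordinates_chartAt (Φ p)
  have hep : Φ p ∈ e.source := mem_chart_source _ _
  have hH := S.isCoframe
  have hYs := hH.contDiffOn_frameCoord he
  obtain ⟨W, hW, hWu⟩ := exists_nhds_frame_curve_unique
    ((hYs.contDiffAt (e.open_target.mem_nhds (e.map_source hep))).of_le (by simp))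
  set c := chartAt (Eu r) (1 : G)
  have hcs : c.IsSmoothCoordinates (Eu r) :=
    OpenPartialHomeomorph.isSmoothCoordinates_chartAt (1 : G)
  have hc1 : (1 : G) ∈ c.source := mem_chart_source _ _
  have hZ : e.source ∩ e ⁻¹' W ∈ 𝓝 (Φ p) :=
    Filter.inter_mem (e.open_source.mem_nhds hep) ((e.continuousAt hep).preimage_mem_nhds hW)
  have hact := S.continuous_act
  have hD1 : ∀ᶠ x in 𝓝 (p, (1 : G)), x.1 <• x.2 ∈ Φ.source ∩ Φ ⁻¹' (e.source ∩ e ⁻¹' W) := by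
    have h1 : Φ.source ∩ Φ ⁻¹' (e.source ∩ e ⁻¹' W) ∈ 𝓝 (p <• (1 : G)) := by
      rw [act_one]
      exact Filter.inter_mem (Φ.open_source.mem_nhds hp) ((Φ.continuousAt hp).preimage_mem_nhds hZ)
    exact hact.continuousAt.preimage_mem_nhds h1
  have hD2 : ∀ᶠ x in 𝓝 (p, (1 : G)), x.1 ∈ Φ.source ∧ Φ x.1 <• x.2 ∈ e.source ∩ e ⁻¹' W := by
    have h1 : ContinuousAt (fun x : P × G => Φ x.1 <• x.2) (p, (1 : G)) := by
      refine ContinuousAt.comp_of_eq (g := fun x : P × G => x.1 <• x.2)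
        (f := fun x : P × G => (Φ x.1, x.2)) hact.continuousAt ?_ rfl
      exact (ContinuousAt.comp_of_eq (Φ.continuousAt hp) continuousAt_fst rfl).prodMk continuousAt_snd
    have h2 : e.source ∩ e ⁻¹' W ∈ 𝓝 (Φ p <• (1 : G)) := by
      rw [act_one]
      exact hZ
    have h3 : ∀ᶠ x in 𝓝 (p, (1 : G)), x.1 ∈ Φ.source :=
      continuousAt_fst.preimage_mem_nhds (Φ.open_source.mem_nhds hp)
    exact h3.and (h1.preimage_mem_nhds h2)
  obtain ⟨U, hU, O₁, hO₁, hUO⟩ := Filter.mem_prod_iff.1 ((nhds_prod_eq (x := p) (y := (1 : G))) ▸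
    (hD1.and hD2))
  have hO₂ : c.target ∩ c.symm ⁻¹' O₁ ∈ 𝓝 (c 1) := by
    refine Filter.inter_mem (c.open_target.mem_nhds (c.map_source hc1))
      ((c.continuousAt_symm (c.map_source hc1)).preimage_mem_nhds ?_)
    rwa [c.left_inv hc1]
  obtain ⟨ρ, hρ, hball⟩ := Metric.mem_nhds_iff.1 hO₂
  refine ⟨U, hU, c.source ∩ c ⁻¹' Metric.ball (c 1) ρ, Filter.inter_mem
    (c.open_source.mem_nhds hc1) ((c.continuousAt hc1).preimage_mem_nhds (Metric.ball_mem_nhds _ hρ)),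
    ?_⟩
  rintro p' hp' g ⟨hg1, hg2⟩
  -- `γ` is the straight segment from 1 to `g` in the chart at 1; it stays in the convex ball chosen
  -- above.
  set l : ℝ → Eu r := fun t => c 1 + t • (c g - c 1) with hl
  have hls : ContDiff ℝ ∞ l := by
    simp only [hl]
    fun_prop
  have hlb : ∀ t ∈ Icc (0 : ℝ) 1, l t ∈ c.target ∩ c.symm ⁻¹' O₁ := fun t ht =>
    hball ((convex_ball (c 1) ρ).add_smul_sub_mem (Metric.mem_ball_self hρ) hg2 ht)
  set γ : ℝ → G := c.symm ∘ l with hγ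
  have hγs : ∀ t ∈ Icc (0 : ℝ) 1, ContMDiffAt 𝓘(ℝ, ℝ) (𝓡 r) ∞ γ t := fun t ht =>
    ContMDiffAt.comp t (hcs.contMDiffAt_symm (hlb t ht).1) hls.contMDiff.contMDiffAt
  have hγ0 : γ 0 = 1 := by simp [hγ, hl, c.left_inv hc1]
  have hγ1 : γ 1 = g := by simp [hγ, hl, c.left_inv hg1]
  have hmem : ∀ t ∈ Icc (0 : ℝ) 1, (p' <• γ t ∈ Φ.source ∩ Φ ⁻¹' (e.source ∩ e ⁻¹' W)) ∧
      (p' ∈ Φ.source ∧ Φ p' <• γ t ∈ e.source ∩ e ⁻¹' W) := fun t ht =>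
    hUO (⟨hp', (hlb t ht).2⟩ : (p', γ t) ∈ U ×ˢ O₁)
  set a : ℝ → Fib n r := fun t =>
    S.coframe (Φ p' <• γ t) (mfderiv 𝓘(ℝ, ℝ) (𝓡 (n + r)) (fun s => Φ p' <• γ s) t (1 : ℝ)) with ha
  have hκs : ∀ q : P, ∀ t ∈ Icc (0 : ℝ) 1,
      ContMDiffAt 𝓘(ℝ, ℝ) (𝓡 (n + r)) ∞ (fun s => q <• γ s) t := fun q t ht =>
    ContMDiffAt.comp t (S.contMDiff_act_right q (γ t)) (hγs t ht)
  have hd2 : ∀ t ∈ Icc (0 : ℝ) 1, HasDerivAt (e ∘ fun s => Φ p' <• γ s)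
      (frameCoord e S.coframe (e (Φ p' <• γ t)) (a t)) t := fun t ht =>
    hH.hasDerivAt_comp_curve he ((hκs (Φ p') t ht).mdifferentiableAt (by simp)) (hmem t ht).2.2.1
  -- `Φ` preserves the coframe, so Φ(p'·γ) has the components of p'·γ, which are those of Φ(p')·γ.
  -- Both curves therefore solve the same equation.
  have hd1 : ∀ t ∈ Icc (0 : ℝ) 1, HasDerivAt (e ∘ fun s => Φ (p' <• γ s))
      (frameCoord e S.coframe (e (Φ (p' <• γ t))) (a t)) t := by
    intro t ht
    have h0 := (hκs p' t ht).mdifferentiableAt (by simp)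
    have h1 := hΦ.mdifferentiableAt (hmem t ht).1.1
    have h2 := hH.hasDerivAt_comp_curve he (κ := fun s => Φ (p' <• γ s)) (h1.comp t h0)
      (hmem t ht).1.2.1
    have h3 := mfderiv_comp_apply t h1 h0 (1 : ℝ)
    have h4 := (congrArg (S.coframe (Φ (p' <• γ t))) h3).trans (hΦ.map_coframe (hmem t ht).1.1 _)
    have h5 := h4.trans ((S.coframe_mfderiv_orbit_curve ((hγs t ht).mdifferentiableAt (by simp)) p').trans
      (S.coframe_mfderiv_orbit_curve ((hγs t ht).mdifferentiableAt (by simp)) (Φ p')).symm)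
    exact (congrArg (fun v => frameCoord e S.coframe (e (Φ (p' <• γ t))) v) h5) ▸ h2
  -- Continuity of the components on the compact interval provides the bound `C` demanded by
  -- uniqueness.
  have hac : ContinuousOn a (Icc 0 1) := by
    have h1 : ∀ t ∈ Icc (0 : ℝ) 1, a t = coframeCoord e S.coframe ((e ∘ fun s => Φ p' <• γ s) t)
        (fderiv ℝ (e ∘ fun s => Φ p' <• γ s) t 1) := by
      intro t ht
      have h2 : fderiv ℝ (e ∘ fun s => Φ p' <• γ s) t 1 =
          frameCoord e S.coframe (e (Φ p' <• γ t)) (a t) := (hd2 t ht).deriv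
      rw [h2]
      exact (hH.coframeCoord_frameCoord he (e.map_source (hmem t ht).2.2.1) _).symm
    refine ContinuousOn.congr (fun t ht => ContinuousAt.continuousWithinAt ?_) h1
    have h3 : ContDiffAt ℝ ∞ (e ∘ fun s => Φ p' <• γ s) t :=
      contMDiffAt_iff_contDiffAt.1 (ContMDiffAt.comp t (he.contMDiffAt (hmem t ht).2.2.1)
        (hκs (Φ p') t ht))
    have h4 := (h3.fderiv_right (m := 0) (by simp)).continuousAt
    have h5 : ContinuousAt (coframeCoord e S.coframe) ((e ∘ fun s => Φ p' <• γ s) t) :=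
      (hH.contDiffOn_coframeCoord he).continuousOn.continuousAt
        (e.open_target.mem_nhds (e.map_source (hmem t ht).2.2.1))
    exact (ContinuousAt.comp (f := e ∘ fun s => Φ p' <• γ s) h5 h3.continuousAt).clm_apply
      (h4.clm_apply continuousAt_const)
  obtain ⟨C, hC⟩ := isCompact_Icc.exists_bound_of_continuousOn hac
  have h0 : (e ∘ fun s => Φ (p' <• γ s)) 0 = (e ∘ fun s => Φ p' <• γ s) 0 := by
    simp only [comp_apply, hγ0, act_one]
  have h1 := hWu a C _ _ (fun t ht => hC t (Ico_subset_Icc_self ht))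
    (fun t ht => ⟨(hmem t ht).1.2.2, hd1 t ht⟩) (fun t ht => ⟨(hmem t ht).2.2.2, hd2 t ht⟩) h0
  simp only [comp_apply, hγ1] at h1
  have hm := hmem 1 (right_mem_Icc.2 zero_le_one)
  rw [hγ1] at hm
  exact e.injOn hm.1.2.1 hm.2.2.1 h1

end GStructureWithConnection

end GStr

/-! ### Equivariant extension of symmetries and invariance of functions. -/

namespace GStr

section Extension

variable {G P : Type*} [Group G] [MulAction Gᵐᵒᵖ P]

variable (G) in
/-- The saturation of `U`. -/
def saturation (U : Set P) : Set P := {x | ∃ g : G, x <• g ∈ U}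

open Classical in
variable (G) in
/-- The equivariant extension of the restriction of `f` to `U`. -/
noncomputable def equivariantExtension (U : Set P) (f : P → P) (x : P) : P :=
  if h : ∃ g : G, x <• g ∈ U then f (x <• h.choose) <• (h.choose)⁻¹ else x

variable (G) in
/-- `f` commutes with the group elements relating points of `U`. -/
def CommutesOn (U : Set P) (f : P → P) : Prop :=
  ∀ u ∈ U, ∀ g : G, u <• g ∈ U → f (u <• g) = f u <• g

variable {U V : Set P} {f f' : P → P}

/-- Two choices of the moving element differ by one relating points of `U`, with which `f` commutes.
The extension is thus independent of the choice. -/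
theorem equivariantExtension_eq (hf : CommutesOn G U f) {x : P} {g : G} (hx : x <• g ∈ U) :
    equivariantExtension G U f x = f (x <• g) <• g⁻¹ := by
  have h : ∃ g : G, x <• g ∈ U := ⟨g, hx⟩
  have h1 : (x <• h.choose) <• (h.choose⁻¹ * g) = x <• g := by
    rw [GStructureWithConnection.act_act, mul_inv_cancel_left]
  have h2 := hf _ h.choose_spec (h.choose⁻¹ * g) (by rwa [h1])
  rw [equivariantExtension, dif_pos h, ← h1, h2, GStructureWithConnection.act_act]
  congr 2
  group

theorem equivariantExtension_act (hf : CommutesOn G U f) {x : P} (hx : x ∈ saturation G U) (k : G) :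
    equivariantExtension G U f (x <• k) = equivariantExtension G U f x <• k := by
  obtain ⟨g, hg⟩ := hx
  have h1 : (x <• k) <• (k⁻¹ * g) = x <• g := by
    rw [GStructureWithConnection.act_act, mul_inv_cancel_left]
  rw [equivariantExtension_eq hf hg, equivariantExtension_eq hf (h1.symm ▸ hg : _ ∈ U), h1,
    GStructureWithConnection.act_act]
  congr 2
  group

theorem act_mem_saturation {x : P} (hx : x ∈ saturation G U) (k : G) :
    x <• k ∈ saturation G U := by
  obtain ⟨g, hg⟩ := hx
  refine ⟨k⁻¹ * g, ?_⟩
  rwa [GStructureWithConnection.act_act, mul_inv_cancel_left]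

theorem mapsTo_equivariantExtension (hf : CommutesOn G U f) (h : MapsTo f U V) :
    MapsTo (equivariantExtension G U f) (saturation G U) (saturation G V) := by
  rintro x ⟨g, hg⟩
  refine ⟨g, ?_⟩
  rw [equivariantExtension_eq hf hg, GStructureWithConnection.act_act, inv_mul_cancel,
    GStructureWithConnection.act_one]
  exact h hg

theorem leftInvOn_equivariantExtension (hf : CommutesOn G U f) (hf' : CommutesOn G V f')
    (h : MapsTo f U V) (h' : LeftInvOn f' f U) :
    LeftInvOn (equivariantExtension G V f') (equivariantExtension G U f) (saturation G U) := by
  rintro x ⟨g, hg⟩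
  have h1 : (f (x <• g) <• g⁻¹) <• g = f (x <• g) := by
    rw [GStructureWithConnection.act_act, inv_mul_cancel, GStructureWithConnection.act_one]
  rw [equivariantExtension_eq hf hg, equivariantExtension_eq hf' (g := g) (by rw [h1]; exact h hg),
    h1, h' hg, GStructureWithConnection.act_act, mul_inv_cancel, GStructureWithConnection.act_one]

end Extension

namespace GStructureWithConnection

variable {n r : ℕ} {G : Type*} [Group G] [TopologicalSpace G] [ChartedSpace (Eu r) G]
  {ι : G →* (Eu n →L[ℝ] Eu n)ˣ}
  {P : Type*} [TopologicalSpace P] [ChartedSpace (Eu (n + r)) P] [IsManifold (𝓡 (n + r)) ∞ P]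
  [MulAction Gᵐᵒᵖ P] (S : GStructureWithConnection r ι P)

include S in
theorem isOpen_saturation {U : Set P} (hU : IsOpen U) : IsOpen (saturation G U) := by
  have h1 : saturation G U = ⋃ g : G, (fun x : P => x <• g) ⁻¹' U := by
    ext x
    simp [saturation]
  rw [h1]
  exact isOpen_iUnion fun g => hU.preimage (S.contMDiff_act_left g).continuous

include S in
theorem eventually_equivariantExtension_eq {U : Set P}
    (hU : IsOpen U) {f : P → P} (hf : CommutesOn G U f)
    {x : P} {g : G} (hx : x <• g ∈ U) : equivariantExtension G U f =ᶠ[𝓝 x]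
      (fun y => y <• g⁻¹) ∘ f ∘ fun y => y <• g := by
  filter_upwards [(S.contMDiff_act_left g).continuous.continuousAt.preimage_mem_nhds
    (hU.mem_nhds hx)] with y hy
  exact equivariantExtension_eq hf hy

include S in
theorem contMDiffOn_equivariantExtension {U : Set P} (hU : IsOpen U) {f : P → P}
    (hf : CommutesOn G U f) (hfs : ContMDiffOn (𝓡 (n + r)) (𝓡 (n + r)) ∞ f U) :
    ContMDiffOn (𝓡 (n + r)) (𝓡 (n + r)) ∞ (equivariantExtension G U f) (saturation G U) := by
  rintro x ⟨g, hg⟩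
  refine ContMDiffAt.contMDiffWithinAt ?_
  refine ContMDiffAt.congr_of_eventuallyEq ?_ (S.eventually_equivariantExtension_eq hU hf hg)
  exact (S.contMDiff_act_left g⁻¹ _).comp x (ContMDiffAt.comp x (hfs.contMDiffAt (hU.mem_nhds hg))
    (S.contMDiff_act_left g x))

variable [LieGroup (𝓡 r) ∞ G]

/-- The right-hand side does not mention `f`, so the conjugate of any symmetry acts on the coframe
as the conjugate of the identity does. -/
theorem coframe_mfderiv_conj {f : P → P} {x : P} {g : G}
    (hf : MDifferentiableAt (𝓡 (n + r)) (𝓡 (n + r)) f (x <• g))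
    (h : ∀ ξ : TangentSpace (𝓡 (n + r)) (x <• g), S.coframe (f (x <• g))
      (mfderiv (𝓡 (n + r)) (𝓡 (n + r)) f (x <• g) ξ) = S.coframe (x <• g) ξ)
    (ξ : TangentSpace (𝓡 (n + r)) x) :
    S.coframe (f (x <• g) <• g⁻¹) (mfderiv (𝓡 (n + r)) (𝓡 (n + r))
      ((fun y => y <• g⁻¹) ∘ f ∘ fun y => y <• g) x ξ) =
      Prod.map (ι g⁻¹⁻¹ : Eu n →L[ℝ] Eu n) (Ad g⁻¹⁻¹ : LieAlg r →L[ℝ] LieAlg r)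
        (S.coframe (x <• g) (mfderiv (𝓡 (n + r)) (𝓡 (n + r)) (fun y : P => y <• g) x ξ)) := by
  have h1 := (S.contMDiff_act_left g).mdifferentiable (by simp) x
  have h2 := (S.contMDiff_act_left g⁻¹).mdifferentiable (by simp) (f (x <• g))
  have h3 := mfderiv_comp_apply x (g := fun y : P => y <• g⁻¹) (f := f ∘ fun y => y <• g) h2
    (hf.comp x h1) ξ
  have h4 := mfderiv_comp_apply x (g := f) (f := fun y : P => y <• g) hf h1 ξ
  refine (congrArg (S.coframe (f (x <• g) <• g⁻¹)) h3).trans ?_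
  refine (S.coframe_equivariant g⁻¹ (f (x <• g)) _).trans ?_
  refine congrArg _ ?_
  exact (congrArg (S.coframe (f (x <• g))) h4).trans (h _)

theorem coframe_mfderiv_equivariantExtension {U : Set P} (hU : IsOpen U) {f : P → P}
    (hf : CommutesOn G U f) (hfs : ContMDiffOn (𝓡 (n + r)) (𝓡 (n + r)) ∞ f U)
    (h : ∀ p ∈ U, ∀ ξ : TangentSpace (𝓡 (n + r)) p,
      S.coframe (f p) (mfderiv (𝓡 (n + r)) (𝓡 (n + r)) f p ξ) = S.coframe p ξ)
    {x : P} (hx : x ∈ saturation G U) (ξ : TangentSpace (𝓡 (n + r)) x) :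
    S.coframe (equivariantExtension G U f x)
      (mfderiv (𝓡 (n + r)) (𝓡 (n + r)) (equivariantExtension G U f) x ξ) = S.coframe x ξ := by
  obtain ⟨g, hg⟩ := hx
  have h1 := S.coframe_mfderiv_conj (f := f) ((hfs.contMDiffAt (hU.mem_nhds hg)).mdifferentiableAt
    (by simp)) (h _ hg) ξ
  -- Comparison with `f = id` identifies the right-hand side as `S.coframe x ξ` without computing
  -- with ι and Ad.
  have h2 := S.coframe_mfderiv_conj (f := id) (x := x) (g := g) mdifferentiableAt_id
    (by intro ξ; rw [mfderiv_id]; rfl) ξ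
  have h3 : ((fun y : P => y <• g⁻¹) ∘ id ∘ fun y => y <• g) = id := by
    funext y
    simp only [comp_apply, id]
    rw [act_act, mul_inv_cancel, act_one]
  have h4 : ∀ φ : P → P, φ = id → (mfderiv (𝓡 (n + r)) (𝓡 (n + r)) φ x ξ : Eu (n + r)) = ξ := by
    rintro _ rfl
    rw [mfderiv_id]
    rfl
  have h5 : x = id (x <• g) <• g⁻¹ := by
    simp only [id]
    rw [act_act, mul_inv_cancel, act_one]
  have h6 := ((S.coframe_congr h5 ξ).trans (congrArg (S.coframe (id (x <• g) <• g⁻¹))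
    (h4 _ h3).symm)).trans h2
  refine Eq.trans ?_ (h1.trans h6.symm)
  have h7 := (S.eventually_equivariantExtension_eq hU hf hg).mfderiv_eq
    (I := 𝓡 (n + r)) (I' := 𝓡 (n + r))
  refine (S.coframe_congr (equivariantExtension_eq hf hg) _).trans ?_
  exact congrArg (fun A : Eu (n + r) →L[ℝ] Eu (n + r) => S.coframe (f (x <• g) <• g⁻¹) (A ξ)) h7

-- If `u` and `u·g` both lie close enough to `p`, properness and the trivial stabilizer force `g`
-- near 1, where `exists_nhds_map_act` applies.
variable {S} in
theorem PreservesCoframe.exists_nhds_commutesOn {Φ : OpenPartialHomeomorph P P}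
    (hΦ : S.PreservesCoframe Φ) {p : P} (hp : p ∈ Φ.source) (hpf : p ∈ freePoints G P) :
    ∃ U ∈ 𝓝 p, CommutesOn G U Φ := by
  obtain ⟨U₀, hU₀, O, hO, h⟩ := hΦ.exists_nhds_map_act hp
  obtain ⟨O', hO'O, hO', h1⟩ := mem_nhds_iff.1 hO
  have hcl := S.isClosed_setOf_act_eq hO'.isClosed_compl
  have hpp : (p, p) ∉ {x : P × P | ∃ g ∈ O'ᶜ, x.2 <• g = x.1} := by
    rintro ⟨g, hg, hgp⟩
    exact hg (hpf g hgp ▸ h1)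
  obtain ⟨A, hA, B, hB, hAB⟩ := Filter.mem_prod_iff.1 ((nhds_prod_eq (x := p) (y := p)) ▸
    hcl.isOpen_compl.mem_nhds hpp)
  refine ⟨U₀ ∩ (A ∩ B), Filter.inter_mem hU₀ (Filter.inter_mem hA hB), ?_⟩
  intro u hu g hug
  refine h u hu.1 g (hO'O ?_)
  by_contra hg
  exact hAB (⟨hug.2.1, hu.2.2⟩ : (u <• g, u) ∈ A ×ˢ B) ⟨g, hg, rfl⟩

variable {S} in
/-- Near points with trivial stabilizers, a local symmetry of the coframe extends to an equivariant
one on a saturated open set. -/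
theorem PreservesCoframe.exists_isLocalSelfEquivalence {Φ : OpenPartialHomeomorph P P}
    (hΦ : S.PreservesCoframe Φ) {p : P} (hp : p ∈ Φ.source) (hpf : p ∈ freePoints G P)
    (hqf : Φ p ∈ freePoints G P) :
    ∃ Ψ : OpenPartialHomeomorph P P, S.IsLocalSelfEquivalence Ψ ∧ p ∈ Ψ.source ∧ Ψ p = Φ p := by
  obtain ⟨U₁, hU₁, hc₁⟩ := hΦ.exists_nhds_commutesOn hp hpf
  obtain ⟨U₂, hU₂, hc₂⟩ := hΦ.symm.exists_nhds_commutesOn (Φ.map_source hp) hqf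
  obtain ⟨U, hUs, hU, hpU⟩ := mem_nhds_iff.1 (Filter.inter_mem (Filter.inter_mem hU₁
    ((Φ.continuousAt hp).preimage_mem_nhds hU₂)) (Φ.open_source.mem_nhds hp))
  have hUsrc : U ⊆ Φ.source := fun u hu => (hUs hu).2
  have hf : CommutesOn G U Φ := fun u hu g hug => hc₁ u (hUs hu).1.1 g (hUs hug).1.1
  have hf' : CommutesOn G (Φ '' U) Φ.symm := by
    rintro _ ⟨u, hu, rfl⟩ g ⟨u', hu', h'⟩
    exact hc₂ _ (hUs hu).1.2 g (h' ▸ (hUs hu').1.2)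
  have hV : IsOpen (Φ '' U) := Φ.isOpen_image_of_subset_source hU hUsrc
  have hVtgt : Φ '' U ⊆ Φ.target := by
    rintro _ ⟨u, hu, rfl⟩
    exact Φ.map_source (hUsrc hu)
  have hm : MapsTo Φ U (Φ '' U) := mapsTo_image _ _
  have hl : LeftInvOn Φ.symm Φ U := fun u hu => Φ.left_inv (hUsrc hu)
  have hm' : MapsTo Φ.symm (Φ '' U) U := by
    rintro _ ⟨u, hu, rfl⟩
    rwa [hl hu]
  have hl' : LeftInvOn Φ Φ.symm (Φ '' U) := fun v hv => Φ.right_inv (hVtgt hv)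
  have hs := S.contMDiffOn_equivariantExtension hU hf (hΦ.contMDiffOn.mono hUsrc)
  have hs' := S.contMDiffOn_equivariantExtension hV hf' (hΦ.contMDiffOn_symm.mono hVtgt)
  let Ψ : OpenPartialHomeomorph P P :=
    { toFun := equivariantExtension G U Φ
      invFun := equivariantExtension G (Φ '' U) Φ.symm
      source := saturation G U
      target := saturation G (Φ '' U)
      map_source' := mapsTo_equivariantExtension hf hm
      map_target' := mapsTo_equivariantExtension hf' hm'
      left_inv' := leftInvOn_equivariantExtension hf hf' hm hl
      right_inv' := leftInvOn_equivariantExtension hf' hf hm' hl'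
      open_source := S.isOpen_saturation hU
      open_target := S.isOpen_saturation hV
      continuousOn_toFun := hs.continuousOn
      continuousOn_invFun := hs'.continuousOn }
  have hpU' : p <• (1 : G) ∈ U := by rwa [act_one]
  refine ⟨Ψ, { toPreservesCoframe := preservesCoframe_of_map_coframe hs hs' fun x hx ξ => ?_
               saturated := fun x hx g => act_mem_saturation hx g
               equivariant := fun x hx g => equivariantExtension_act hf hx g }, ⟨1, hpU'⟩, ?_⟩
  · exact S.coframe_mfderiv_equivariantExtension hU hf (hΦ.contMDiffOn.mono hUsrc)
      (fun q hq => hΦ.map_coframe (hUsrc hq)) hx ξ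
  · refine (equivariantExtension_eq hf hpU').trans ?_
    rw [inv_one, act_one, act_one]

variable {S} in
/-- Invariant functions are invariant under all local symmetries of the coframe. -/
theorem IsInvariantFunction.map_eq [T2Space P] (hι : Injective ι) {f : P → ℝ}
    (hf : S.IsInvariantFunction f) {Φ : OpenPartialHomeomorph P P} (hΦ : S.PreservesCoframe Φ)
    {p : P} (hp : p ∈ Φ.source) : f (Φ p) = f p := by
  have hd := S.dense_freePoints hι
  have ho := S.isOpen_freePoints
  -- Points with trivial stabilizer whose image also has one are dense in the source: `Φ` is a
  -- homeomorphism and `freePoints G P` is open and dense. Equality is shown there and extended by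
  -- continuity.
  have h1 : p ∈ closure (Φ.source ∩ (freePoints G P ∩ Φ ⁻¹' freePoints G P)) := by
    rw [mem_closure_iff]
    intro W hW hpW
    have hW1 : IsOpen (Φ.source ∩ W) := Φ.open_source.inter hW
    have hW2 : IsOpen (Φ '' (Φ.source ∩ W)) :=
      Φ.isOpen_image_of_subset_source hW1 inter_subset_left
    obtain ⟨_, ⟨u, hu, rfl⟩, huf⟩ := hd.inter_open_nonempty _ hW2 ⟨_, p, ⟨hp, hpW⟩, rfl⟩
    have hW3 : IsOpen ((Φ.source ∩ W) ∩ Φ ⁻¹' freePoints G P) := by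
      have := Φ.isOpen_inter_preimage ho
      have h2 : (Φ.source ∩ W) ∩ Φ ⁻¹' freePoints G P = (Φ.source ∩ Φ ⁻¹' freePoints G P) ∩ W := by
        ext; simp; tauto
      rw [h2]
      exact this.inter hW
    obtain ⟨v, hv, hvf⟩ := hd.inter_open_nonempty _ hW3 ⟨u, hu, huf⟩
    exact ⟨v, hv.1.2, hv.1.1, hvf, hv.2⟩
  have h2 : ContinuousWithinAt (fun q => f (Φ q) - f q)
      (Φ.source ∩ (freePoints G P ∩ Φ ⁻¹' freePoints G P)) p :=
    ((hf.1.continuous.continuousAt.comp (Φ.continuousAt hp)).sub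
      hf.1.continuous.continuousAt).continuousWithinAt
  have h3 := h2.mem_closure_image h1
  have h4 : (fun q => f (Φ q) - f q) '' (Φ.source ∩ (freePoints G P ∩ Φ ⁻¹' freePoints G P)) ⊆
      {0} := by
    rintro _ ⟨q, ⟨hq, hqf, hqf'⟩, rfl⟩
    obtain ⟨Ψ, hΨ, hqΨ, hΨq⟩ := hΦ.exists_isLocalSelfEquivalence hq hqf hqf'
    simp only [mem_singleton_iff]
    rw [← hΨq, hf.2 Ψ hΨ q hqΨ, sub_self]
  have h5 := closure_minimal h4 isClosed_singleton h3
  exact sub_eq_zero.1 h5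

end GStructureWithConnection

end GStr

/-! ### Linear algebra of independent functionals. -/

section LinearAlgebra

theorem Submodule.exists_linearIndependent_of_finrank_eq {V : Type*} [AddCommGroup V] [Module ℝ V]
    [FiniteDimensional ℝ V] {D : Submodule ℝ V} {d : ℕ} (hD : Module.finrank ℝ D = d) :
    ∃ l : Fin d → V, (∀ a, l a ∈ D) ∧ LinearIndependent ℝ l :=
  let b := Module.finBasisOfFinrankEq ℝ D hD
  ⟨fun a => b a, fun a => (b a).2, b.linearIndependent.map' D.subtype D.ker_subtype⟩

variable {E : Type*} [NormedAddCommGroup E] [NormedSpace ℝ E] [FiniteDimensional ℝ E] {d : ℕ}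

/-- Linearly independent functionals are jointly surjective. -/
theorem surjective_pi_of_linearIndependent {l : Fin d → (E →L[ℝ] ℝ)} (hl : LinearIndependent ℝ l) :
    Surjective (fun v (a : Fin d) => l a v) := by
  let L : E →ₗ[ℝ] (Fin d → ℝ) := LinearMap.pi fun a => (l a).toLinearMap
  have hL : LinearMap.range L = ⊤ := by
    by_contra h
    obtain ⟨φ, hφ, hle⟩ := Submodule.exists_le_ker_of_lt_top _ (lt_top_iff_ne_top.2 h)
    refine hφ ?_
    have h1 : ∀ c : Fin d → ℝ, φ c = ∑ a, c a * φ (Pi.single a 1) := by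
      intro c
      conv_lhs => rw [← Finset.univ_sum_single c, map_sum]
      refine Finset.sum_congr rfl fun a _ => ?_
      rw [← smul_eq_mul, ← map_smul]
      congr 1
      rw [← Pi.single_smul, smul_eq_mul, mul_one]
    have h2 : ∑ a, φ (Pi.single a 1) • l a = 0 := by
      ext v
      have h3 : φ (L v) = 0 := hle ⟨v, rfl⟩
      rw [h1] at h3
      simp only [sum_apply, smul_apply, zero_apply, smul_eq_mul]
      rw [← h3]
      exact Finset.sum_congr rfl fun a _ => mul_comm _ _
    have h4 := Fintype.linearIndependent_iff.1 hl _ h2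
    refine LinearMap.ext fun c => ?_
    rw [h1]
    simp [h4]
  exact LinearMap.range_eq_top.1 hL

/-- In a `d`-dimensional space of functionals, `d` jointly surjective ones span. -/
theorem apply_eq_zero_of_surjective_pi {D : Submodule ℝ (E →L[ℝ] ℝ)} (hD : Module.finrank ℝ D = d)
    {l : Fin d → (E →L[ℝ] ℝ)} (hlD : ∀ a, l a ∈ D) (hl : Surjective (fun v (a : Fin d) => l a v))
    {m : E →L[ℝ] ℝ} (hm : m ∈ D) {v : E} (hv : ∀ a, l a v = 0) : m v = 0 := by
  have hli : LinearIndependent ℝ l := by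
    rw [Fintype.linearIndependent_iff]
    intro c hc a
    obtain ⟨w, hw⟩ := hl (Pi.single a 1)
    have h2 := congrArg (fun k : E →L[ℝ] ℝ => k w) hc
    simp only [sum_apply, smul_apply, zero_apply, smul_eq_mul] at h2
    have h3 : ∀ b, l b w = (Pi.single a 1 : Fin d → ℝ) b := fun b => congrFun hw b
    simpa [h3, Pi.single_apply] using h2
  have hle : Submodule.span ℝ (range l) ≤ D := Submodule.span_le.2 (by
    rintro _ ⟨a, rfl⟩
    exact hlD a)
  have hs : Submodule.span ℝ (range l) = D := Submodule.eq_of_le_of_finrank_eq hle (by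
    rw [finrank_span_eq_card hli, hD, Fintype.card_fin])
  rw [← hs] at hm
  obtain ⟨c, rfl⟩ := (Submodule.mem_span_range_iff_exists_fun ℝ).1 hm
  simp [hv]

/-- A surjective linear map extends to an isomorphism by a complementary projection. -/
theorem exists_complement_equiv {k m : ℕ} (L : EuclideanSpace ℝ (Fin m) →L[ℝ] EuclideanSpace ℝ (Fin k))
    (hL : Surjective L) : k ≤ m ∧ ∃ pr : EuclideanSpace ℝ (Fin m) →L[ℝ] EuclideanSpace ℝ (Fin (m - k)),
      ∃ A : EuclideanSpace ℝ (Fin m) ≃L[ℝ] EuclideanSpace ℝ (Fin k) × EuclideanSpace ℝ (Fin (m - k)),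
        (A : EuclideanSpace ℝ (Fin m) →L[ℝ] _) = L.prod pr := by
  have hr : LinearMap.range L.toLinearMap = ⊤ := LinearMap.range_eq_top.2 hL
  have hdim := L.toLinearMap.finrank_range_add_finrank_ker
  rw [hr, finrank_top, finrank_euclideanSpace_fin, finrank_euclideanSpace_fin] at hdim
  have hk : Module.finrank ℝ (LinearMap.ker L.toLinearMap) =
      Module.finrank ℝ (EuclideanSpace ℝ (Fin (m - k))) := by
    rw [finrank_euclideanSpace_fin]
    omega
  obtain ⟨ψ⟩ := FiniteDimensional.nonempty_linearEquiv_of_finrank_eq hk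
  obtain ⟨q, hq⟩ := (LinearMap.ker L.toLinearMap).exists_isCompl
  let ρ := Submodule.projectionOnto _ _ hq
  let pr : EuclideanSpace ℝ (Fin m) →L[ℝ] EuclideanSpace ℝ (Fin (m - k)) :=
    LinearMap.toContinuousLinearMap (ψ.toLinearMap ∘ₗ ρ)
  have hinj : Injective (L.prod pr) := by
    refine (injective_iff_map_eq_zero _).2 fun v hv => ?_
    have h1 : L v = 0 := congrArg Prod.fst hv
    have h2 : ψ (ρ v) = 0 := congrArg Prod.snd hv
    have h3 : ρ v = ⟨v, h1⟩ := Submodule.projectionOnto_apply_left hq ⟨v, h1⟩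
    rw [LinearEquiv.map_eq_zero_iff, h3] at h2
    exact congrArg Subtype.val h2
  have hd : Module.finrank ℝ (EuclideanSpace ℝ (Fin m)) =
      Module.finrank ℝ (EuclideanSpace ℝ (Fin k) × EuclideanSpace ℝ (Fin (m - k))) := by
    rw [Module.finrank_prod]
    simp only [finrank_euclideanSpace_fin]
    omega
  have hb : Bijective (L.prod pr).toLinearMap :=
    ⟨hinj, (LinearMap.injective_iff_surjective_of_finrank_eq_finrank hd).1 hinj⟩
  refine ⟨by omega, pr, (LinearEquiv.ofBijective _ hb).toContinuousLinearEquiv, ?_⟩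
  ext v <;> rfl

end LinearAlgebra

/-! ### Invariant maps and adapted coordinates. -/

namespace GStr

namespace GStructureWithConnection

variable {n r d : ℕ} {G : Type*} [Group G] [TopologicalSpace G] [ChartedSpace (Eu r) G]
  {ι : G →* (Eu n →L[ℝ] Eu n)ˣ}
  {P : Type*} [TopologicalSpace P] [ChartedSpace (Eu (n + r)) P] [IsManifold (𝓡 (n + r)) ∞ P]
  [MulAction Gᵐᵒᵖ P] (S : GStructureWithConnection r ι P)
  {W W' : Type*} [NormedAddCommGroup W] [NormedSpace ℝ W] [NormedAddCommGroup W'] [NormedSpace ℝ W']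

/-- The smooth maps that are invariant under all local symmetries of the coframe. -/
def IsInvariantMap (u : P → W) : Prop :=
  ContMDiff (𝓡 (n + r)) 𝓘(ℝ, W) ∞ u ∧
    ∀ Φ : OpenPartialHomeomorph P P, S.PreservesCoframe Φ → ∀ p ∈ Φ.source, u (Φ p) = u p

variable {S}

namespace IsInvariantMap

theorem const (w : W) : S.IsInvariantMap (fun _ : P => w) :=
  ⟨contMDiff_const, fun _ _ _ _ => rfl⟩

theorem comp {u : P → W} (hu : S.IsInvariantMap u) {φ : W → W'} (hφ : ContDiff ℝ ∞ φ) :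
    S.IsInvariantMap (fun p => φ (u p)) :=
  ⟨hφ.contMDiff.comp hu.1, fun Φ hΦ p hp => congrArg φ (hu.2 Φ hΦ p hp)⟩

theorem isInvariantFunction {u : P → ℝ} (hu : S.IsInvariantMap u) : S.IsInvariantFunction u :=
  ⟨hu.1, fun Φ hΦ p hp => hu.2 Φ hΦ.toPreservesCoframe p hp⟩

theorem eventuallyEq {u : P → W} (hu : S.IsInvariantMap u) {Φ : OpenPartialHomeomorph P P}
    (hΦ : S.PreservesCoframe Φ) {p : P} (hp : p ∈ Φ.source) : u ∘ Φ =ᶠ[𝓝 p] u := by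
  filter_upwards [Φ.open_source.mem_nhds hp] with q hq using hu.2 Φ hΦ q hq

/-- The derivative of an invariant map along a vector field with invariant components. -/
theorem mvfderiv_frameField {u : P → W} (hu : S.IsInvariantMap u) {a : P → Fib n r}
    (ha : S.IsInvariantMap a) :
    S.IsInvariantMap (fun p => mvfderiv (𝓡 (n + r)) u p (frameField S.coframe a p)) :=
  ⟨hu.1.mvfderiv_apply (S.isCoframe.contMDiff_frameField ha.1), fun Φ hΦ p hp =>
    S.isCoframe.mvfderiv_frameField_of_map (hΦ.mdifferentiableAt hp) (hΦ.map_coframe hp)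
      (ha.2 Φ hΦ p hp) (hu.1.mdifferentiable (by simp) _) (hu.eventuallyEq hΦ hp)⟩

/-- The bracket of vector fields with invariant components. -/
theorem coframeBracket {a b : P → Fib n r} (ha : S.IsInvariantMap a) (hb : S.IsInvariantMap b) :
    S.IsInvariantMap (coframeBracket S.coframe a b) := by
  refine ⟨S.isCoframe.contMDiff_coframeBracket ha.1 hb.1, fun Φ hΦ p hp => ?_⟩
  refine S.isCoframe.coframeBracket_of_map
    ((hΦ.contMDiffOn p hp).contMDiffAt (Φ.open_source.mem_nhds hp)) ?_ ha.1 hb.1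
    (ha.eventuallyEq hΦ hp) (hb.eventuallyEq hΦ hp)
  filter_upwards [Φ.open_source.mem_nhds hp] with q hq using hΦ.map_coframe hq

end IsInvariantMap

theorem IsInvariantFunction.isInvariantMap [LieGroup (𝓡 r) ∞ G] [T2Space P] (hι : Injective ι)
    {f : P → ℝ} (hf : S.IsInvariantFunction f) : S.IsInvariantMap f :=
  ⟨hf.1, fun _ hΦ _ hp => hf.map_eq hι hΦ hp⟩

variable (S)

/-- Coordinates of `P` whose first components are invariant functions. -/
structure IsAdapted (e : OpenPartialHomeomorph P (Eu d × Eu (n + r - d))) (F : P → Eu d) : Prop where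
  isSmoothCoordinates : e.IsSmoothCoordinates (Eu (n + r))
  isInvariantMap : S.IsInvariantMap F
  fst_eq : ∀ p ∈ e.source, (e p).1 = F p
  exists_target_eq : ∃ (s₁ : Set (Eu d)) (s₂ : Set (Eu (n + r - d))), IsOpen s₁ ∧ IsOpen s₂ ∧
    Convex ℝ s₂ ∧ e.target = s₁ ×ˢ s₂

variable [LieGroup (𝓡 r) ∞ G] [T2Space P]

/-- Invariant functions with independent differentials at `p₀` are completed by a linear projection
to a local diffeomorphism. Shrinking the target to a product of balls makes the fibres connected. -/
theorem exists_isAdapted (hι : Injective ι) (hS : S.IsFullyRegular d) (p₀ : P) :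
    d ≤ n + r ∧ ∃ (e : OpenPartialHomeomorph P (Eu d × Eu (n + r - d))) (F : P → Eu d),
      p₀ ∈ e.source ∧ S.IsAdapted e F := by
  let D : Submodule ℝ (Eu (n + r) →L[ℝ] ℝ) := S.invariantDifferentials p₀
  have hD : Module.finrank ℝ D = d := hS p₀
  obtain ⟨l, hlD, hl⟩ := Submodule.exists_linearIndependent_of_finrank_eq hD
  have hsurj := surjective_pi_of_linearIndependent hl
  choose I hI hIb using hlD
  set F : P → Eu d := fun p => WithLp.toLp 2 (fun a => I a p) with hF
  have hFinv : S.IsInvariantMap F := by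
    refine ⟨?_, fun Φ hΦ p hp => ?_⟩
    · have h1 : ContMDiff (𝓡 (n + r)) 𝓘(ℝ, Fin d → ℝ) ∞ (fun p a => I a p) :=
        contMDiff_pi_space.2 fun a => (hI a).1
      exact (PiLp.continuousLinearEquiv 2 ℝ (fun _ : Fin d => ℝ)).symm.contDiff.contMDiff.comp h1
    · simp only [hF]
      congr 1
      funext a
      exact (hI a).map_eq hι hΦ hp
  set c := chartAt (Eu (n + r)) p₀
  have hc : c.IsSmoothCoordinates (Eu (n + r)) := OpenPartialHomeomorph.isSmoothCoordinates_chartAt p₀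
  have hp : p₀ ∈ c.source := mem_chart_source _ _
  have hFs : ContDiffOn ℝ ∞ (F ∘ c.symm) c.target := by
    rw [← contMDiffOn_iff_contDiffOn]
    exact hFinv.1.comp_contMDiffOn hc.contMDiffOn_symm
  set L := fderiv ℝ (F ∘ c.symm) (c p₀)
  have hFd : HasFDerivAt (F ∘ c.symm) L (c p₀) :=
    ((hFs.contDiffAt (c.open_target.mem_nhds (c.map_source hp))).differentiableAt
      (by simp)).hasFDerivAt
  have hL : Surjective L := by
    intro w
    obtain ⟨v, hv⟩ := hsurj (fun a => w a)
    refine ⟨mfderiv (𝓡 (n + r)) 𝓘(ℝ, Eu (n + r)) c p₀ v, ?_⟩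
    ext a
    have h1 : HasFDerivAt (fun y => (F ∘ c.symm) y a) ((EuclideanSpace.proj a : Eu d →L[ℝ] ℝ).comp L)
      (c p₀) := (EuclideanSpace.proj a : Eu d →L[ℝ] ℝ).hasFDerivAt.comp (c p₀) hFd
    have h2 := hc.mvfderiv_apply hp ((hI a).1.mdifferentiable (by simp) p₀) v
    have h3 : fderiv ℝ (I a ∘ c.symm) (c p₀) = (EuclideanSpace.proj a : Eu d →L[ℝ] ℝ).comp L :=
      h1.fderiv
    rw [h3] at h2
    refine h2.symm.trans ?_
    exact (congrArg (fun A => A v) (hIb a)).trans (congrFun hv a)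
  -- `pr` supplies the remaining `n + r - d` coordinates; `d ≤ n + r` comes from the surjectivity of
  -- `L`, so the subtraction is not truncated.
  obtain ⟨hdle, pr, A, hA⟩ := exists_complement_equiv L hL
  have hf' : HasFDerivAt (fun y => ((F ∘ c.symm) y, pr y))
      (A : Eu (n + r) →L[ℝ] Eu d × Eu (n + r - d)) (c p₀) := by
    rw [hA]
    exact hFd.prodMk pr.hasFDerivAt
  have hfs : ContDiffOn ℝ ∞ (fun y => ((F ∘ c.symm) y, pr y)) c.target :=
    hFs.prodMk pr.contDiff.contDiffOn
  obtain ⟨g, hg1, hg2, hg3, hg4⟩ := hfs.exists_localInverse c.open_target (c.map_source hp) hf'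
  have hg5 : ContDiffOn ℝ ∞ g g.source := by
    rw [hg3]
    exact hfs.mono hg2
  set e₁ := c.trans g
  have hpe : p₀ ∈ e₁.source := by
    simp only [e₁, OpenPartialHomeomorph.trans_source]
    exact ⟨hp, hg1⟩
  obtain ⟨ε, hε, hball⟩ := Metric.mem_nhds_iff.1 (e₁.open_target.mem_nhds (e₁.map_source hpe))
  set s₁ := Metric.ball (e₁ p₀).1 ε
  set s₂ := Metric.ball (e₁ p₀).2 ε
  have hs : s₁ ×ˢ s₂ ⊆ e₁.target := by
    rw [ball_prod_same]
    exact hball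
  have hso : IsOpen (s₁ ×ˢ s₂) := Metric.isOpen_ball.prod Metric.isOpen_ball
  set e := e₁.trans (OpenPartialHomeomorph.ofSet (s₁ ×ˢ s₂) hso) with he
  have hes : e.source ⊆ e₁.source := by
    rw [he, OpenPartialHomeomorph.trans_source]
    exact inter_subset_left
  have het : e.target = s₁ ×ˢ s₂ := by
    rw [he, OpenPartialHomeomorph.trans_target]
    exact inter_eq_left.2 hs
  refine ⟨hdle, e, F, ?_, ⟨?_, ?_⟩, hFinv, ?_, s₁, s₂, Metric.isOpen_ball, Metric.isOpen_ball,
    convex_ball _ _, het⟩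
  · rw [he, OpenPartialHomeomorph.trans_source]
    exact ⟨hpe, Metric.mem_ball_self hε, Metric.mem_ball_self hε⟩
  · intro p hp
    have hp' : p ∈ c.source ∩ c ⁻¹' g.source := hes hp
    have h1 : ContMDiffAt (𝓡 (n + r)) 𝓘(ℝ, Eu d × Eu (n + r - d)) ∞ (g ∘ c) p :=
      ContMDiffAt.comp p (hg5.contDiffAt (g.open_source.mem_nhds hp'.2)).contMDiffAt
        (hc.contMDiffAt hp'.1)
    exact h1.contMDiffWithinAt
  · intro y hy
    rw [het] at hy
    have hy' : y ∈ g.target ∩ g.symm ⁻¹' c.target := by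
      have := hs hy
      rwa [OpenPartialHomeomorph.trans_target] at this
    have h1 : ContMDiffAt 𝓘(ℝ, Eu d × Eu (n + r - d)) (𝓡 (n + r)) ∞ (c.symm ∘ g.symm) y :=
      ContMDiffAt.comp y (hc.contMDiffAt_symm hy'.2)
        (hg4.contDiffAt (g.open_target.mem_nhds hy'.1)).contMDiffAt
    exact h1.contMDiffWithinAt
  · intro p hp
    have hp' : p ∈ c.source ∩ c ⁻¹' g.source := hes hp
    change (g (c p)).1 = F p
    rw [hg3]
    simp only [comp_apply, c.left_inv hp'.1]

end GStructureWithConnection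

end GStr

/-! ### Invariants separate local equivalence classes. -/

namespace GStr

namespace GStructureWithConnection

variable {n r d : ℕ} {G : Type*} [Group G] [TopologicalSpace G] [ChartedSpace (Eu r) G]
  {ι : G →* (Eu n →L[ℝ] Eu n)ˣ}
  {P : Type*} [TopologicalSpace P] [ChartedSpace (Eu (n + r)) P] [IsManifold (𝓡 (n + r)) ∞ P]
  [MulAction Gᵐᵒᵖ P] {S : GStructureWithConnection r ι P}
  {W : Type*} [NormedAddCommGroup W] [NormedSpace ℝ W]
  {e : OpenPartialHomeomorph P (Eu d × Eu (n + r - d))} {F : P → Eu d}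

namespace IsAdapted

variable (he : S.IsAdapted e F)
include he

theorem apply_symm {y : Eu d × Eu (n + r - d)} (hy : y ∈ e.target) : F (e.symm y) = y.1 := by
  rw [← he.fst_eq _ (e.map_target hy), e.right_inv hy]

theorem mvfderiv_apply {p : P} (hp : p ∈ e.source) (ξ : TangentSpace (𝓡 (n + r)) p) :
    mvfderiv (𝓡 (n + r)) F p ξ =
      (show Eu d × Eu (n + r - d) from
        mfderiv (𝓡 (n + r)) 𝓘(ℝ, Eu d × Eu (n + r - d)) e p ξ).1 := by
  rw [he.isSmoothCoordinates.mvfderiv_apply hp (he.isInvariantMap.1.mdifferentiable (by simp) p)]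
  have h1 : F ∘ e.symm =ᶠ[𝓝 (e p)] Prod.fst := by
    filter_upwards [e.open_target.mem_nhds (e.map_source hp)] with y hy using he.apply_symm hy
  rw [h1.fderiv_eq, fderiv_fst]
  rfl

theorem mvfderiv_apply_coord {p : P} (hp : p ∈ e.source) (ξ : TangentSpace (𝓡 (n + r)) p)
    (a : Fin d) : mvfderiv (𝓡 (n + r)) (fun q => F q a) p ξ =
      (show Eu d × Eu (n + r - d) from
        mfderiv (𝓡 (n + r)) 𝓘(ℝ, Eu d × Eu (n + r - d)) e p ξ).1 a := by
  have hF := he.isInvariantMap.1.mdifferentiable (by simp) p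
  have h1 := ((EuclideanSpace.proj a : Eu d →L[ℝ] ℝ).hasMFDerivAt (x := F p)).comp p hF.hasMFDerivAt
  refine (congrArg (fun A => A ξ) h1.mfderiv).trans ?_
  exact congrArg (EuclideanSpace.proj a : Eu d →L[ℝ] ℝ) (he.mvfderiv_apply hp ξ)

/-- At every point of the coordinate domain the components of `F` have `d` independent
differentials. By full regularity these span all differentials of invariant functions. -/
theorem mvfderiv_eq_zero (hS : S.IsFullyRegular d) {f : P → ℝ} (hf : S.IsInvariantFunction f)
    {p : P} (hp : p ∈ e.source) {ξ : TangentSpace (𝓡 (n + r)) p}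
    (hξ : (show Eu d × Eu (n + r - d) from
        mfderiv (𝓡 (n + r)) 𝓘(ℝ, Eu d × Eu (n + r - d)) e p ξ).1 = 0) :
    mvfderiv (𝓡 (n + r)) f p ξ = 0 := by
  let D : Submodule ℝ (Eu (n + r) →L[ℝ] ℝ) := S.invariantDifferentials p
  have hD : Module.finrank ℝ D = d := hS p
  refine apply_eq_zero_of_surjective_pi hD
    (l := fun a => mvfderiv (𝓡 (n + r)) (fun q => F q a) p) (fun a => ?_) ?_ (m := mvfderiv (𝓡 (n + r)) f p)
    ⟨f, hf, rfl⟩ (v := ξ) (fun a => ?_)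
  · exact ⟨_, (he.isInvariantMap.comp (φ := fun z : Eu d => z a)
      (EuclideanSpace.proj a : Eu d →L[ℝ] ℝ).contDiff).isInvariantFunction, rfl⟩
  · intro c
    have h1 := he.isSmoothCoordinates.mfderiv_apply_symm (e.map_source hp)
      ((WithLp.toLp 2 c, 0) : Eu d × Eu (n + r - d))
    rw [e.left_inv hp] at h1
    refine ⟨mfderiv 𝓘(ℝ, Eu d × Eu (n + r - d)) (𝓡 (n + r)) e.symm (e p)
      ((WithLp.toLp 2 c, 0) : Eu d × Eu (n + r - d)), funext fun a => ?_⟩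
    refine (he.mvfderiv_apply_coord hp _ a).trans ?_
    exact congrArg (fun w : Eu d × Eu (n + r - d) => w.1 a) h1
  · exact (he.mvfderiv_apply_coord hp ξ a).trans (congrArg (fun w : Eu d => w a) hξ)

/-- Invariant maps depend on the first components of adapted coordinates only. -/
theorem eq_of_eq (hS : S.IsFullyRegular d) {u : P → W} (hu : S.IsInvariantMap u) {p q : P}
    (hp : p ∈ e.source) (hq : q ∈ e.source) (h : F p = F q) : u p = u q := by
  rw [SeparatingDual.eq_iff_forall_dual_eq (R := ℝ)]
  intro l
  set f : P → ℝ := fun p => l (u p)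
  have hf : S.IsInvariantMap f := hu.comp l.contDiff
  obtain ⟨s₁, s₂, hs₁, hs₂, hconv, ht⟩ := he.exists_target_eq
  have hmem : ∀ p ∈ e.source, (F p, (e p).2) = e p := fun p hp =>
    Prod.ext (he.fst_eq p hp).symm rfl
  have hp' := e.map_source hp
  have hq' := e.map_source hq
  rw [ht] at hp' hq'
  have hF1 : F p ∈ s₁ := he.fst_eq p hp ▸ hp'.1
  -- Along a fibre the derivative of an invariant function vanishes, and the fibre `s₂` is
  -- connected.
  have hd : ∀ y ∈ s₂, HasFDerivAt (fun y => f (e.symm (F p, y))) (0 : Eu (n + r - d) →L[ℝ] ℝ) y := by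
    intro y hy
    have hy' : (F p, y) ∈ e.target := ht ▸ ⟨hF1, hy⟩
    have h1 : MDifferentiableAt 𝓘(ℝ, Eu d × Eu (n + r - d)) 𝓘(ℝ, ℝ) (f ∘ e.symm) (F p, y) :=
      MDifferentiableAt.comp _ (hf.1.mdifferentiable (by simp) _)
        (he.isSmoothCoordinates.mdifferentiableAt_symm hy')
    have h2 : HasFDerivAt (fun y => f (e.symm (F p, y))) _ y :=
      h1.differentiableAt.hasFDerivAt.comp y (hasFDerivAt_prodMk_right (F p) y)
    suffices h0 : (fderiv ℝ (f ∘ e.symm) (F p, y)).comp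
        (ContinuousLinearMap.inr ℝ (Eu d) (Eu (n + r - d))) = 0 by
      rw [h0] at h2
      exact h2
    refine ContinuousLinearMap.ext fun w => ?_
    have h3 := he.isSmoothCoordinates.mvfderiv_apply (e.map_target hy')
      (hf.1.mdifferentiable (by simp) (e.symm (F p, y)))
      (mfderiv 𝓘(ℝ, Eu d × Eu (n + r - d)) (𝓡 (n + r)) e.symm (F p, y)
        ((0, w) : Eu d × Eu (n + r - d)))
    have h4 := he.isSmoothCoordinates.mfderiv_apply_symm hy' ((0, w) : Eu d × Eu (n + r - d))
    have h5 := he.mvfderiv_eq_zero hS hf.isInvariantFunction (e.map_target hy')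
      (ξ := mfderiv 𝓘(ℝ, Eu d × Eu (n + r - d)) (𝓡 (n + r)) e.symm (F p, y)
        ((0, w) : Eu d × Eu (n + r - d))) (congrArg Prod.fst h4)
    rw [h5, e.right_inv hy'] at h3
    exact (h3.trans (congrArg (fderiv ℝ (f ∘ e.symm) (F p, y)) h4)).symm
  have h1 := hs₂.is_const_of_fderiv_eq_zero hconv.isPreconnected
    (fun y hy => (hd y hy).differentiableAt.differentiableWithinAt)
    (fun y hy => (hd y hy).fderiv) hp'.2 hq'.2
  rw [hmem p hp, e.left_inv hp, h, hmem q hq, e.left_inv hq] at h1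
  exact h1

/-- Points with the same first components in adapted coordinates are locally equivalent. -/
theorem exists_preservesCoframe (hS : S.IsFullyRegular d) {p q : P} (hp : p ∈ e.source)
    (hq : q ∈ e.source) (h : F p = F q) :
    ∃ Φ : OpenPartialHomeomorph P P, S.PreservesCoframe Φ ∧ p ∈ Φ.source ∧ Φ p = q := by
  obtain ⟨s₁, s₂, hs₁, hs₂, hconv, ht⟩ := he.exists_target_eq
  have hc := he.isSmoothCoordinates
  have hH := S.isCoframe
  have hmem : ∀ p ∈ e.source, (F p, (e p).2) = e p := fun p hp =>
    Prod.ext (he.fst_eq p hp).symm rfl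
  have hp' := e.map_source hp
  have hq' := e.map_source hq
  rw [ht] at hp' hq'
  have hconst : ∀ {W : Type} [NormedAddCommGroup W] [NormedSpace ℝ W] {u : P → W},
      S.IsInvariantMap u → ∀ z ∈ s₁, ∀ y ∈ s₂, ∀ y' ∈ s₂, u (e.symm (z, y)) = u (e.symm (z, y')) := by
    intro W _ _ u hu z hz y hy y' hy'
    have h1 : (z, y) ∈ e.target := ht ▸ ⟨hz, hy⟩
    have h2 : (z, y') ∈ e.target := ht ▸ ⟨hz, hy'⟩
    exact he.eq_of_eq hS hu (e.map_target h1) (e.map_target h2)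
      ((he.apply_symm h1).trans (he.apply_symm h2).symm)
  have hY := hH.contDiffOn_frameCoord hc
  have hB := hH.contDiffOn_coframeCoord hc
  rw [ht] at hY hB
  -- Both hypotheses on dependence on `z` alone follow from `hconst`: the first components of the
  -- frame are derivatives of `F` along frame fields with constant components, and `T` consists of
  -- the brackets of such fields.
  obtain ⟨Ψ, hΨ1, hΨ2, hΨ3, hΨ4, hΨ5, hΨ6, hΨ7⟩ := exists_coframe_symmetry hs₁ hs₂ hY hB
    (fun y hy w => hH.frameCoord_coframeCoord hc (ht ▸ hy) w)
    (fun y hy w => hH.coframeCoord_frameCoord hc (ht ▸ hy) w)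
    (fun z hz y hy y' hy' v => by
      have h1 : ∀ y ∈ s₂, (frameCoord e S.coframe (z, y) v).1 =
          mvfderiv (𝓡 (n + r)) F (e.symm (z, y)) (frameField S.coframe (fun _ => v) (e.symm (z, y))) :=
        fun y hy => (he.mvfderiv_apply (e.map_target (ht ▸ ⟨hz, hy⟩)) _).symm
      rw [h1 y hy, h1 y' hy']
      exact hconst (he.isInvariantMap.mvfderiv_frameField (IsInvariantMap.const v)) z hz y hy y' hy')
    (T := fun y v w => coframeBracket S.coframe (fun _ => v) (fun _ => w) (e.symm y))
    (fun y hy v w => hH.fderiv_frameCoord_sub hc (ht ▸ hy) v w)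
    (fun z hz y hy y' hy' v w => hconst
      ((IsInvariantMap.const v).coframeBracket (IsInvariantMap.const w)) z hz y hy y' hy')
    (z₀ := F p) (he.fst_eq p hp ▸ hp'.1) hp'.2 hq'.2
  rw [hmem p hp] at hΨ1
  rw [hmem p hp, h, hmem q hq] at hΨ4
  rw [← ht] at hΨ2 hΨ3
  have hΨs : ∀ x ∈ e.source, e x ∈ Ψ.source → x ∈ (e.trans (Ψ.trans e.symm)).source := by
    intro x hx hx'
    simp only [OpenPartialHomeomorph.trans_source]
    exact ⟨hx, hx', hΨ3 (Ψ.map_source hx')⟩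
  refine ⟨e.trans (Ψ.trans e.symm), preservesCoframe_of_map_coframe ?_ ?_ ?_, hΨs p hp hΨ1, ?_⟩
  · intro x hx
    have hx' : x ∈ e.source ∩ e ⁻¹' (Ψ.source ∩ Ψ ⁻¹' e.target) := hx
    have h1 : ContMDiffAt (𝓡 (n + r)) (𝓡 (n + r)) ∞ (e.symm ∘ Ψ ∘ e) x :=
      ContMDiffAt.comp x (hc.contMDiffAt_symm hx'.2.2) (ContMDiffAt.comp x
        (hΨ5.contDiffAt (Ψ.open_source.mem_nhds hx'.2.1)).contMDiffAt (hc.contMDiffAt hx'.1))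
    exact h1.contMDiffWithinAt
  · intro x hx
    have hx1 : x ∈ e.source ∧ e x ∈ Ψ.target ∧ Ψ.symm (e x) ∈ e.target := by
      simp only [OpenPartialHomeomorph.trans_target, OpenPartialHomeomorph.symm_target,
        OpenPartialHomeomorph.trans_symm_eq_symm_trans_symm, OpenPartialHomeomorph.symm_symm] at hx
      exact ⟨hx.1.1, hx.1.2, hx.2⟩
    have h1 : ContMDiffAt (𝓡 (n + r)) (𝓡 (n + r)) ∞ (e.symm ∘ Ψ.symm ∘ e) x :=
      ContMDiffAt.comp x (hc.contMDiffAt_symm hx1.2.2) (ContMDiffAt.comp x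
        (hΨ6.contDiffAt (Ψ.open_target.mem_nhds hx1.2.1)).contMDiffAt (hc.contMDiffAt hx1.1))
    exact h1.contMDiffWithinAt
  · intro x hx ξ
    have hx' : x ∈ e.source ∩ e ⁻¹' (Ψ.source ∩ Ψ ⁻¹' e.target) := hx
    have h1 := hc.mdifferentiableAt hx'.1
    have h2 := (hΨ7 _ hx'.2.1).differentiableAt.mdifferentiableAt
    have h3 := hc.mdifferentiableAt_symm hx'.2.2
    have h4 := mfderiv_comp_apply x (g := e.symm) (f := Ψ ∘ e) h3 (h2.comp x h1) ξ
    have h5 := mfderiv_comp_apply x h2 h1 ξ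
    rw [mfderiv_eq_fderiv, (hΨ7 _ hx'.2.1).fderiv] at h5
    have h6 : S.coframe (e.symm (Ψ (e x))) (mfderiv (𝓡 (n + r)) (𝓡 (n + r))
        (e.symm ∘ (Ψ ∘ e)) x ξ) = coframeCoord e S.coframe (Ψ (e x))
          (frameCoord e S.coframe (Ψ (e x)) (coframeCoord e S.coframe (e x)
            (mfderiv (𝓡 (n + r)) 𝓘(ℝ, Eu d × Eu (n + r - d)) e x ξ))) :=
      (congrArg (S.coframe (e.symm (Ψ (e x)))) h4).trans (congrArg (coframeCoord e S.coframe (Ψ (e x))) h5)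
    refine h6.trans ((hH.coframeCoord_frameCoord hc hx'.2.2 _).trans ?_)
    refine (congrArg (S.coframe (e.symm (e x))) (hc.mfderiv_symm_apply hx'.1 ξ)).trans ?_
    exact S.coframe_congr (e.left_inv hx'.1) ξ
  · change e.symm (Ψ (e p)) = q
    rw [hΨ4, e.left_inv hq]

end IsAdapted

end GStructureWithConnection

end GStr

/-! ### The smooth structure on the quotient X. -/

namespace GStr

namespace GStructureWithConnection

variable {n r d : ℕ} {G : Type*} [Group G] [TopologicalSpace G] [ChartedSpace (Eu r) G]
  {ι : G →* (Eu n →L[ℝ] Eu n)ˣ}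
  {P : Type*} [TopologicalSpace P] [ChartedSpace (Eu (n + r)) P] [IsManifold (𝓡 (n + r)) ∞ P]
  [MulAction Gᵐᵒᵖ P] {S : GStructureWithConnection r ι P}
  {W : Type*} [NormedAddCommGroup W] [NormedSpace ℝ W]

theorem h_eq_iff {p q : P} : S.h p = S.h q ↔
    ∃ Φ : OpenPartialHomeomorph P P, S.PreservesCoframe Φ ∧ p ∈ Φ.source ∧ Φ p = q :=
  Quotient.eq (r := S.localEquivalence)

theorem PreservesCoframe.h_map {Φ : OpenPartialHomeomorph P P} (hΦ : S.PreservesCoframe Φ) {p : P}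
    (hp : p ∈ Φ.source) : S.h (Φ p) = S.h p :=
  (h_eq_iff.2 ⟨Φ, hΦ, hp, rfl⟩).symm

variable (S) in
theorem surjective_h : Surjective S.h := Quotient.mk_surjective

variable (S) in
theorem continuous_h : Continuous S.h := continuous_quotient_mk'

-- A point equivalent to a point of `U` has a neighbourhood consisting of images of points of `U`
-- under one symmetry.
variable (S) in
theorem isOpenMap_h : IsOpenMap S.h := by
  intro U hU
  have hX : Topology.IsQuotientMap S.h := isQuotientMap_quotient_mk'
  rw [← hX.isOpen_preimage, isOpen_iff_mem_nhds]
  rintro q ⟨p, hp, hpq⟩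
  obtain ⟨Φ, hΦ, hpΦ, rfl⟩ := h_eq_iff.1 hpq
  have h1 : IsOpen (Φ '' (Φ.source ∩ U)) := Φ.isOpen_image_source_inter hU
  refine Filter.mem_of_superset (h1.mem_nhds ⟨p, ⟨hpΦ, hp⟩, rfl⟩) ?_
  rintro _ ⟨x, hx, rfl⟩
  exact ⟨x, hx.2, (hΦ.h_map hx.1).symm⟩

namespace IsInvariantMap

/-- The map on `P / ∼` induced by an invariant map. -/
noncomputable def descend {u : P → W} (hu : S.IsInvariantMap u) : S.X → W :=
  Quotient.lift u (by
    rintro p _ ⟨Φ, hΦ, hp, rfl⟩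
    exact (hu.2 Φ hΦ p hp).symm)

theorem continuous_descend {u : P → W} (hu : S.IsInvariantMap u) : Continuous hu.descend :=
  hu.1.continuous.quotient_lift _

end IsInvariantMap

variable {e : OpenPartialHomeomorph P (Eu d × Eu (n + r - d))} {F : P → Eu d}

/-- The chart of `P / ∼` given by the first components of adapted coordinates around `p₀`. -/
noncomputable def IsAdapted.quotientChart (he : S.IsAdapted e F) (hS : S.IsFullyRegular d) {p₀ : P}
    (hp₀ : p₀ ∈ e.source) : OpenPartialHomeomorph S.X (Eu d) := by
  have ht : ∀ z ∈ Prod.fst '' e.target, (z, (e p₀).2) ∈ e.target := by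
    obtain ⟨s₁, s₂, -, -, -, ht⟩ := he.exists_target_eq
    have hp' := e.map_source hp₀
    rw [ht] at hp' ⊢
    rintro _ ⟨y, hy, rfl⟩
    exact ⟨hy.1, hp'.2⟩
  exact
  { toFun := he.isInvariantMap.descend
    invFun := fun z => S.h (e.symm (z, (e p₀).2))
    source := S.h '' e.source
    target := Prod.fst '' e.target
    map_source' := by
      rintro _ ⟨p, hp, rfl⟩
      exact ⟨e p, e.map_source hp, he.fst_eq p hp⟩
    map_target' := fun z hz => mem_image_of_mem _ (e.map_target (ht z hz))
    -- This is the injectivity of the chart: points with equal invariants are equivalent, by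
    -- `exists_preservesCoframe`.
    left_inv' := by
      rintro _ ⟨p, hp, rfl⟩
      have hz := ht (F p) ⟨e p, e.map_source hp, he.fst_eq p hp⟩
      exact h_eq_iff.2 (he.exists_preservesCoframe hS (e.map_target hz) hp (he.apply_symm hz))
    right_inv' := fun z hz => he.apply_symm (ht z hz)
    open_source := S.isOpenMap_h _ e.open_source
    open_target := isOpenMap_fst _ e.open_target
    continuousOn_toFun := he.isInvariantMap.continuous_descend.continuousOn
    continuousOn_invFun := S.continuous_h.comp_continuousOn
      (e.continuousOn_symm.comp (by fun_prop) ht) }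

/-- In the quotient chart a descended map is the original map on the slice through `p₀` with
constant second coordinate. -/
theorem IsAdapted.contDiffOn_quotientChart_symm (he : S.IsAdapted e F) (hS : S.IsFullyRegular d)
    {p₀ : P} (hp₀ : p₀ ∈ e.source) {u : P → W} (hu : S.IsInvariantMap u) :
    ContDiffOn ℝ ∞ (hu.descend ∘ (he.quotientChart hS hp₀).symm)
      (he.quotientChart hS hp₀).target := by
  rintro z ⟨y, hy, rfl⟩
  have hy' : (y.1, (e p₀).2) ∈ e.target := by
    obtain ⟨s₁, s₂, -, -, -, ht⟩ := he.exists_target_eq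
    have hp' := e.map_source hp₀
    rw [ht] at hp' hy ⊢
    exact ⟨hy.1, hp'.2⟩
  have h1 : ContMDiffAt 𝓘(ℝ, Eu d × Eu (n + r - d)) 𝓘(ℝ, W) ∞ (u ∘ e.symm) (y.1, (e p₀).2) :=
    ContMDiffAt.comp _ (hu.1 _) (he.isSmoothCoordinates.contMDiffAt_symm hy')
  exact (h1.contDiffAt.comp y.1
    (contDiff_id.prodMk contDiff_const : ContDiff ℝ ∞ fun z : Eu d => (z, (e p₀).2)).contDiffAt
    ).contDiffWithinAt

variable [LieGroup (𝓡 r) ∞ G] [T2Space P]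

theorem exists_smooth_structure (hι : Injective ι) (hS : S.IsFullyRegular d) :
    ∃ _ : ChartedSpace (Eu d) S.X, IsManifold (𝓡 d) ∞ S.X ∧
      Manifold.IsSubmersion (𝓡 (n + r)) (𝓡 d) ∞ S.h := by
  choose hd e F hp he using exists_isAdapted (S := S) hι hS
  let c : ChartedSpace (Eu d) S.X :=
    { atlas := range fun p => (he p).quotientChart hS (hp p)
      chartAt := fun x => (he x.out).quotientChart hS (hp x.out)
      mem_chart_source := fun x => ⟨x.out, hp x.out, x.out_eq⟩
      chart_mem_atlas := fun x => mem_range_self _ }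
  have hm : IsManifold (𝓡 d) ∞ S.X := by
    refine isManifold_of_contDiffOn (𝓡 d) ∞ S.X ?_
    rintro _ _ ⟨p, rfl⟩ ⟨q, rfl⟩
    -- A chart of X is itself the descent of an invariant map, so transition maps are covered by the
    -- same lemma.
    exact ((he p).contDiffOn_quotientChart_symm hS (hp p) (he q).isInvariantMap).mono
      fun z hz => hz.1.1
  refine ⟨c, hm, Manifold.IsSubmersionOfComplement.isSubmersion (F := Eu (n + r - d)) fun p => ?_⟩
  -- The adapted coordinates are transported to the model space of P; in the resulting pair of
  -- charts `h` is the first projection.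
  let L : (Eu d × Eu (n + r - d)) ≃L[ℝ] Eu (n + r) := ContinuousLinearEquiv.ofFinrankEq (by
    have := hd p
    simp
    omega)
  have hes := (he p).isSmoothCoordinates
  refine Manifold.IsSubmersionAtOfComplement.mk_of_charts L.symm
    ((e p).transHomeomorph L.toHomeomorph) ((he p).quotientChart hS (hp p)) (hp p)
    ⟨p, hp p, rfl⟩ ?_ (IsManifold.subset_maximalAtlas ⟨p, rfl⟩) (fun q hq => ⟨q, hq, rfl⟩) ?_
  · refine OpenPartialHomeomorph.mem_maximalAtlas_of_contMDiffOn _ ?_ ?_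
    · exact L.contDiff.contMDiff.comp_contMDiffOn hes.contMDiffOn
    · exact hes.contMDiffOn_symm.comp L.symm.contDiff.contMDiff.contMDiffOn fun y hy => hy
  · intro y hy
    exact (he p).apply_symm (hy.2 : L.symm y ∈ (e p).target)

end GStructureWithConnection

end GStr

/-! ### Local sections of submersions and descent of smoothness. -/

section Submersion

variable {E E' : Type*} [NormedAddCommGroup E] [NormedSpace ℝ E]
  [NormedAddCommGroup E'] [NormedSpace ℝ E']
  {M : Type*} [TopologicalSpace M] [ChartedSpace E M] [IsManifold 𝓘(ℝ, E) ∞ M]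
  {N : Type*} [TopologicalSpace N] [ChartedSpace E' N] [IsManifold 𝓘(ℝ, E') ∞ N]
  {f : M → N}

/-- A submersion has a local section through every point. -/
theorem Manifold.IsSubmersion.exists_localSection (hf : Manifold.IsSubmersion 𝓘(ℝ, E) 𝓘(ℝ, E') ∞ f)
    (p : M) : ∃ s : N → M, ContMDiffAt 𝓘(ℝ, E') 𝓘(ℝ, E) ∞ s (f p) ∧ s (f p) = p ∧
      ∀ᶠ x in 𝓝 (f p), f (s x) = x := by
  have h := hf.isSubmersionAt p
  set a := h.domChart
  set b := h.codChart
  set L := h.equiv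
  have hpa : p ∈ a.source := h.mem_domChart_source
  have hpb : f p ∈ b.source := h.mem_codChart_source
  have ha := (IsManifold.mem_maximalAtlas_iff_contMDiffOn a).1 h.domChart_mem_maximalAtlas
  have hb := (IsManifold.mem_maximalAtlas_iff_contMDiffOn b).1 h.codChart_mem_maximalAtlas
  have hw : ∀ y ∈ a.target, b (f (a.symm y)) = (L y).1 := fun y hy =>
    h.writtenInCharts (by simpa using hy)
  have hbp : b (f p) = (L (a p)).1 := by
    rw [← hw _ (a.map_source hpa), a.left_inv hpa]
  have hLp : L.symm (b (f p), (L (a p)).2) = a p := by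
    rw [hbp]
    exact L.symm_apply_apply _
  have h1 : ContMDiffAt 𝓘(ℝ, E') 𝓘(ℝ, E) ∞ (fun x => L.symm (b x, (L (a p)).2)) (f p) := by
    have hb' := hb.1.contMDiffAt (b.open_source.mem_nhds hpb)
    exact L.symm.contDiff.contMDiff.contMDiffAt.comp (f p) (hb'.prodMk_space contMDiffAt_const)
  have h2 : ∀ᶠ x in 𝓝 (f p), L.symm (b x, (L (a p)).2) ∈ a.target := by
    refine h1.continuousAt.eventually_mem (a.open_target.mem_nhds ?_)
    rw [hLp]
    exact a.map_source hpa
  refine ⟨fun x => a.symm (L.symm (b x, (L (a p)).2)), ?_, ?_, ?_⟩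
  · refine ContMDiffAt.comp (f p) (ha.2.contMDiffAt (a.open_target.mem_nhds h2.self_of_nhds)) h1
  · simp only [hLp, a.left_inv hpa]
  · filter_upwards [h2, b.open_source.mem_nhds hpb] with x hx hx'
    refine b.injOn (h.source_subset_preimage_source (a.map_target hx)) hx' ?_
    rw [hw _ hx, L.apply_symm_apply]

/-- A map is smooth if its composition with a surjective submersion is smooth. -/
theorem Manifold.IsSubmersion.contMDiff_of_comp {E'' H'' : Type*} [NormedAddCommGroup E'']
    [NormedSpace ℝ E''] [TopologicalSpace H''] {J : ModelWithCorners ℝ E'' H''}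
    {N' : Type*} [TopologicalSpace N'] [ChartedSpace H'' N']
    (hf : Manifold.IsSubmersion 𝓘(ℝ, E) 𝓘(ℝ, E') ∞ f) (hs : Surjective f) {g : N → N'}
    (hg : ContMDiff 𝓘(ℝ, E) J ∞ (g ∘ f)) : ContMDiff 𝓘(ℝ, E') J ∞ g := by
  intro x
  obtain ⟨p, rfl⟩ := hs x
  obtain ⟨s, hs1, hs2, hs3⟩ := hf.exists_localSection p
  refine (hg.contMDiffAt.comp (f p) hs1).congr_of_eventuallyEq ?_
  filter_upwards [hs3] with x hx
  simp [hx]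

end Submersion

/-! ### Brackets of related vector fields. -/

section Related

variable {E E' : Type*} [NormedAddCommGroup E] [NormedSpace ℝ E] [CompleteSpace E]
  [NormedAddCommGroup E'] [NormedSpace ℝ E'] [CompleteSpace E']
  {M : Type*} [TopologicalSpace M] [ChartedSpace E M] [IsManifold 𝓘(ℝ, E) ∞ M]
  {N : Type*} [TopologicalSpace N] [ChartedSpace E' N] [IsManifold 𝓘(ℝ, E') ∞ N]
  {f : M → N} {p : M}

/-- The Lie bracket of vector fields related by a smooth map. -/
theorem VectorField.mfderiv_mlieBracket_of_related
    {V W : Π x : M, TangentSpace 𝓘(ℝ, E) x} {V' W' : Π x : N, TangentSpace 𝓘(ℝ, E') x}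
    (hf : ContMDiff 𝓘(ℝ, E) 𝓘(ℝ, E') ∞ f)
    (hV : MDifferentiableAt 𝓘(ℝ, E) 𝓘(ℝ, E).tangent (fun x => (⟨x, V x⟩ : TangentBundle 𝓘(ℝ, E) M)) p)
    (hW : MDifferentiableAt 𝓘(ℝ, E) 𝓘(ℝ, E).tangent (fun x => (⟨x, W x⟩ : TangentBundle 𝓘(ℝ, E) M)) p)
    (hV' : MDifferentiableAt 𝓘(ℝ, E') 𝓘(ℝ, E').tangent
      (fun x => (⟨x, V' x⟩ : TangentBundle 𝓘(ℝ, E') N)) (f p))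
    (hW' : MDifferentiableAt 𝓘(ℝ, E') 𝓘(ℝ, E').tangent
      (fun x => (⟨x, W' x⟩ : TangentBundle 𝓘(ℝ, E') N)) (f p))
    (hVV' : ∀ q, mfderiv 𝓘(ℝ, E) 𝓘(ℝ, E') f q (V q) = V' (f q))
    (hWW' : ∀ q, mfderiv 𝓘(ℝ, E) 𝓘(ℝ, E') f q (W q) = W' (f q)) :
    mfderiv 𝓘(ℝ, E) 𝓘(ℝ, E') f p (mlieBracket 𝓘(ℝ, E) V W p) =
      mlieBracket 𝓘(ℝ, E') V' W' (f p) := by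
  have hp := mem_chart_source E' (f p)
  set e := chartAt E' (f p)
  have he : e.IsSmoothCoordinates E' := OpenPartialHomeomorph.isSmoothCoordinates_chartAt (f p)
  have hef : ContMDiffAt 𝓘(ℝ, E) 𝓘(ℝ, E') ∞ (e ∘ f) p := (he.contMDiffAt hp).comp p hf.contMDiffAt
  have hfd := hf.mdifferentiable (by simp)
  have hnhds : ∀ᶠ q in 𝓝 p, f q ∈ e.source :=
    hf.continuous.continuousAt.eventually_mem (e.open_source.mem_nhds hp)
  -- Since `f` need not be a diffeomorphism, pullback is not available. The bracket on `M` is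
  -- instead applied as a commutator of derivations to the vector-valued function `e ∘ f`, and the
  -- result is compared with the coordinate bracket on `N`.
  have key : ∀ (U : Π x : M, TangentSpace 𝓘(ℝ, E) x) (U' : Π x : N, TangentSpace 𝓘(ℝ, E') x),
      (∀ q, mfderiv 𝓘(ℝ, E) 𝓘(ℝ, E') f q (U q) = U' (f q)) → ∀ q, f q ∈ e.source →
      mvfderiv 𝓘(ℝ, E) (e ∘ f) q (U q) = e.pushforward U' (e (f q)) := by
    intro U U' hU q hq
    rw [e.pushforward_apply hq, ← hU q]
    exact mfderiv_comp_apply q (he.mdifferentiableAt hq) (hfd q) (U q)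
  have key' : ∀ (U : Π x : M, TangentSpace 𝓘(ℝ, E) x) (U' : Π x : N, TangentSpace 𝓘(ℝ, E') x),
      (∀ q, mfderiv 𝓘(ℝ, E) 𝓘(ℝ, E') f q (U q) = U' (f q)) →
      MDifferentiableAt 𝓘(ℝ, E') 𝓘(ℝ, E').tangent
        (fun x => (⟨x, U' x⟩ : TangentBundle 𝓘(ℝ, E') N)) (f p) → ∀ ξ : TangentSpace 𝓘(ℝ, E) p,
      mvfderiv 𝓘(ℝ, E) (fun q => mvfderiv 𝓘(ℝ, E) (e ∘ f) q (U q)) p ξ =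
        fderiv ℝ (e.pushforward U') (e (f p)) (mvfderiv 𝓘(ℝ, E) (e ∘ f) p ξ) := by
    intro U U' hU hU' ξ
    have h1 : (fun q => mvfderiv 𝓘(ℝ, E) (e ∘ f) q (U q)) =ᶠ[𝓝 p]
        e.pushforward U' ∘ (e ∘ f) := by
      filter_upwards [hnhds] with q hq using key U U' hU q hq
    have h2 := (he.differentiableAt_pushforward hp hU').mdifferentiableAt
    have h3 := mfderiv_comp_apply p h2 (hef.mdifferentiableAt (by simp)) ξ
    rw [mfderiv_eq_fderiv] at h3
    exact (congrArg (fun A : E →L[ℝ] E' => A ξ) h1.mfderiv_eq).trans h3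
  have h1 := mvfderiv_mlieBracket hV hW
    (hef.of_le (WithTop.coe_le_coe.2 (le_top : (2 : ℕ∞) ≤ ⊤)))
  rw [key' V V' hVV' hV', key' W W' hWW' hW', key V V' hVV' p hp, key W W' hWW' p hp] at h1
  have h2 := he.mfderiv_mlieBracket hp hV' hW'
  have h3 := mfderiv_comp_apply p (he.mdifferentiableAt hp) (hfd p) (mlieBracket 𝓘(ℝ, E) V W p)
  have h4 : mfderiv 𝓘(ℝ, E') 𝓘(ℝ, E') e (f p) (mfderiv 𝓘(ℝ, E) 𝓘(ℝ, E') f p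
      (mlieBracket 𝓘(ℝ, E) V W p)) = mfderiv 𝓘(ℝ, E') 𝓘(ℝ, E') e (f p)
        (mlieBracket 𝓘(ℝ, E') V' W' (f p)) := h3.symm.trans (h1.trans h2.symm)
  rw [← he.mfderiv_symm_apply hp (mlieBracket 𝓘(ℝ, E') V' W' (f p)), ← h4,
    he.mfderiv_symm_apply hp]

end Related

/-! ### Forms, sections and bundle maps on a trivial bundle. -/

section Trivial

variable {E : Type*} [NormedAddCommGroup E] [NormedSpace ℝ E]
  {M : Type*} [TopologicalSpace M] [ChartedSpace E M]
  {F F' : Type*} [NormedAddCommGroup F] [NormedSpace ℝ F] [NormedAddCommGroup F'] [NormedSpace ℝ F']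

theorem Bundle.Trivial.symmL_trivializationAt_prod (x₀ x : M) (v : F × F') :
    (trivializationAt (F × F') (Bundle.Trivial M (F × F')) x₀).symmL ℝ x v = v :=
  (Bundle.Trivialization.symmL_apply
    (trivializationAt (F × F') (Bundle.Trivial M (F × F')) x₀) ⟨mem_univ x, mem_univ x⟩ v).trans
    ((trivializationAt (F × F') (Bundle.Trivial M (F × F')) x₀).symm_apply_apply_mk
      (b := x) ⟨mem_univ x, mem_univ x⟩ v)

theorem Bundle.Trivial.mem_forms_prod_iff {k : ℕ}
    {η : Π x : M, Bundle.Trivial M (F × F') x [⋀^Fin k]→L[ℝ] ℝ} :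
    η ∈ GStr.forms 𝓘(ℝ, E) (F × F') (Bundle.Trivial M (F × F')) k ↔
      ContMDiff 𝓘(ℝ, E) 𝓘(ℝ, (F × F') [⋀^Fin k]→L[ℝ] ℝ) ∞
        (show M → (F × F') [⋀^Fin k]→L[ℝ] ℝ from η) := by
  refine forall_congr' fun x₀ => ?_
  have h : (fun x => (η x).compContinuousLinearMap
      ((trivializationAt (F × F') (Bundle.Trivial M (F × F')) x₀).symmL ℝ x) :
        M → (F × F') [⋀^Fin k]→L[ℝ] ℝ) = η := by
    funext x
    refine ContinuousAlternatingMap.ext fun v => ?_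
    let τ : (F × F') [⋀^Fin k]→L[ℝ] ℝ := η x
    refine congrArg (fun w : Fin k → F × F' => τ w) (funext fun i => ?_)
    exact Bundle.Trivial.symmL_trivializationAt_prod x₀ x (v i)
  rw [h]

theorem Bundle.Trivial.contMDiff_prod_iff {EN HN : Type*} [NormedAddCommGroup EN] [NormedSpace ℝ EN]
    [TopologicalSpace HN] {J : ModelWithCorners ℝ EN HN} {N : Type*} [TopologicalSpace N]
    [ChartedSpace HN N] {u : N → M} {w : N → F × F'} :
    ContMDiff J (𝓘(ℝ, E).prod 𝓘(ℝ, F × F')) ∞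
      (fun y => (⟨u y, w y⟩ : TotalSpace (F × F') (Bundle.Trivial M (F × F'))))
      ↔ ContMDiff J 𝓘(ℝ, E) ∞ u ∧ ContMDiff J 𝓘(ℝ, F × F') ∞ w := by
  have h := fun y => contMDiffAt_totalSpace (F := F × F') (E := Bundle.Trivial M (F × F'))
    (IB := 𝓘(ℝ, E)) (IM := J) (n := ∞)
    (f := fun y => (⟨u y, w y⟩ : TotalSpace (F × F') (Bundle.Trivial M (F × F')))) (x₀ := y)
  exact ⟨fun hu => ⟨fun y => ((h y).1 (hu y)).1, fun y => ((h y).1 (hu y)).2⟩,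
    fun hu y => (h y).2 ⟨hu.1 y, hu.2 y⟩⟩

/-- A bundle map from a trivial bundle of finite rank to the tangent bundle is smooth if it maps
constant sections to smooth vector fields. -/
theorem Bundle.Trivial.contMDiff_prod_toTangent [IsManifold 𝓘(ℝ, E) ∞ M] [FiniteDimensional ℝ F]
    [FiniteDimensional ℝ F'] {Ψ : Π x : M, (F × F') →L[ℝ] TangentSpace 𝓘(ℝ, E) x}
    (hΨ : ∀ v : F × F', ContMDiff 𝓘(ℝ, E) 𝓘(ℝ, E).tangent ∞
      (fun x => (⟨x, Ψ x v⟩ : TangentBundle 𝓘(ℝ, E) M))) :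
    ContMDiff (𝓘(ℝ, E).prod 𝓘(ℝ, F × F')) 𝓘(ℝ, E).tangent ∞
      (fun a : TotalSpace (F × F') (Bundle.Trivial M (F × F')) =>
        (⟨a.1, Ψ a.1 a.2⟩ : TangentBundle 𝓘(ℝ, E) M)) := by
  intro a₀
  have hid := (Bundle.Trivial.contMDiff_prod_iff (E := E) (J := 𝓘(ℝ, E).prod 𝓘(ℝ, F × F'))
    (u := fun a : TotalSpace (F × F') (Bundle.Trivial M (F × F')) => a.1)
    (w := fun a => a.2)).1 contMDiff_id
  refine contMDiffAt_totalSpace.2 ⟨hid.1 a₀, ?_⟩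
  set τ := trivializationAt E (TangentSpace 𝓘(ℝ, E) : M → Type _) a₀.1
  have hbase : ∀ᶠ x in 𝓝 a₀.1, x ∈ τ.baseSet :=
    τ.open_baseSet.mem_nhds (mem_baseSet_trivializationAt E _ a₀.1)
  have h1 : ContMDiffAt 𝓘(ℝ, E) 𝓘(ℝ, (F × F') →L[ℝ] E) ∞
      (fun x => (τ.continuousLinearMapAt ℝ x).comp (Ψ x)) a₀.1 := by
    refine contMDiffWithinAt_clm_iff.2 fun v => ?_
    have h2 := (contMDiffAt_totalSpace.1 (hΨ v a₀.1)).2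
    refine ContMDiffAt.congr_of_eventuallyEq h2 ?_
    filter_upwards [hbase] with x hx
    exact τ.continuousLinearMapAt_apply_of_mem ℝ hx _
  refine ContMDiffAt.congr_of_eventuallyEq
    ((h1.comp (f := fun a : TotalSpace (F × F') (Bundle.Trivial M (F × F')) => a.1) a₀ (hid.1 a₀)).clm_apply
      (hid.2 a₀)) ?_
  filter_upwards [(hid.1 a₀).continuousAt.eventually hbase] with a ha
  exact (τ.continuousLinearMapAt_apply_of_mem ℝ ha _).symm

end Trivial

/-! ### The pullback by H and the invariant forms. -/

namespace GStr

namespace GStructureWithConnection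

variable {n r d : ℕ} {G : Type*} [Group G] [TopologicalSpace G] [ChartedSpace (Eu r) G]
  {ι : G →* (Eu n →L[ℝ] Eu n)ˣ}
  {P : Type*} [TopologicalSpace P] [ChartedSpace (Eu (n + r)) P] [IsManifold (𝓡 (n + r)) ∞ P]
  [MulAction Gᵐᵒᵖ P] {S : GStructureWithConnection r ι P}
  {W : Type*} [NormedAddCommGroup W] [NormedSpace ℝ W]
  [ChartedSpace (Eu d) S.X]

theorem isInvariantMap_comp_h (hh : ContMDiff (𝓡 (n + r)) (𝓡 d) ∞ S.h) {f : S.X → W}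
    (hf : ContMDiff (𝓡 d) 𝓘(ℝ, W) ∞ f) : S.IsInvariantMap (f ∘ S.h) :=
  ⟨hf.comp hh, fun _ hΦ _ hp => congrArg f (hΦ.h_map hp)⟩

variable [IsManifold (𝓡 d) ∞ S.X]

theorem IsInvariantMap.contMDiff_descend (hh : Manifold.IsSubmersion (𝓡 (n + r)) (𝓡 d) ∞ S.h)
    {u : P → W} (hu : S.IsInvariantMap u) : ContMDiff (𝓡 d) 𝓘(ℝ, W) ∞ hu.descend :=
  hh.contMDiff_of_comp S.surjective_h hu.1

/-- In components the pullback by `H` is simply composition with `h`. Smoothness and injectivity of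
the pullback are read off from this. -/
theorem pullback_H_apply_inverse {k : ℕ} (η : Π x : S.X, S.A x [⋀^Fin k]→L[ℝ] ℝ) (p : P) :
    (pullback S.H k η p).compContinuousLinearMap (S.coframe p).inverse =
      (η (S.h p) : Fib n r [⋀^Fin k]→L[ℝ] ℝ) := by
  refine ContinuousAlternatingMap.ext fun v => ?_
  let τ : Fib n r [⋀^Fin k]→L[ℝ] ℝ := η (S.h p)
  refine congrArg (fun w : Fin k → Fib n r => τ w) (funext fun i => ?_)
  exact S.isCoframe.apply_frameField (fun _ => v i) p

theorem pullback_H_mem_forms (hh : ContMDiff (𝓡 (n + r)) (𝓡 d) ∞ S.h) {k : ℕ}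
    {η : Π x : S.X, S.A x [⋀^Fin k]→L[ℝ] ℝ} (hη : η ∈ forms (𝓡 d) (Fib n r) S.A k) :
    pullback S.H k η ∈ forms (𝓡 (n + r)) (Eu (n + r)) (TangentSpace (𝓡 (n + r)) : P → Type _) k := by
  rw [S.isCoframe.mem_forms_iff]
  have h1 : (fun p => (pullback S.H k η p).compContinuousLinearMap (S.coframe p).inverse) =
      (show S.X → Fib n r [⋀^Fin k]→L[ℝ] ℝ from η) ∘ S.h := funext fun p => pullback_H_apply_inverse η p
  rw [h1]
  exact (Bundle.Trivial.mem_forms_prod_iff.1 hη).comp hh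

theorem pullback_H_injective {k : ℕ} : Injective (pullback S.H k) := by
  intro η η' h
  funext x
  obtain ⟨p, rfl⟩ := S.surjective_h x
  exact (pullback_H_apply_inverse η p).symm.trans ((congrArg (fun Ω : (Π p : P,
    TangentSpace (𝓡 (n + r)) p [⋀^Fin k]→L[ℝ] ℝ) => (Ω p).compContinuousLinearMap
      (S.coframe p).inverse) h).trans (pullback_H_apply_inverse η' p))

theorem pullback_H_mem_invariantForms (hh : ContMDiff (𝓡 (n + r)) (𝓡 d) ∞ S.h) {k : ℕ}
    {η : Π x : S.X, S.A x [⋀^Fin k]→L[ℝ] ℝ} (hη : η ∈ forms (𝓡 d) (Fib n r) S.A k) :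
    pullback S.H k η ∈ S.invariantForms k := by
  refine ⟨pullback_H_mem_forms hh hη, fun Φ hΦ p hp => ?_⟩
  refine ContinuousAlternatingMap.ext fun v => ?_
  have h2 := congrArg (show S.X → Fib n r [⋀^Fin k]→L[ℝ] ℝ from η) (hΦ.toPreservesCoframe.h_map hp)
  refine (congrArg (fun τ : Fib n r [⋀^Fin k]→L[ℝ] ℝ => τ fun i =>
    S.coframe (Φ p) (mfderiv (𝓡 (n + r)) (𝓡 (n + r)) Φ p (v i))) h2).trans ?_
  let τ : Fib n r [⋀^Fin k]→L[ℝ] ℝ := η (S.h p)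
  refine congrArg (fun w : Fin k → Fib n r => τ w) (funext fun i => ?_)
  exact hΦ.toPreservesCoframe.map_coframe hp (v i)

theorem bijOn_pullback_H [LieGroup (𝓡 r) ∞ G] [T2Space P] (hι : Injective ι)
    (hh : Manifold.IsSubmersion (𝓡 (n + r)) (𝓡 d) ∞ S.h) (k : ℕ) :
    BijOn (pullback S.H k) (forms (𝓡 d) (Fib n r) S.A k) (S.invariantForms k) := by
  refine ⟨fun η hη => pullback_H_mem_invariantForms hh.contMDiff hη, pullback_H_injective.injOn, ?_⟩
  intro Ω hΩ
  -- Each component of an invariant form is an invariant function, hence preserved by all symmetries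
  -- and not only by the equivariant ones. The component map then descends to a form on X.
  have hu : S.IsInvariantMap (fun p => (Ω p).compContinuousLinearMap (S.coframe p).inverse) := by
    have hs := S.isCoframe.mem_forms_iff.1 hΩ.1
    refine ⟨hs, fun Φ hΦ p hp => ContinuousAlternatingMap.ext fun v => ?_⟩
    have hf : S.IsInvariantFunction (fun p => (Ω p).compContinuousLinearMap (S.coframe p).inverse v) := by
      refine ⟨fun q => (hs q).continuousAlternatingMap_apply_const v, fun Ψ hΨ q hq => ?_⟩
      refine Eq.trans ?_ (congrArg (fun τ => τ (fun i => frameField S.coframe (fun _ => v i) q))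
        (hΩ.2 Ψ hΨ q hq))
      refine congrArg (fun w => Ω (Ψ q) w) (funext fun i => ?_)
      exact (S.isCoframe.mfderiv_frameField_of_map (hΨ.toPreservesCoframe.map_coframe hq)
        (a := fun _ => v i) rfl).symm
    exact (hf.isInvariantMap hι).2 Φ hΦ p hp
  refine ⟨fun x => hu.descend x, Bundle.Trivial.mem_forms_prod_iff.2 (hu.contMDiff_descend hh), ?_⟩
  funext p
  refine ContinuousAlternatingMap.ext fun v => ?_
  exact congrArg (fun w => Ω p w) (funext fun i => S.isCoframe.inverse_apply (v i))

end GStructureWithConnection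

end GStr

/-! ### Bracket identities in components. -/

namespace IsCoframe

variable {E V : Type*} [NormedAddCommGroup E] [NormedSpace ℝ E] [FiniteDimensional ℝ E]
  [NormedAddCommGroup V] [NormedSpace ℝ V]
  {M : Type*} [TopologicalSpace M] [ChartedSpace E M] [IsManifold 𝓘(ℝ, E) ∞ M]
  {H : Π p : M, TangentSpace 𝓘(ℝ, E) p →L[ℝ] V} (hH : IsCoframe H) {a b c : M → V}
include hH

theorem mdifferentiableAt_frameField (ha : ContMDiff 𝓘(ℝ, E) 𝓘(ℝ, V) ∞ a) (p : M) :
    MDifferentiableAt 𝓘(ℝ, E) 𝓘(ℝ, E).tangent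
      (fun q => (⟨q, frameField H a q⟩ : TangentBundle 𝓘(ℝ, E) M)) p :=
  (hH.contMDiff_frameField ha).mdifferentiable (by simp) p

theorem coframeBracket_add_right (hb : ContMDiff 𝓘(ℝ, E) 𝓘(ℝ, V) ∞ b)
    (hc : ContMDiff 𝓘(ℝ, E) 𝓘(ℝ, V) ∞ c) (p : M) :
    coframeBracket H a (fun q => b q + c q) p = coframeBracket H a b p + coframeBracket H a c p := by
  have h1 : frameField H (fun q => b q + c q) = frameField H b + frameField H c :=
    funext fun q => map_add _ _ _
  simp only [coframeBracket]
  rw [h1, VectorField.mlieBracket_add_right (hH.mdifferentiableAt_frameField hb p)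
    (hH.mdifferentiableAt_frameField hc p), map_add]

omit hH [FiniteDimensional ℝ E] in
theorem _root_.coframeBracket_swap (p : M) :
    coframeBracket H a b p = -coframeBracket H b a p := by
  simp only [coframeBracket]
  rw [VectorField.mlieBracket_swap_apply, map_neg]

theorem coframeBracket_jacobi (ha : ContMDiff 𝓘(ℝ, E) 𝓘(ℝ, V) ∞ a)
    (hb : ContMDiff 𝓘(ℝ, E) 𝓘(ℝ, V) ∞ b) (hc : ContMDiff 𝓘(ℝ, E) 𝓘(ℝ, V) ∞ c) (p : M) :
    coframeBracket H a (coframeBracket H b c) p =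
      coframeBracket H (coframeBracket H a b) c p + coframeBracket H b (coframeBracket H a c) p := by
  have := FiniteDimensional.complete ℝ E
  have h2 : minSmoothness ℝ 3 ≤ (∞ : ℕ∞ω) := by
    rw [minSmoothness_of_isRCLikeNormedField]
    exact WithTop.coe_le_coe.2 (le_top : (3 : ℕ∞) ≤ ⊤)
  have : IsManifold 𝓘(ℝ, E) (minSmoothness ℝ 3) M := IsManifold.of_le (n := ∞) h2
  have h1 : ∀ a b : M → V, frameField H (coframeBracket H a b) =
      VectorField.mlieBracket 𝓘(ℝ, E) (frameField H a) (frameField H b) :=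
    fun a b => funext fun q => hH.frameField_coframeBracket a b q
  have h3 : minSmoothness ℝ 2 ≤ (∞ : ℕ∞ω) := le_trans (minSmoothness_monotone (by norm_num)) h2
  have h4 := VectorField.leibniz_identity_mlieBracket_apply
    ((hH.contMDiff_frameField ha).of_le h3 p) ((hH.contMDiff_frameField hb).of_le h3 p)
    ((hH.contMDiff_frameField hc).of_le h3 p)
  rw [coframeBracket, coframeBracket, coframeBracket, h1, h1, h1, h4, map_add]

theorem coframeBracket_smul_right {f : M → ℝ} (hf : ContMDiff 𝓘(ℝ, E) 𝓘(ℝ, ℝ) ∞ f)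
    (hb : ContMDiff 𝓘(ℝ, E) 𝓘(ℝ, V) ∞ b) (p : M) :
    coframeBracket H a (fun q => f q • b q) p =
      f p • coframeBracket H a b p + mvfderiv 𝓘(ℝ, E) f p (frameField H a p) • b p := by
  have h1 : frameField H (fun q => f q • b q) = f • frameField H b :=
    funext fun q => map_smul _ _ _
  simp only [coframeBracket]
  rw [h1, VectorField.mlieBracket_smul_right (hf.mdifferentiable (by simp) p)
    (hH.mdifferentiableAt_frameField hb p), map_add, map_smul, map_smul, hH.apply_frameField, add_comm]

end IsCoframe

/-! ### The induced Lie algebroid. -/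

namespace GStr

namespace GStructureWithConnection

variable {n r d : ℕ} {G : Type*} [Group G] [TopologicalSpace G] [ChartedSpace (Eu r) G]
  {ι : G →* (Eu n →L[ℝ] Eu n)ˣ}
  {P : Type*} [TopologicalSpace P] [ChartedSpace (Eu (n + r)) P] [IsManifold (𝓡 (n + r)) ∞ P]
  [MulAction Gᵐᵒᵖ P] {S : GStructureWithConnection r ι P}
  [ChartedSpace (Eu d) S.X]

variable (S) in
/-- The anchor `A → TX` induced by the differential of `h`. -/
noncomputable def inducedAnchor (x : S.X) : Fib n r →L[ℝ] TangentSpace (𝓡 d) x :=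
  show Fib n r →L[ℝ] Eu d from
    (mfderiv (𝓡 (n + r)) (𝓡 d) S.h x.out).comp (S.coframe x.out).inverse

/-- Independence of the representative: a symmetry relating two points of a fibre preserves both `h`
and the frame vector with components `v`. -/
theorem inducedAnchor_h (hh : ContMDiff (𝓡 (n + r)) (𝓡 d) ∞ S.h) (p : P) (v : Fib n r) :
    S.inducedAnchor (S.h p) v =
      mfderiv (𝓡 (n + r)) (𝓡 d) S.h p ((S.coframe p).inverse v) := by
  have h1 : ∀ q, S.h q = S.h p →
      (mfderiv (𝓡 (n + r)) (𝓡 d) S.h q ((S.coframe q).inverse v) : Eu d) =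
        (mfderiv (𝓡 (n + r)) (𝓡 d) S.h p ((S.coframe p).inverse v) : Eu d) := by
    intro q hq
    obtain ⟨Φ, hΦ, hqΦ, rfl⟩ := h_eq_iff.1 hq
    have h2 := mfderiv_comp_apply q (hh.mdifferentiable (by simp) (Φ q))
      (hΦ.mdifferentiableAt hqΦ) ((S.coframe q).inverse v)
    have h3 := S.isCoframe.mfderiv_frameField_of_map (hΦ.map_coframe hqΦ) (a := fun _ => v) rfl
    have h4 : S.h ∘ Φ =ᶠ[𝓝 q] S.h := by
      filter_upwards [Φ.open_source.mem_nhds hqΦ] with y hy using hΦ.h_map hy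
    have h5 := congrArg (fun A : Eu (n + r) →L[ℝ] Eu d => A ((S.coframe q).inverse v))
      (h4.mfderiv_eq (I := 𝓡 (n + r)) (I' := 𝓡 d))
    exact h5.symm.trans (h2.trans (congrArg (mfderiv (𝓡 (n + r)) (𝓡 d) S.h (Φ q)) h3))
  exact h1 _ (Quotient.out_eq (S.h p))

variable [IsManifold (𝓡 d) ∞ S.X]

/-- Tested on constant sections, and after composition with the surjective submersion `h`, the
anchor is the tangent map of `h` along a smooth frame field. -/
theorem contMDiff_inducedAnchor (hh : Manifold.IsSubmersion (𝓡 (n + r)) (𝓡 d) ∞ S.h) :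
    ContMDiff ((𝓡 d).prod 𝓘(ℝ, Fib n r)) (𝓡 d).tangent ∞
      (fun a : TotalSpace (Fib n r) S.A =>
        (⟨a.1, S.inducedAnchor a.1 a.2⟩ : TangentBundle (𝓡 d) S.X)) := by
  refine Bundle.Trivial.contMDiff_prod_toTangent fun v => hh.contMDiff_of_comp S.surjective_h ?_
  have h1 := (hh.contMDiff.contMDiff_tangentMap (m := ∞) (by simp)).comp
    (S.isCoframe.contMDiff_frameField (a := fun _ => v) contMDiff_const)
  refine h1.congr fun p => ?_
  exact congrArg (TotalSpace.mk (S.h p)) (inducedAnchor_h hh.contMDiff p v)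

theorem isInvariantMap_section (hh : ContMDiff (𝓡 (n + r)) (𝓡 d) ∞ S.h)
    (s : Cₛ^∞⟮𝓡 d; Fib n r, S.A⟯) : S.IsInvariantMap (W := Fib n r) (fun p => s (S.h p)) :=
  isInvariantMap_comp_h hh (f := fun x => (s x : Fib n r))
    (Bundle.Trivial.contMDiff_prod_iff.1 s.contMDiff).2

/-- The section of `A` induced by an invariant map. -/
noncomputable def IsInvariantMap.toSection {a : P → Fib n r} (ha : S.IsInvariantMap a)
    (hh : Manifold.IsSubmersion (𝓡 (n + r)) (𝓡 d) ∞ S.h) : Cₛ^∞⟮𝓡 d; Fib n r, S.A⟯ :=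
  ⟨ha.descend, Bundle.Trivial.contMDiff_prod_iff.2 ⟨contMDiff_id, ha.contMDiff_descend hh⟩⟩

/-- The lift of a section of `A` to a vector field on `P`. -/
noncomputable def liftSection (hh : ContMDiff (𝓡 (n + r)) (𝓡 d) ∞ S.h)
    (s : Cₛ^∞⟮𝓡 d; Fib n r, S.A⟯) :
    Cₛ^∞⟮𝓡 (n + r); Eu (n + r), (TangentSpace (𝓡 (n + r)) : P → Type _)⟯ :=
  ⟨frameField S.coframe (fun p => s (S.h p)),
    S.isCoframe.contMDiff_frameField (isInvariantMap_section hh s).1⟩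

theorem H_liftSection (hh : ContMDiff (𝓡 (n + r)) (𝓡 d) ∞ S.h)
    (s : Cₛ^∞⟮𝓡 d; Fib n r, S.A⟯) (p : P) : S.H p (liftSection hh s p) = s (S.h p) :=
  S.isCoframe.apply_frameField (fun p => s (S.h p)) p

theorem mfderiv_h_liftSection (hh : ContMDiff (𝓡 (n + r)) (𝓡 d) ∞ S.h)
    (s : Cₛ^∞⟮𝓡 d; Fib n r, S.A⟯) (p : P) :
    mfderiv (𝓡 (n + r)) (𝓡 d) S.h p (liftSection hh s p) =
      S.inducedAnchor (S.h p) (s (S.h p)) :=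
  (inducedAnchor_h hh p (s (S.h p))).symm

theorem mvfderiv_comp_h (hh : ContMDiff (𝓡 (n + r)) (𝓡 d) ∞ S.h) {W : Type*}
    [NormedAddCommGroup W] [NormedSpace ℝ W] {f : S.X → W} (hf : ContMDiff (𝓡 d) 𝓘(ℝ, W) ∞ f)
    (s : Cₛ^∞⟮𝓡 d; Fib n r, S.A⟯) (p : P) :
    mvfderiv (𝓡 (n + r)) (f ∘ S.h) p (liftSection hh s p) =
      mvfderiv (𝓡 d) f (S.h p) (S.inducedAnchor (S.h p) (s (S.h p))) := by
  rw [← mfderiv_h_liftSection hh s p]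
  exact mfderiv_comp_apply p (hf.mdifferentiable (by simp) _) (hh.mdifferentiable (by simp) _) _

/-- The Lie algebroid structure on `A` induced by the coframe. -/
noncomputable def inducedAlgebroid (hh : Manifold.IsSubmersion (𝓡 (n + r)) (𝓡 d) ∞ S.h) :
    LieAlgebroid (𝓡 d) (Fib n r) S.A where
  anchor := S.inducedAnchor
  contMDiff_anchor := contMDiff_inducedAnchor hh
  -- Sections are lifted to fields with the same components, bracketed on P, and the invariant
  -- components of the result descended. The axioms are then checked at points `S.h p`.
  bracket s t := ((isInvariantMap_section hh.contMDiff s).coframeBracket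
    (isInvariantMap_section hh.contMDiff t)).toSection hh
  bracket_add s t t' := by
    refine ContMDiffSection.ext fun x => ?_
    obtain ⟨p, rfl⟩ := S.surjective_h x
    exact S.isCoframe.coframeBracket_add_right (isInvariantMap_section hh.contMDiff t).1
      (isInvariantMap_section hh.contMDiff t').1 p
  bracket_skew s t := by
    refine ContMDiffSection.ext fun x => ?_
    obtain ⟨p, rfl⟩ := S.surjective_h x
    exact coframeBracket_swap p
  jacobi s t u := by
    refine ContMDiffSection.ext fun x => ?_
    obtain ⟨p, rfl⟩ := S.surjective_h x
    exact S.isCoframe.coframeBracket_jacobi (isInvariantMap_section hh.contMDiff s).1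
      (isInvariantMap_section hh.contMDiff t).1 (isInvariantMap_section hh.contMDiff u).1 p
  leibniz s t t' f hf ht x := by
    obtain ⟨p, rfl⟩ := S.surjective_h x
    have h1 := S.isCoframe.coframeBracket_smul_right (a := fun p => s (S.h p)) (hf.comp hh.contMDiff)
      (isInvariantMap_section hh.contMDiff t).1 p
    have h2 : (fun p => t' (S.h p)) = fun p => (f ∘ S.h) p • t (S.h p) := funext fun p => ht (S.h p)
    refine (congrArg (fun b => coframeBracket S.coframe (fun p => s (S.h p)) b p) h2).trans
      (h1.trans ?_)
    exact congrArg (fun c : ℝ => _ + c • t (S.h p)) (mvfderiv_comp_h hh.contMDiff hf s p)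
  anchor_bracket s t x := by
    obtain ⟨p, rfl⟩ := S.surjective_h x
    have hd : ∀ s : Cₛ^∞⟮𝓡 d; Fib n r, S.A⟯, ContMDiff (𝓡 d) (𝓡 d).tangent ∞
        (fun y => (⟨y, S.inducedAnchor y (s y)⟩ : TangentBundle (𝓡 d) S.X)) := fun s =>
      (contMDiff_inducedAnchor hh).comp s.contMDiff
    have hd' : ∀ s : Cₛ^∞⟮𝓡 d; Fib n r, S.A⟯, _ := fun s =>
      (liftSection hh.contMDiff s).contMDiff.mdifferentiable (by simp) p
    -- The lift of a section is `h`-related to its image under the anchor.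
    refine Eq.trans ?_ (VectorField.mfderiv_mlieBracket_of_related hh.contMDiff (hd' s) (hd' t)
      ((hd s).mdifferentiable (by simp) _) ((hd t).mdifferentiable (by simp) _)
      (mfderiv_h_liftSection hh.contMDiff s) (mfderiv_h_liftSection hh.contMDiff t))
    refine (inducedAnchor_h hh.contMDiff p _).trans ?_
    exact congrArg (mfderiv (𝓡 (n + r)) (𝓡 d) S.h p)
      (S.isCoframe.frameField_coframeBracket (fun p => s (S.h p)) (fun p => t (S.h p)) p)

end GStructureWithConnection

end GStr

theorem Function.apply_update_eq {α β κ : Type*} [DecidableEq κ] (H : α → β) {f : κ → α} {g : κ → β}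
    (hfg : ∀ l, H (f l) = g l) {i : κ} {a : α} {b : β} (hab : H a = b) (l : κ) :
    H (Function.update f i a l) = Function.update g i b l := by
  by_cases hl : l = i
  · subst hl
    simpa using hab
  · simpa [hl] using hfg l

/-! ### The algebroid differential, the morphism property and uniqueness. -/

namespace GStr

namespace GStructureWithConnection

variable {n r d : ℕ} {G : Type*} [Group G] [TopologicalSpace G] [ChartedSpace (Eu r) G]
  {ι : G →* (Eu n →L[ℝ] Eu n)ˣ}
  {P : Type*} [TopologicalSpace P] [ChartedSpace (Eu (n + r)) P] [IsManifold (𝓡 (n + r)) ∞ P]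
  [MulAction Gᵐᵒᵖ P] {S : GStructureWithConnection r ι P}
  [ChartedSpace (Eu d) S.X] [IsManifold (𝓡 d) ∞ S.X] {k : ℕ}

theorem contMDiff_forms_apply {η : Π x : S.X, S.A x [⋀^Fin k]→L[ℝ] ℝ}
    (hη : η ∈ forms (𝓡 d) (Fib n r) S.A k) {w : Fin k → S.X → Fib n r}
    (hw : ∀ i, ContMDiff (𝓡 d) 𝓘(ℝ, Fib n r) ∞ (w i)) :
    ContMDiff (𝓡 d) 𝓘(ℝ, ℝ) ∞ (fun x => η x (fun i => w i x)) := fun x =>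
  ContMDiffWithinAt.continuousAlternatingMap_apply (F := Fib n r)
    (Bundle.Trivial.mem_forms_prod_iff.1 hη x) fun i => hw i x

theorem contMDiff_section (s : Cₛ^∞⟮𝓡 d; Fib n r, S.A⟯) :
    ContMDiff (𝓡 d) 𝓘(ℝ, Fib n r) ∞ (fun x => s x) :=
  (Bundle.Trivial.contMDiff_prod_iff.1 s.contMDiff).2

theorem contMDiff_diffOnSections (L : LieAlgebroid (𝓡 d) (Fib n r) S.A)
    {η : Π x : S.X, S.A x [⋀^Fin k]→L[ℝ] ℝ} (hη : η ∈ forms (𝓡 d) (Fib n r) S.A k)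
    (s : Fin (k + 1) → Cₛ^∞⟮𝓡 d; Fib n r, S.A⟯) :
    ContMDiff (𝓡 d) 𝓘(ℝ, ℝ) ∞ (L.diffOnSections η s) := by
  refine ContMDiff.add ?_ ?_
  · refine contMDiff_finsetSum fun i _ => contMDiff_const.mul ?_
    exact (contMDiff_forms_apply hη fun l => contMDiff_section (s (i.succAbove l))).mvfderiv_apply
      (L.contMDiff_anchor.comp (s i).contMDiff)
  · refine contMDiff_finsetSum fun j _ => contMDiff_finsetSum fun i _ => ?_
    split_ifs
    · refine contMDiff_const.mul ?_
      let b : Fin k → S.X → Fib n r := fun l x => Function.update (fun l => s (j.succAbove l) x) i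
        (L.bracket (s i.castSucc) (s j) x) l
      refine contMDiff_forms_apply hη (w := b) fun l => ?_
      by_cases hl : l = i
      · have h1 : b l = fun x => L.bracket (s i.castSucc) (s j) x := by
          funext x
          subst hl
          exact Function.update_self ..
        rw [h1]
        exact contMDiff_section _
      · have h1 : b l = fun x => s (j.succAbove l) x :=
          funext fun x => Function.update_of_ne hl ..
        rw [h1]
        exact contMDiff_section _
    · exact contMDiff_const

/-- The two Koszul formulas agree term by term: lifts are `h`-related to anchors, and `H` of a
bracket of lifts is by construction the bracket of the sections. -/
theorem diffOnSections_pullback_H (hh : Manifold.IsSubmersion (𝓡 (n + r)) (𝓡 d) ∞ S.h)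
    {η : Π x : S.X, S.A x [⋀^Fin k]→L[ℝ] ℝ} (hη : η ∈ forms (𝓡 d) (Fib n r) S.A k)
    (s : Fin (k + 1) → Cₛ^∞⟮𝓡 d; Fib n r, S.A⟯) (p : P) :
    (tangentAlgebroid (𝓡 (n + r)) P).diffOnSections (pullback S.H k η)
        (fun i => liftSection hh.contMDiff (s i)) p =
      (inducedAlgebroid hh).diffOnSections η s (S.h p) := by
  refine congrArg₂ (· + ·) (Finset.sum_congr rfl fun i _ => ?_)
    (Finset.sum_congr rfl fun j _ => Finset.sum_congr rfl fun i _ => ?_)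
  · refine congrArg ((-1 : ℝ) ^ (i : ℕ) * ·) ?_
    have h1 : (fun q => pullback S.H k η q (fun l => liftSection hh.contMDiff (s (i.succAbove l)) q)) =
        (fun x => η x (fun l => s (i.succAbove l) x)) ∘ S.h := funext fun q =>
      congrArg (η (S.h q)) (funext fun l => H_liftSection hh.contMDiff (s (i.succAbove l)) q)
    rw [h1]
    exact mvfderiv_comp_h hh.contMDiff
      (contMDiff_forms_apply hη fun l => contMDiff_section (s (i.succAbove l))) (s i) p
  · split_ifs
    · refine congrArg ((-1 : ℝ) ^ (j : ℕ) * ·) (congrArg (η (S.h p)) (funext fun l => ?_))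
      refine apply_update_eq (S.H p) (fun l => H_liftSection hh.contMDiff (s (j.succAbove l)) p) ?_ l
      rfl
    · rfl

/-- The constant section of `A` with value `v`. -/
noncomputable def constSection (hh : Manifold.IsSubmersion (𝓡 (n + r)) (𝓡 d) ∞ S.h)
    (v : Fib n r) : Cₛ^∞⟮𝓡 d; Fib n r, S.A⟯ :=
  (IsInvariantMap.const v).toSection hh

/-- The components of the de Rham differential of the pullback, evaluated on constants, are Koszul
expressions on X by `diffOnSections_pullback_H`. They therefore descend, and their smoothness comes
from that of the Koszul expressions. -/
theorem exists_isDifferential_inducedAlgebroid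
    (hh : Manifold.IsSubmersion (𝓡 (n + r)) (𝓡 d) ∞ S.h)
    {η : Π x : S.X, S.A x [⋀^Fin k]→L[ℝ] ℝ} (hη : η ∈ forms (𝓡 d) (Fib n r) S.A k) :
    ∃ ζ ∈ forms (𝓡 d) (Fib n r) S.A (k + 1), (inducedAlgebroid hh).IsDifferential η ζ ∧
      (tangentAlgebroid (𝓡 (n + r)) P).IsDifferential (pullback S.H k η)
        (pullback S.H (k + 1) ζ) := by
  obtain ⟨Z, hZ⟩ := exists_isDifferential_tangentAlgebroid (pullback_H_mem_forms hh.contMDiff hη)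
  let u : P → Fib n r [⋀^Fin (k + 1)]→L[ℝ] ℝ := fun p =>
    (Z p).compContinuousLinearMap (S.coframe p).inverse
  have hu : ∀ (s : Fin (k + 1) → Cₛ^∞⟮𝓡 d; Fib n r, S.A⟯) (p : P),
      u p (fun i => s i (S.h p)) = (inducedAlgebroid hh).diffOnSections η s (S.h p) := fun s p =>
    (hZ (fun i => liftSection hh.contMDiff (s i)) p).trans (diffOnSections_pullback_H hh hη s p)
  have huv : ∀ (v : Fin (k + 1) → Fib n r) (p : P), u p v =
      (inducedAlgebroid hh).diffOnSections η (fun i => constSection hh (v i)) (S.h p) := fun v p =>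
    hu (fun i => constSection hh (v i)) p
  -- The representative is irrelevant since `huv` expresses `u p` through `S.h p` alone.
  let ζ : Π x : S.X, S.A x [⋀^Fin (k + 1)]→L[ℝ] ℝ := fun x => u x.out
  have hζ : ∀ p, ζ (S.h p) = u p := by
    intro p
    refine ContinuousAlternatingMap.ext fun v => ?_
    refine (huv v _).trans (Eq.trans ?_ (huv v p).symm)
    exact congrArg _ (Quotient.out_eq (S.h p))
  refine ⟨ζ, Bundle.Trivial.mem_forms_prod_iff.2 fun x =>
    contMDiffWithinAt_continuousAlternatingMap_iff.2 fun v => ?_, fun s x => ?_, fun s p => ?_⟩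
  · have h1 : (fun x => (ζ x : Fib n r [⋀^Fin (k + 1)]→L[ℝ] ℝ) v) =
        (inducedAlgebroid hh).diffOnSections η (fun i => constSection hh (v i)) := by
      funext x
      obtain ⟨p, rfl⟩ := S.surjective_h x
      exact (congrArg (fun τ : Fib n r [⋀^Fin (k + 1)]→L[ℝ] ℝ => τ v) (hζ p)).trans (huv v p)
    have h2 := contMDiff_diffOnSections (inducedAlgebroid hh) hη (fun i => constSection hh (v i))
    rw [← h1] at h2
    exact h2 x
  · obtain ⟨p, rfl⟩ := S.surjective_h x
    exact (congrArg (fun τ : Fib n r [⋀^Fin (k + 1)]→L[ℝ] ℝ => τ (fun i => s i (S.h p))) (hζ p)).trans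
      (hu s p)
  · refine Eq.trans ?_ (hZ s p)
    refine (congrArg (fun τ : Fib n r [⋀^Fin (k + 1)]→L[ℝ] ℝ => τ (fun i => S.coframe p (s i p)))
      (hζ p)).trans ?_
    exact congrArg (Z p) (funext fun i => S.isCoframe.inverse_apply (s i p))

theorem isMorphism_inducedAlgebroid (hh : Manifold.IsSubmersion (𝓡 (n + r)) (𝓡 d) ∞ S.h) :
    IsMorphism (tangentAlgebroid (𝓡 (n + r)) P) (inducedAlgebroid hh) S.H where
  contMDiff_base := hh.contMDiff
  contMDiff_map := by
    refine Bundle.Trivial.contMDiff_prod_iff.2 ⟨?_, S.contMDiff_θ.prodMk_space S.contMDiff_conn⟩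
    exact hh.contMDiff.comp (contMDiff_proj (TangentSpace (𝓡 (n + r)) : P → Type _))
  anchor_comp p ξ := by
    refine (inducedAnchor_h hh.contMDiff p (S.coframe p ξ)).trans ?_
    exact congrArg (mfderiv (𝓡 (n + r)) (𝓡 d) S.h p) (S.isCoframe.inverse_apply ξ)
  differential _ _ hη := exists_isDifferential_inducedAlgebroid hh hη

variable (S) in
theorem constForm_mem_forms (l : Fib n r →L[ℝ] ℝ) :
    (fun _ => ContinuousAlternatingMap.ofSubsingleton ℝ (Fib n r) ℝ (0 : Fin 1) l :
      Π x : S.X, S.A x [⋀^Fin 1]→L[ℝ] ℝ) ∈ forms (𝓡 d) (Fib n r) S.A 1 :=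
  Bundle.Trivial.mem_forms_prod_iff.2 contMDiff_const

/-- The differential fixes the values on lifts of constant sections, and these fill every fibre. Two
algebroid structures with `H` a morphism thus have the same differential. -/
theorem pullback_H_eq_of_isDifferential (hh : Manifold.IsSubmersion (𝓡 (n + r)) (𝓡 d) ∞ S.h)
    {Ω : Π p : P, TangentSpace (𝓡 (n + r)) p [⋀^Fin k]→L[ℝ] ℝ}
    {ζ ζ' : Π x : S.X, S.A x [⋀^Fin (k + 1)]→L[ℝ] ℝ}
    (h : (tangentAlgebroid (𝓡 (n + r)) P).IsDifferential Ω (pullback S.H (k + 1) ζ))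
    (h' : (tangentAlgebroid (𝓡 (n + r)) P).IsDifferential Ω (pullback S.H (k + 1) ζ')) : ζ = ζ' := by
  funext x
  obtain ⟨p, rfl⟩ := S.surjective_h x
  refine ContinuousAlternatingMap.ext fun v => ?_
  have h1 := (h (fun i => liftSection hh.contMDiff (constSection hh (v i))) p).trans
    (h' (fun i => liftSection hh.contMDiff (constSection hh (v i))) p).symm
  have h2 : (fun i => S.H p (liftSection hh.contMDiff (constSection hh (v i)) p)) = v :=
    funext fun i => H_liftSection hh.contMDiff (constSection hh (v i)) p
  exact (congrArg (ζ (S.h p)) h2).symm.trans (h1.trans (congrArg (ζ' (S.h p)) h2))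

/-- In degree one, the differential and the anchor recover the bracket paired with `l`, which is
what the uniqueness argument needs. -/
theorem diffOnSections_constForm (L : LieAlgebroid (𝓡 d) (Fib n r) S.A) (l : Fib n r →L[ℝ] ℝ)
    (s t : Cₛ^∞⟮𝓡 d; Fib n r, S.A⟯) (x : S.X) :
    L.diffOnSections (fun _ => ContinuousAlternatingMap.ofSubsingleton ℝ (Fib n r) ℝ (0 : Fin 1) l)
        ![s, t] x =
      mvfderiv (𝓡 d) (fun y => l (t y)) x (L.anchor x (s x)) -
        mvfderiv (𝓡 d) (fun y => l (s y)) x (L.anchor x (t x)) - l (L.bracket s t x) := by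
  simp [LieAlgebroid.diffOnSections, Fin.sum_univ_succ]
  ring

theorem eq_of_isMorphism (hh : Manifold.IsSubmersion (𝓡 (n + r)) (𝓡 d) ∞ S.h)
    {L L' : LieAlgebroid (𝓡 d) (Fib n r) S.A}
    (hL : IsMorphism (tangentAlgebroid (𝓡 (n + r)) P) L S.H)
    (hL' : IsMorphism (tangentAlgebroid (𝓡 (n + r)) P) L' S.H) : L = L' := by
  have hanchor : L.anchor = L'.anchor := by
    funext x
    obtain ⟨p, rfl⟩ := S.surjective_h x
    refine ContinuousLinearMap.ext fun v => ?_
    have h1 : S.H p ((S.coframe p).inverse v) = v := S.isCoframe.apply_frameField (fun _ => v) p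
    have h2 := (hL.anchor_comp p ((S.coframe p).inverse v)).trans
      (hL'.anchor_comp p ((S.coframe p).inverse v)).symm
    exact (congrArg (L.anchor (S.h p)) h1).symm.trans (h2.trans (congrArg (L'.anchor (S.h p)) h1))
  have hbracket : L.bracket = L'.bracket := by
    funext s t
    refine ContMDiffSection.ext fun x => ?_
    -- Each functional `l` on the fibre is a constant 1-form; with equal anchors and equal
    -- differentials, only the bracket term of the degree-one formula is left to compare.
    refine (SeparatingDual.eq_iff_forall_dual_eq (R := ℝ) (V := Fib n r)).2 fun l => ?_
    obtain ⟨ζ, -, h1, h2⟩ := hL.differential 1 _ (constForm_mem_forms S l)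
    obtain ⟨ζ', -, h1', h2'⟩ := hL'.differential 1 _ (constForm_mem_forms S l)
    obtain rfl := pullback_H_eq_of_isDifferential hh h2 h2'
    have h3 := (h1 ![s, t] x).symm.trans (h1' ![s, t] x)
    rw [diffOnSections_constForm, diffOnSections_constForm, hanchor] at h3
    exact sub_right_injective h3
  cases L
  cases L'
  cases hanchor
  cases hbracket
  rfl

end GStructureWithConnection

end GStr

theorem mainTheorem3 {n r d : ℕ}
    {G : Type*} [Group G] [TopologicalSpace G] [ChartedSpace (GStr.Eu r) G] [LieGroup (𝓡 r) ∞ G]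
    (ι : G →* (GStr.Eu n →L[ℝ] GStr.Eu n)ˣ) (hι : GStr.IsClosedLieSubgroup r ι)
    {P : Type*} [TopologicalSpace P] [T2Space P] [SecondCountableTopology P]
    [ChartedSpace (GStr.Eu (n + r)) P] [IsManifold (𝓡 (n + r)) ∞ P] [MulAction Gᵐᵒᵖ P]
    (S : GStr.GStructureWithConnection r ι P) (hS : S.IsFullyRegular d) :
    (∃ _ : ChartedSpace (GStr.Eu d) S.X, IsManifold (𝓡 d) ∞ S.X ∧
      Manifold.IsSubmersion (𝓡 (n + r)) (𝓡 d) ∞ S.h) ∧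
    ∀ [ChartedSpace (GStr.Eu d) S.X] [IsManifold (𝓡 d) ∞ S.X],
      Manifold.IsSubmersion (𝓡 (n + r)) (𝓡 d) ∞ S.h →
      (∀ k : ℕ, Set.BijOn (GStr.pullback S.H k)
        (GStr.forms (𝓡 d) (GStr.Eu n × GStr.LieAlg r) S.A k) (S.invariantForms k)) ∧
      ∃! L : GStr.LieAlgebroid (𝓡 d) (GStr.Eu n × GStr.LieAlg r) S.A,
        GStr.IsMorphism (GStr.tangentAlgebroid (𝓡 (n + r)) P) L S.H := by
  exact ⟨GStr.GStructureWithConnection.exists_smooth_structure hι.isClosedEmbedding.injective hS,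
    fun hh => ⟨GStr.GStructureWithConnection.bijOn_pullback_H hι.isClosedEmbedding.injective hh,
      GStr.GStructureWithConnection.inducedAlgebroid hh,
      GStr.GStructureWithConnection.isMorphism_inducedAlgebroid hh, fun _ hL =>
        GStr.GStructureWithConnection.eq_of_isMorphism hh hL
          (GStr.GStructureWithConnection.isMorphism_inducedAlgebroid hh)⟩⟩
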